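/- Fix the following model of randomized computation (a real RAM): a program works with integer registers, real registers and real arrays; each arithmetic operation on reals ($+,-,\cdot,/,\sqrt{\ }$), each addition or subtraction of indices, each comparison, each memory access, each access to one entry $A_i(j,l)$ or $b_i$ of the input, and each draw of an independent uniform random number in $[0,1]$ costs one step. For real $n\times n$ matrices write $A\bullet X=\sum_{j,l}A(j,l)X(j,l)$ and let $\Vert\cdot\Vert_F$ be the Frobenius norm. **Theorem.** There are a single program of this model and an absolute constant $C$ such that the following holds for all integers $m,n\ge 1$, all real $\varepsilon>0$, all $A_1,\dots,A_m\in\mathbb{R}^{n\times n}$ and $b_1,\dots,b_m\in\mathbb{R}$ with $\Vert A_i\Vert_F\le 1$ and $|b_i|\le 1$ for every $i$, such that there is a symmetric $X^*\succeq 0$ with $\Vert X^*\Vert_F\le 1$ and $A_i\bullet X^*\ge b_i$ for every $i$. 1. On input $m,n,\varepsilon,(A_i),(b_i)$ the program halts with probability at least $1/2$ with an output $X\in\mathbb{R}^{n\times n}$ that is an $\varepsilon$-approximated solution: $A_i\bullet X\ge b_i-\varepsilon$ for every $i$, and $X$ is symmetric with $X\succeq-\varepsilon I$. 2. If $m\ge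 2$ and $\varepsilon\le 1$, then for every outcome of the random numbers the program halts after at most $$C\left(\frac{m\log m}{\varepsilon^2}+\frac{n^2\log m\,\log n}{\varepsilon^{2.5}}\right)$$ steps. -/

import Mathlib

open MeasureTheory

attribute [local instance] Matrix.frobeniusNormedAddCommGroup

noncomputable section

/-! ## Semidefinite feasibility problems -/

/-- The product `A • X = ∑ j, ∑ l, A j l * X j l` of two real matrices. -/
def matDot {n : ℕ} (A X : Matrix (Fin n) (Fin n) ℝ) : ℝ := ∑ j, ∑ l, A j l * X j l

/-- The data of a problem: find `X ⪰ 0` with `A i • X ≥ b i` for all `i`. -/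
structure SDP (m n : ℕ) where
  /-- the constraint matrices -/
  A : Fin m → Matrix (Fin n) (Fin n) ℝ
  /-- the right-hand sides -/
  b : Fin m → ℝ

namespace SDP

variable {m n : ℕ}

/-- `X` is a feasible solution. -/
def IsFeasible (S : SDP m n) (X : Matrix (Fin n) (Fin n) ℝ) : Prop :=
  X.PosSemidef ∧ ∀ i, S.b i ≤ matDot (S.A i) X

/-- `X` is an `ε`-approximated solution: every constraint is violated by at most `ε`, and
`X ⪰ -ε I` (in particular `X` is symmetric). -/
def IsApproxSolution (S : SDP m n) (ε : ℝ) (X : Matrix (Fin n) (Fin n) ℝ) : Prop :=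
  (∀ i, S.b i - ε ≤ matDot (S.A i) X) ∧
    (X + ε • (1 : Matrix (Fin n) (Fin n) ℝ)).PosSemidef

/-- Random access to the entries of the constraint matrices; `0` outside the index range. -/
def entryA (S : SDP m n) (i j l : ℕ) : ℝ :=
  if h : i < m ∧ j < n ∧ l < n then S.A ⟨i, h.1⟩ ⟨j, h.2.1⟩ ⟨l, h.2.2⟩ else 0

/-- Random access to the right-hand sides; `0` outside the index range. -/
def entryB (S : SDP m n) (i : ℕ) : ℝ :=
  if h : i < m then S.b ⟨i, h⟩ else 0

end SDP

/-! ## A randomized real-number random access machine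

Programs of a structured language over integer registers (indices, counters), real registers
and two-index real arrays. Every arithmetic operation, comparison, memory access, access to an
entry of the input, and every draw of a uniform random number from `[0, 1]` costs one step.
Index arithmetic is additive only, and there is no rounding of reals to integers. -/

namespace RealRAM

/-- A memory state. `pos` is the number of random numbers drawn so far. -/
structure State where
  /-- integer registers -/
  nat : ℕ → ℕ
  /-- real registers -/
  real : ℕ → ℝ
  /-- real arrays: name, row, column -/
  arr : ℕ → ℕ → ℕ → ℝ
  /-- number of random numbers consumed -/
  pos : ℕ

/-- All registers and arrays are `0` at the start. -/
def State.init : State := ⟨fun _ => 0, fun _ => 0, fun _ _ _ => 0, 0⟩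

/-- Index expressions. `numConstr` and `dim` are the input sizes `m` and `n`. -/
inductive NatExpr : Type
  | const (k : ℕ)
  | numConstr
  | dim
  | var (x : ℕ)
  | add (e f : NatExpr)
  | sub (e f : NatExpr)

/-- Real expressions. `eps` is the accuracy that is part of the input, `inA` and `inB` are entries
of the input, and `ofNat` converts an index to a real number. -/
inductive RealExpr : Type
  | const (q : ℚ)
  | eps
  | inA (i j l : NatExpr)
  | inB (i : NatExpr)
  | var (x : ℕ)
  | arr (k : ℕ) (i j : NatExpr)
  | ofNat (e : NatExpr)
  | add (e f : RealExpr)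
  | sub (e f : RealExpr)
  | mul (e f : RealExpr)
  | div (e f : RealExpr)
  | sqrt (e : RealExpr)

/-- Tests. -/
inductive Test : Type
  | natLt (e f : NatExpr)
  | realLt (e f : RealExpr)
  | not (c : Test)

/-- Programs. -/
inductive Cmd : Type
  | skip
  | setNat (x : ℕ) (e : NatExpr)
  | setReal (x : ℕ) (e : RealExpr)
  | store (k : ℕ) (i j : NatExpr) (e : RealExpr)
  | sample (x : ℕ)
  | seq (c d : Cmd)
  | ite (c : Test) (d e : Cmd)
  | loop (c : Test) (d : Cmd)

/-- The value of an index expression; subtraction is truncated at `0`. -/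
def NatExpr.eval (m n : ℕ) (s : State) : NatExpr → ℕ
  | .const k => k
  | .numConstr => m
  | .dim => n
  | .var x => s.nat x
  | .add e f => e.eval m n s + f.eval m n s
  | .sub e f => e.eval m n s - f.eval m n s

/-- The number of operations in an index expression. -/
def NatExpr.cost : NatExpr → ℕ
  | .const _ => 1
  | .numConstr => 1
  | .dim => 1
  | .var _ => 1
  | .add e f => 1 + e.cost + f.cost
  | .sub e f => 1 + e.cost + f.cost

/-- The value of a real expression; a quotient by `0` and the square root of a negative number
are `0`. -/
def RealExpr.eval {m n : ℕ} (S : SDP m n) (ε : ℝ) (s : State) : RealExpr → ℝ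
  | .const q => (q : ℝ)
  | .eps => ε
  | .inA i j l => S.entryA (i.eval m n s) (j.eval m n s) (l.eval m n s)
  | .inB i => S.entryB (i.eval m n s)
  | .var x => s.real x
  | .arr k i j => s.arr k (i.eval m n s) (j.eval m n s)
  | .ofNat e => (e.eval m n s : ℝ)
  | .add e f => e.eval S ε s + f.eval S ε s
  | .sub e f => e.eval S ε s - f.eval S ε s
  | .mul e f => e.eval S ε s * f.eval S ε s
  | .div e f => e.eval S ε s / f.eval S ε s
  | .sqrt e => Real.sqrt (e.eval S ε s)

/-- The number of operations in a real expression. -/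
def RealExpr.cost : RealExpr → ℕ
  | .const _ => 1
  | .eps => 1
  | .inA i j l => 1 + i.cost + j.cost + l.cost
  | .inB i => 1 + i.cost
  | .var _ => 1
  | .arr _ i j => 1 + i.cost + j.cost
  | .ofNat e => 1 + e.cost
  | .add e f => 1 + e.cost + f.cost
  | .sub e f => 1 + e.cost + f.cost
  | .mul e f => 1 + e.cost + f.cost
  | .div e f => 1 + e.cost + f.cost
  | .sqrt e => 1 + e.cost

/-- The truth of a test. -/
def Test.Holds {m n : ℕ} (S : SDP m n) (ε : ℝ) (s : State) : Test → Prop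
  | .natLt e f => e.eval m n s < f.eval m n s
  | .realLt e f => e.eval S ε s < f.eval S ε s
  | .not c => ¬ c.Holds S ε s

/-- The number of operations in a test. -/
def Test.cost : Test → ℕ
  | .natLt e f => 1 + e.cost + f.cost
  | .realLt e f => 1 + e.cost + f.cost
  | .not c => 1 + c.cost

/-- Overwrite an integer register. -/
def State.setNat (s : State) (x v : ℕ) : State :=
  { s with nat := Function.update s.nat x v }

/-- Overwrite a real register. -/
def State.setReal (s : State) (x : ℕ) (v : ℝ) : State :=
  { s with real := Function.update s.real x v }

/-- Overwrite one array cell. -/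
def State.store (s : State) (k i j : ℕ) (v : ℝ) : State :=
  { s with arr := fun k' i' j' => if k' = k ∧ i' = i ∧ j' = j then v else s.arr k' i' j' }

/-- Write the next random number of the tape `ω` into a real register. -/
def State.draw (s : State) (ω : ℕ → unitInterval) (x : ℕ) : State :=
  { s with real := Function.update s.real x (ω s.pos : ℝ), pos := s.pos + 1 }

/-- `Exec S ε ω c s t s'`: on the input `(S, ε)` with the random numbers `ω`, the program `c`
started in the state `s` halts in the state `s'` after `t` steps. -/
inductive Exec {m n : ℕ} (S : SDP m n) (ε : ℝ) (ω : ℕ → unitInterval) :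
    Cmd → State → ℕ → State → Prop
  | skip (s : State) : Exec S ε ω .skip s 1 s
  | setNat (s : State) (x : ℕ) (e : NatExpr) :
      Exec S ε ω (.setNat x e) s (1 + e.cost) (s.setNat x (e.eval m n s))
  | setReal (s : State) (x : ℕ) (e : RealExpr) :
      Exec S ε ω (.setReal x e) s (1 + e.cost) (s.setReal x (e.eval S ε s))
  | store (s : State) (k : ℕ) (i j : NatExpr) (e : RealExpr) :
      Exec S ε ω (.store k i j e) s (1 + i.cost + j.cost + e.cost)
        (s.store k (i.eval m n s) (j.eval m n s) (e.eval S ε s))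
  | sample (s : State) (x : ℕ) : Exec S ε ω (.sample x) s 1 (s.draw ω x)
  | seq {c d : Cmd} {s s' s'' : State} {t t' : ℕ} (hc : Exec S ε ω c s t s')
      (hd : Exec S ε ω d s' t' s'') : Exec S ε ω (.seq c d) s (t + t') s''
  | iteTrue {c : Test} {d e : Cmd} {s s' : State} {t : ℕ} (h : c.Holds S ε s)
      (hd : Exec S ε ω d s t s') : Exec S ε ω (.ite c d e) s (1 + c.cost + t) s'
  | iteFalse {c : Test} {d e : Cmd} {s s' : State} {t : ℕ} (h : ¬ c.Holds S ε s)
      (he : Exec S ε ω e s t s') : Exec S ε ω (.ite c d e) s (1 + c.cost + t) s'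
  | loopTrue {c : Test} {d : Cmd} {s s' s'' : State} {t t' : ℕ} (h : c.Holds S ε s)
      (hd : Exec S ε ω d s t s') (hl : Exec S ε ω (.loop c d) s' t' s'') :
      Exec S ε ω (.loop c d) s (1 + c.cost + t + t') s''
  | loopFalse {c : Test} {d : Cmd} {s : State} (h : ¬ c.Holds S ε s) :
      Exec S ε ω (.loop c d) s (1 + c.cost) s

/-- For fixed random numbers, the number of steps and the final state are unique. -/
theorem Exec.unique {m n : ℕ} {S : SDP m n} {ε : ℝ} {ω : ℕ → unitInterval} {c : Cmd}
    {s s₁ s₂ : State} {t₁ t₂ : ℕ} (h₁ : Exec S ε ω c s t₁ s₁) (h₂ : Exec S ε ω c s t₂ s₂) :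
    t₁ = t₂ ∧ s₁ = s₂ := by
  induction h₁ generalizing t₂ s₂ with
  | skip => cases h₂; exact ⟨rfl, rfl⟩
  | setNat => cases h₂; exact ⟨rfl, rfl⟩
  | setReal => cases h₂; exact ⟨rfl, rfl⟩
  | store => cases h₂; exact ⟨rfl, rfl⟩
  | sample => cases h₂; exact ⟨rfl, rfl⟩
  | seq _ _ ih ih' =>
    cases h₂ with
    | seq k k' =>
      obtain ⟨rfl, rfl⟩ := ih k
      obtain ⟨rfl, rfl⟩ := ih' k'
      exact ⟨rfl, rfl⟩
  | iteTrue h _ ih =>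
    cases h₂ with
    | iteTrue _ k => obtain ⟨rfl, rfl⟩ := ih k; exact ⟨rfl, rfl⟩
    | iteFalse k _ => exact absurd h k
  | iteFalse h _ ih =>
    cases h₂ with
    | iteTrue k _ => exact absurd k h
    | iteFalse _ k => obtain ⟨rfl, rfl⟩ := ih k; exact ⟨rfl, rfl⟩
  | loopTrue h _ _ ih ih' =>
    cases h₂ with
    | loopTrue _ k k' =>
      obtain ⟨rfl, rfl⟩ := ih k
      obtain ⟨rfl, rfl⟩ := ih' k'
      exact ⟨rfl, rfl⟩
    | loopFalse k => exact absurd h k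
  | loopFalse h =>
    cases h₂ with
    | loopTrue k _ _ => exact absurd k h
    | loopFalse _ => exact ⟨rfl, rfl⟩

/-- The output of a run: the upper left `n × n` block of array `0`. -/
def State.output (n : ℕ) (s : State) : Matrix (Fin n) (Fin n) ℝ :=
  Matrix.of fun j l => s.arr 0 j l

/-- The law of an infinite sequence of independent uniform random numbers in `[0, 1]`. -/
def uniformTape : Measure (ℕ → unitInterval) :=
  Measure.infinitePi fun _ : ℕ => (volume : Measure unitInterval)

end RealRAM

end

noncomputable section

/-! ## The tape of random numbers -/

namespace RealRAM

/-! The problem is played as a zero-sum game. A primal player chooses a symmetric `X` in the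
Frobenius unit ball, a dual player chooses a distribution on the constraints. Semidefiniteness
enters through the payoff: if `v` approximates an eigenvector for the smallest eigenvalue of `X` and
`vᵀXv < 0`, the penalty `2 vᵀXv / vᵀv` is added. The primal player makes projected gradient steps
for one sampled constraint and the penalty (`primal_regret`); the dual player multiplies the weights
by `1 - βy + (βy)²`, where `y` is an estimated slack (`dual_regret`). With `β` of order `ε` and
about `log m / ε²` rounds, both regrets are small fractions of `εT`. A feasible point never has a
negative payoff, so adding the regrets bounds the accumulated violation of every constraint by the
sampling errors (`violation_le`). The output is the average of the primal points.

A round has to cost `O(m + n² log n / √ε)`. All slacks are estimated from one entry `(J, L)`,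
sampled with probability `X(J,L)² / ‖X‖²`: the number `‖X‖² A(J,L) / X(J,L)` has mean `A • X` and
second moment at most `1`, and clipping it to size `1/(8β)` costs a bias of at most `2β`. The vector
`v` comes from `O(log n / √ε)` Chebyshev steps from a random start. For the polynomials `p` of the
fourth kind, `|x| p(x)²` is at most `1` on `[-1, 0]` and equals `sinh² ((2k+1) arsinh √x)` for `x ≥
0`, so components with large violation are amplified against all others (`exists_eigErr_bound`). The
factor `2` in the penalty makes it sufficient to find half of the largest violation.

A single eigenvector computation may fail with noticeable probability. Its error is at most `1`,
however, and has mean at most `ε/16` (`lintegral_eigErr_le`), which is enough to bound an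
exponential moment. The exponential of `β` times the total error is a product over the rounds whose
mean is bounded one factor at a time (`lintegral_expErr_le`). Markov's inequality and a union bound
over the constraints then give success with probability at least `1/2`
(`half_le_uniformTape_iterOutput`).

A trivial constraint `0 ≥ 0` is appended. Its slack is always `0`, so the bound for it controls the
penalties and eigenvector errors alone, and this is the lower bound on the eigenvalues of the
average (`iterOutput_isApprox`).

The lengths of all loops depend on `m`, `n` and `ε` only, so the time bound holds for every outcome
of the random numbers. A small program logic of total correctness with step counts and frames
(`Runs`, `Frame`) shows that the program computes `iterOutput` (`Runs.solveCmd`). -/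

instance : IsProbabilityMeasure uniformTape := by
  unfold uniformTape; infer_instance

/-- Drawing one coordinate of the tape afresh does not change its law. -/
theorem measurePreserving_update (j : ℕ) :
    MeasurePreserving (fun p : (ℕ → unitInterval) × unitInterval => Function.update p.1 j p.2)
      (uniformTape.prod volume) uniformTape := by
  have hm : Measurable
      (fun p : (ℕ → unitInterval) × unitInterval => Function.update p.1 j p.2) := by
    refine measurable_pi_lambda _ fun i => ?_
    by_cases h : i = j
    · subst h; simpa using measurable_snd
    · simp only [Function.update_of_ne h]
      exact (measurable_pi_apply i).comp measurable_fst
  refine ⟨hm, ?_⟩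
  refine Measure.eq_infinitePi (fun _ : ℕ => (volume : Measure unitInterval)) fun s t ht => ?_
  have hs : MeasurableSet (Set.pi (s : Set ℕ) t) :=
    MeasurableSet.pi s.countable_toSet fun i _ => ht i
  rw [Measure.map_apply hm hs]
  -- Cylinders determine the law. The preimage of one is a rectangle: the old tape keeps the
  -- conditions away from `j`, the fresh number takes the condition at `j`, if there is one.
  have key : (fun p : (ℕ → unitInterval) × unitInterval => Function.update p.1 j p.2) ⁻¹'
      (Set.pi (s : Set ℕ) t) =
      (Set.pi ((s.erase j : Finset ℕ) : Set ℕ) t) ×ˢ (if j ∈ s then t j else Set.univ) := by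
    ext ⟨ω, u⟩
    simp only [Set.mem_preimage, Set.mem_pi, Finset.mem_coe, Set.mem_prod, Finset.mem_erase]
    constructor
    · intro h
      refine ⟨fun i hi => by simpa [Function.update_of_ne hi.1] using h i hi.2, ?_⟩
      split_ifs with hj
      · simpa using h j hj
      · trivial
    · rintro ⟨h, hj⟩ i hi
      by_cases hij : i = j
      · subst hij; simpa [hi] using hj
      · simpa [Function.update_of_ne hij] using h i ⟨hij, hi⟩
  rw [key, Measure.prod_prod, uniformTape, Measure.infinitePi_pi _ (fun i _ => ht i)]
  split_ifs with hj
  · rw [Finset.prod_erase_mul _ _ hj]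
  · rw [Finset.erase_eq_of_notMem hj]; simp

/-- Stands in for a bound on a conditional expectation: `F` ignores the coordinate `j`, so this
coordinate can be drawn afresh and integrated first. -/
theorem lintegral_mul_le_of_resample (j : ℕ) {F G G' : (ℕ → unitInterval) → ENNReal}
    (hF : Measurable F) (hG : Measurable G)
    (hFj : ∀ ω u, F (Function.update ω j u) = F ω)
    (hGj : ∀ ω, ∫⁻ u, G (Function.update ω j u) ≤ G' ω) :
    ∫⁻ ω, F ω * G ω ∂uniformTape ≤ ∫⁻ ω, F ω * G' ω ∂uniformTape := by
  have hmp := measurePreserving_update j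
  have hFG : Measurable fun ω => F ω * G ω := hF.mul hG
  rw [← hmp.lintegral_comp hFG]
  have hc : Measurable fun p : (ℕ → unitInterval) × unitInterval =>
      F (Function.update p.1 j p.2) * G (Function.update p.1 j p.2) := hFG.comp hmp.measurable
  rw [lintegral_prod _ hc.aemeasurable]
  refine lintegral_mono fun ω => ?_
  simp only [hFj]
  rw [lintegral_const_mul]
  · gcongr; exact hGj ω
  · exact hG.comp (hmp.measurable.comp measurable_prodMk_left)

/-- The tape `ω` with the coordinates in `J` replaced by those of `ω'`. -/
def override (J : Set ℕ) (ω ω' : ℕ → unitInterval) : ℕ → unitInterval :=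
  open Classical in fun i => if i ∈ J then ω' i else ω i

theorem override_of_mem {J : Set ℕ} {i : ℕ} (h : i ∈ J) (ω ω' : ℕ → unitInterval) :
    override J ω ω' i = ω' i := by simp [override, h]

theorem override_of_notMem {J : Set ℕ} {i : ℕ} (h : i ∉ J) (ω ω' : ℕ → unitInterval) :
    override J ω ω' i = ω i := by simp [override, h]

/-- Drawing a block of coordinates of the tape afresh does not change its law. -/
theorem measurePreserving_override (J : Set ℕ) :
    MeasurePreserving (fun p : (ℕ → unitInterval) × (ℕ → unitInterval) => override J p.1 p.2)
      (uniformTape.prod uniformTape) uniformTape := by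
  classical
  have hm : Measurable
      (fun p : (ℕ → unitInterval) × (ℕ → unitInterval) => override J p.1 p.2) := by
    refine measurable_pi_lambda _ fun i => ?_
    by_cases h : i ∈ J
    · simp only [override_of_mem h]
      exact (measurable_pi_apply i).comp measurable_snd
    · simp only [override_of_notMem h]
      exact (measurable_pi_apply i).comp measurable_fst
  refine ⟨hm, ?_⟩
  refine Measure.eq_infinitePi (fun _ : ℕ => (volume : Measure unitInterval)) fun s t ht => ?_
  have hs : MeasurableSet (Set.pi (s : Set ℕ) t) :=
    MeasurableSet.pi s.countable_toSet fun i _ => ht i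
  rw [Measure.map_apply hm hs]
  have key : (fun p : (ℕ → unitInterval) × (ℕ → unitInterval) => override J p.1 p.2) ⁻¹'
      (Set.pi (s : Set ℕ) t) =
      (Set.pi ((s.filter (· ∉ J) : Finset ℕ) : Set ℕ) t) ×ˢ
        (Set.pi ((s.filter (· ∈ J) : Finset ℕ) : Set ℕ) t) := by
    ext ⟨ω, ω'⟩
    simp only [Set.mem_preimage, Set.mem_pi, Finset.mem_coe, Set.mem_prod, Finset.mem_filter]
    constructor
    · intro h
      exact ⟨fun i hi => by simpa [override_of_notMem hi.2] using h i hi.1,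
        fun i hi => by simpa [override_of_mem hi.2] using h i hi.1⟩
    · rintro ⟨h, h'⟩ i hi
      by_cases hij : i ∈ J
      · simpa [override_of_mem hij] using h' i ⟨hi, hij⟩
      · simpa [override_of_notMem hij] using h i ⟨hi, hij⟩
  rw [key, Measure.prod_prod, uniformTape, Measure.infinitePi_pi _ (fun i _ => ht i),
    Measure.infinitePi_pi _ (fun i _ => ht i), mul_comm, Finset.prod_filter_mul_prod_filter_not]

/-- The block version, used with `J = Set.Ici q` to separate past from future: `F` is determined by
the draws before `q`, and `G` is averaged over the later ones while the past is frozen. -/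
theorem lintegral_mul_le_of_override (J : Set ℕ) {F G : (ℕ → unitInterval) → ENNReal}
    {c : ENNReal} (hF : Measurable F) (hG : Measurable G)
    (hFJ : ∀ ω ω', F (override J ω ω') = F ω)
    (hGJ : ∀ ω, ∫⁻ ω', G (override J ω ω') ∂uniformTape ≤ c) :
    ∫⁻ ω, F ω * G ω ∂uniformTape ≤ c * ∫⁻ ω, F ω ∂uniformTape := by
  have hmp := measurePreserving_override J
  have hFG : Measurable fun ω => F ω * G ω := hF.mul hG
  rw [← hmp.lintegral_comp hFG]
  have hc : Measurable fun p : (ℕ → unitInterval) × (ℕ → unitInterval) =>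
      F (override J p.1 p.2) * G (override J p.1 p.2) := hFG.comp hmp.measurable
  rw [lintegral_prod _ hc.aemeasurable, mul_comm, ← lintegral_mul_const _ hF]
  refine lintegral_mono fun ω => ?_
  simp only [hFJ]
  rw [lintegral_const_mul]
  · gcongr; exact hGJ ω
  · exact hG.comp (hmp.measurable.comp measurable_prodMk_left)

/-- A bound on the mean over one coordinate, uniform in the other ones, bounds the mean. -/
theorem lintegral_le_of_resample (j : ℕ) {G : (ℕ → unitInterval) → ENNReal} {c : ENNReal}
    (hG : Measurable G) (hGj : ∀ ω, ∫⁻ u, G (Function.update ω j u) ≤ c) :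
    ∫⁻ ω, G ω ∂uniformTape ≤ c := by
  simpa using lintegral_mul_le_of_resample j measurable_one hG (fun _ _ => rfl) hGj

theorem volume_setOf_le_unitInterval (a b : ℝ) :
    volume {u : unitInterval | a ≤ u ∧ (u : ℝ) ≤ b} ≤ ENNReal.ofReal (b - a) := by
  have h : MeasurableEmbedding (Subtype.val : unitInterval → ℝ) :=
    MeasurableEmbedding.subtype_coe measurableSet_Icc
  have e : (volume : Measure unitInterval) = Measure.comap Subtype.val volume := rfl
  rw [e, h.comap_apply, ← Real.volume_Icc]
  exact measure_mono (by rintro _ ⟨u, hu, rfl⟩; exact hu)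

end RealRAM

/-! ## Sampling an index with given weights -/

section Pick

variable {N : ℕ}

/-- The sum of the weights of index below `i`. -/
def prefixSum (w : Fin N → ℝ) (i : ℕ) : ℝ := ∑ j : Fin N, if (j : ℕ) < i then w j else 0

@[simp] theorem prefixSum_zero (w : Fin N → ℝ) : prefixSum w 0 = 0 := by simp [prefixSum]

theorem prefixSum_succ (w : Fin N → ℝ) {i : ℕ} (h : i < N) :
    prefixSum w (i + 1) = prefixSum w i + w ⟨i, h⟩ := by
  have : w ⟨i, h⟩ = ∑ j : Fin N, if j = ⟨i, h⟩ then w j else 0 := by simp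
  rw [this, prefixSum, prefixSum, ← Finset.sum_add_distrib]
  refine Finset.sum_congr rfl fun j _ => ?_
  by_cases h1 : j = ⟨i, h⟩
  · subst h1; simp
  · have h2 : (j : ℕ) ≠ i := fun h' => h1 (Fin.ext h')
    by_cases h3 : (j : ℕ) < i
    · simp [h1, h3, Nat.lt_succ_of_lt h3]
    · have : ¬ (j : ℕ) < i + 1 := by omega
      simp [h1, h3, this]

theorem prefixSum_self (w : Fin N → ℝ) : prefixSum w N = ∑ j, w j := by simp [prefixSum]

/-- The last index whose prefix sum is at most `u` times the total weight. -/
def pickNat (w : Fin N → ℝ) (u : ℝ) : ℕ → ℕ :=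
  open Classical in Nat.findGreatest fun i => prefixSum w i ≤ u * ∑ j, w j

/-- The index sampled by the random number `u` with probabilities proportional to `w`. -/
def pick [NeZero N] (w : Fin N → ℝ) (u : ℝ) : Fin N :=
  ⟨pickNat w u (N - 1), lt_of_le_of_lt (Nat.findGreatest_le _)
    (Nat.sub_lt (Nat.pos_of_ne_zero (NeZero.ne N)) one_pos)⟩

theorem prefixSum_pick_le [NeZero N] {w : Fin N → ℝ} {u : ℝ} (hu : 0 ≤ u) (hw : 0 ≤ ∑ j, w j) :
    prefixSum w (pick w u) ≤ u * ∑ j, w j := by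
  classical
  exact Nat.findGreatest_spec (P := fun i => prefixSum w i ≤ u * ∑ j, w j) (Nat.zero_le (N - 1))
    (by simpa using mul_nonneg hu hw)

theorem le_prefixSum_pick_succ [NeZero N] {w : Fin N → ℝ} {u : ℝ} (hu : u ≤ 1)
    (hw : 0 ≤ ∑ j, w j) : u * ∑ j, w j ≤ prefixSum w (pick w u + 1) := by
  classical
  by_cases h : (pick w u : ℕ) + 1 ≤ N - 1
  · exact (not_le.1 (Nat.findGreatest_is_greatest
      (P := fun i => prefixSum w i ≤ u * ∑ j, w j) (Nat.lt_succ_self _) h)).le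
  -- At the last index the search range ends, so maximality says nothing; but there the prefix sum
  -- is the whole weight and `u ≤ 1` suffices.
  · have h1 := (pick w u).2
    have h2 : (pick w u : ℕ) + 1 = N := by omega
    rw [h2, prefixSum_self]
    nlinarith

/-- The numbers `u` that select `i` lie in a closed interval of length `w i / W`. An upper bound is
all that is needed later, so the common endpoints of adjacent intervals do no harm. -/
theorem lintegral_pick_le [NeZero N] {w : Fin N → ℝ} (hw : 0 < ∑ j, w j) (f : Fin N → ENNReal) :
    ∫⁻ u : unitInterval, f (pick w u) ≤ ∑ i, ENNReal.ofReal (w i / ∑ j, w j) * f i := by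
  set W := ∑ j, w j with hW
  let A : Fin N → Set unitInterval :=
    fun i => {u | prefixSum w i / W ≤ u ∧ (u : ℝ) ≤ prefixSum w (i + 1) / W}
  have hA : ∀ i, MeasurableSet (A i) := fun i =>
    (measurableSet_le measurable_const measurable_subtype_coe).inter
      (measurableSet_le measurable_subtype_coe measurable_const)
  have hle : ∀ u : unitInterval, f (pick w u) ≤ ∑ i, (A i).indicator (fun _ => f i) u := by
    intro u
    have hu : u ∈ A (pick w u) := by
      constructor
      · rw [div_le_iff₀ hw]; exact prefixSum_pick_le u.2.1 hw.le
      · rw [le_div_iff₀ hw]; exact le_prefixSum_pick_succ u.2.2 hw.le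
    calc f (pick w u) = (A (pick w u)).indicator (fun _ => f (pick w u)) u := by
          rw [Set.indicator_of_mem hu]
      _ ≤ _ := Finset.single_le_sum
          (f := fun i => (A i).indicator (fun _ => f i) u) (fun _ _ => zero_le) (Finset.mem_univ _)
  calc ∫⁻ u : unitInterval, f (pick w u)
      ≤ ∫⁻ u : unitInterval, ∑ i, (A i).indicator (fun _ => f i) u := lintegral_mono hle
    _ = ∑ i, f i * volume (A i) := by
        rw [lintegral_finsetSum _ fun i _ => measurable_const.indicator (hA i)]
        exact Finset.sum_congr rfl fun i _ => lintegral_indicator_const (hA i) _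
    _ ≤ _ := by
        refine Finset.sum_le_sum fun i _ => ?_
        rw [mul_comm]
        gcongr
        refine (RealRAM.volume_setOf_le_unitInterval _ _).trans (le_of_eq ?_)
        rw [prefixSum_succ w i.2]; congr 1; ring

theorem measurable_pick {Ω : Type*} [MeasurableSpace Ω] [NeZero N] {w : Ω → Fin N → ℝ} {u : Ω → ℝ}
    (hw : ∀ i, Measurable fun ω => w ω i) (hu : Measurable u) :
    Measurable fun ω => pick (w ω) (u ω) := by
  classical
  have h1 : Measurable fun ω => pickNat (w ω) (u ω) (N - 1) := by
    refine measurable_findGreatest fun k _ => measurableSet_le ?_ ?_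
    · refine Finset.measurable_sum _ fun i _ => ?_
      split_ifs
      · exact hw i
      · exact measurable_const
    · exact hu.mul (Finset.measurable_sum _ fun i _ => hw i)
  have h2 : Measurable fun k : ℕ => if h : k < N then (⟨k, h⟩ : Fin N) else 0 :=
    measurable_from_top
  convert h2.comp h1 using 1
  ext ω
  have := (pick (w ω) (u ω)).2
  simp only [pick] at this
  simp [pick, this]

end Pick
end

noncomputable section

/-! ## Chebyshev polynomials of the fourth kind, shifted to `[-1, 0]` -/

/-- The pair of the shifted Chebyshev polynomials of the fourth kind of degrees `k` and `k - 1`. -/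
def chebPair (x : ℝ) : ℕ → ℝ × ℝ
  | 0 => (1, -1)
  | k + 1 => (2 * (chebPair x k).1 + 4 * x * (chebPair x k).1 - (chebPair x k).2,
      (chebPair x k).1)

/-- `cheb x k` is the shifted Chebyshev polynomial of the fourth kind of degree `k` at `x`. -/
def cheb (x : ℝ) (k : ℕ) : ℝ := (chebPair x k).1

/-- Since `2 + 4 sinh² s = 2 cosh 2s`, the recursion is the addition theorem for `sinh` at odd
multiples of `s`; the initial pair `(1, -1)` corresponds to `sinh (±s)`. -/
theorem chebPair_sinh (s : ℝ) (k : ℕ) :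
    (chebPair (Real.sinh s ^ 2) k).1 * Real.sinh s = Real.sinh ((2 * k + 1) * s) ∧
    (chebPair (Real.sinh s ^ 2) k).2 * Real.sinh s = Real.sinh ((2 * k - 1) * s) := by
  induction k with
  | zero => simp [chebPair, Real.sinh_neg]
  | succ k ih =>
    refine ⟨?_, ?_⟩
    · have e : Real.sinh ((2 * ((k + 1 : ℕ) : ℝ) + 1) * s) =
          Real.sinh ((2 * k + 1) * s + 2 * s) := by push_cast; ring_nf
      have e' : Real.sinh ((2 * (k : ℝ) - 1) * s) =
          Real.sinh ((2 * k + 1) * s - 2 * s) := by ring_nf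
      have h1 := ih.1
      have h2 := ih.2
      rw [e', Real.sinh_sub] at h2
      rw [e, Real.sinh_add]
      have h3 : Real.cosh (2 * s) = 1 + 2 * Real.sinh s ^ 2 := by
        rw [Real.cosh_two_mul, Real.cosh_sq]; ring
      rw [h3] at h2 ⊢
      simp only [chebPair]
      linear_combination (2 + 4 * Real.sinh s ^ 2) * h1 - h2
    · have := ih.1
      simp only [chebPair]
      rw [this]; push_cast; ring_nf

theorem chebPair_sin (s : ℝ) (k : ℕ) :
    (chebPair (-Real.sin s ^ 2) k).1 * Real.sin s = Real.sin ((2 * k + 1) * s) ∧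
    (chebPair (-Real.sin s ^ 2) k).2 * Real.sin s = Real.sin ((2 * k - 1) * s) := by
  induction k with
  | zero => simp [chebPair]
  | succ k ih =>
    refine ⟨?_, ?_⟩
    · have e : Real.sin ((2 * ((k + 1 : ℕ) : ℝ) + 1) * s) =
          Real.sin ((2 * k + 1) * s + 2 * s) := by push_cast; ring_nf
      have e' : Real.sin ((2 * (k : ℝ) - 1) * s) =
          Real.sin ((2 * k + 1) * s - 2 * s) := by ring_nf
      have h1 := ih.1
      have h2 := ih.2
      rw [e', Real.sin_sub] at h2
      rw [e, Real.sin_add]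
      have h3 : Real.cos (2 * s) = 1 - 2 * Real.sin s ^ 2 := by
        rw [Real.cos_two_mul, Real.cos_sq']; ring
      rw [h3] at h2 ⊢
      simp only [chebPair]
      linear_combination (2 - 4 * Real.sin s ^ 2) * h1 - h2
    · have := ih.1
      simp only [chebPair]
      rw [this]; push_cast; ring_nf

theorem mul_cheb_sq_of_nonneg {x : ℝ} (hx : 0 ≤ x) (k : ℕ) :
    x * cheb x k ^ 2 = Real.sinh ((2 * k + 1) * Real.arsinh √x) ^ 2 := by
  have h := (chebPair_sinh (Real.arsinh √x) k).1
  rw [Real.sinh_arsinh, Real.sq_sqrt hx] at h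
  rw [← h, mul_pow, Real.sq_sqrt hx, cheb]; ring

/-- This bound dictates the choice of the fourth kind: in the quadratic form of the iterate the
squared polynomial appears with the weight `-μ`, and exactly this product stays below `1` on the
harmless part `[-1, 0]` of the spectrum. -/
theorem neg_mul_cheb_sq_le_one {x : ℝ} (hx : -1 ≤ x) (hx' : x ≤ 0) (k : ℕ) :
    -x * cheb x k ^ 2 ≤ 1 := by
  have h := (chebPair_sin (Real.arcsin √(-x)) k).1
  have h1 : √(-x) ≤ 1 := Real.sqrt_le_one.2 (by linarith)
  rw [Real.sin_arcsin (by linarith [Real.sqrt_nonneg (-x)]) h1, Real.sq_sqrt (by linarith),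
    neg_neg] at h
  have h2 := Real.sin_sq_le_one ((2 * k + 1) * Real.arcsin √(-x))
  rw [← h, mul_pow, Real.sq_sqrt (by linarith)] at h2
  rw [cheb]; linarith

/-- The increments have to be carried along in the induction: `p (k+1) - p k = (p k - p (k-1)) + 4 x
p k`, so values and increments are monotone in `x` together. -/
theorem chebPair_bounds {x y : ℝ} (hx : 0 ≤ x) (hxy : x ≤ y) (k : ℕ) :
    (chebPair x k).1 ≤ (chebPair y k).1 ∧ 1 ≤ (chebPair x k).1 ∧
    (chebPair x k).1 - (chebPair x k).2 ≤ (chebPair y k).1 - (chebPair y k).2 ∧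
    0 ≤ (chebPair x k).1 - (chebPair x k).2 := by
  induction k with
  | zero => simp [chebPair]
  | succ k ih =>
    obtain ⟨h1, h2, h3, h4⟩ := ih
    simp only [chebPair]
    have h5 : x * (chebPair x k).1 ≤ y * (chebPair y k).1 := by
      apply mul_le_mul hxy h1 (by linarith) (by linarith)
    have h6 : 0 ≤ x * (chebPair x k).1 := mul_nonneg hx (by linarith)
    refine ⟨?_, ?_, ?_, ?_⟩ <;> linarith

theorem cheb_le_cheb {x y : ℝ} (hx : 0 ≤ x) (hxy : x ≤ y) (k : ℕ) : cheb x k ≤ cheb y k :=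
  (chebPair_bounds hx hxy k).1

theorem one_le_cheb {x : ℝ} (hx : 0 ≤ x) (k : ℕ) : 1 ≤ cheb x k :=
  (chebPair_bounds hx le_rfl k).2.1

theorem abs_sin_odd_le (k : ℕ) (s : ℝ) :
    |Real.sin ((2 * k + 1) * s)| ≤ (2 * k + 1) * |Real.sin s| := by
  induction k with
  | zero => simp
  | succ k ih =>
    have e : (2 * ((k + 1 : ℕ) : ℝ) + 1) * s = (2 * k + 1) * s + 2 * s := by push_cast; ring
    rw [e, Real.sin_add]
    have h1 : |Real.cos (2 * s)| ≤ 1 := Real.abs_cos_le_one _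
    have h2 : |Real.sin (2 * s)| ≤ 2 * |Real.sin s| := by
      rw [Real.sin_two_mul, abs_mul, abs_mul, abs_two]
      nlinarith [Real.abs_cos_le_one s, abs_nonneg (Real.sin s)]
    have h3 : |Real.cos ((2 * k + 1) * s)| ≤ 1 := Real.abs_cos_le_one _
    calc _ ≤ |Real.sin ((2 * k + 1) * s) * Real.cos (2 * s)| +
          |Real.cos ((2 * k + 1) * s) * Real.sin (2 * s)| := abs_add_le _ _
      _ ≤ |Real.sin ((2 * k + 1) * s)| * 1 + 1 * |Real.sin (2 * s)| := by
          rw [abs_mul, abs_mul]; gcongr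
      _ ≤ _ := by push_cast; linarith

theorem cheb_zero (k : ℕ) : chebPair 0 k = (2 * (k : ℝ) + 1, 2 * (k : ℝ) - 1) := by
  induction k with
  | zero => simp [chebPair]
  | succ k ih => simp only [chebPair, ih]; push_cast; ext <;> simp <;> ring

theorem abs_cheb_le_of_nonpos {x : ℝ} (hx : -1 ≤ x) (hx' : x ≤ 0) (k : ℕ) :
    |cheb x k| ≤ cheb 0 k := by
  rcases hx'.eq_or_lt with rfl | hlt
  · rw [abs_of_nonneg (by linarith [one_le_cheb le_rfl k])]
  have h := (chebPair_sin (Real.arcsin √(-x)) k).1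
  have h1 : √(-x) ≤ 1 := Real.sqrt_le_one.2 (by linarith)
  have h0 : 0 < √(-x) := Real.sqrt_pos.2 (by linarith)
  have h2 := abs_sin_odd_le k (Real.arcsin √(-x))
  rw [Real.sin_arcsin (by linarith) h1] at h h2
  rw [Real.sq_sqrt (by linarith), neg_neg] at h
  rw [← h, abs_mul] at h2
  have := le_of_mul_le_mul_right h2 (abs_pos.2 h0.ne')
  rw [cheb, cheb, cheb_zero]; simpa using this

/-! ## The growth of the polynomials -/

/-- Mean value inequality for `sinh`: its derivative is at most `√2 < 1.42` up to `arsinh 1`, while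
`√x - √(x/2) ≥ 0.29 √x`, and `0.29 / 1.42 > 1/5`. -/
theorem sub_le_arsinh_sub {x : ℝ} (hx : 0 ≤ x) (hx1 : x ≤ 1) :
    √x / 5 ≤ Real.arsinh √x - Real.arsinh √(x / 2) := by
  set s₁ := Real.arsinh √x
  set s₂ := Real.arsinh √(x / 2)
  have e1 : Real.sinh s₁ = √x := Real.sinh_arsinh _
  have e2 : Real.sinh s₂ = √(x / 2) := Real.sinh_arsinh _
  have h12 : s₂ ≤ s₁ := Real.arsinh_le_arsinh.2 (Real.sqrt_le_sqrt (by linarith))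
  have h20 : 0 ≤ s₂ := Real.arsinh_nonneg_iff.2 (Real.sqrt_nonneg _)
  have hc : Real.cosh s₁ ≤ 1.42 := by
    have : Real.cosh s₁ ^ 2 ≤ 2 := by rw [Real.cosh_sq, e1, Real.sq_sqrt hx]; linarith
    nlinarith [Real.cosh_pos s₁]
  have hmv : Real.sinh s₁ - Real.sinh s₂ ≤ 1.42 * (s₁ - s₂) := by
    refine Convex.image_sub_le_mul_sub_of_deriv_le (D := Set.Icc s₂ s₁) (convex_Icc _ _)
      Real.continuous_sinh.continuousOn Real.differentiable_sinh.differentiableOn ?_ s₂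
      (by simp [h12]) s₁ (by simp [h12]) h12
    intro y hy
    rw [interior_Icc] at hy
    rw [Real.deriv_sinh]
    refine le_trans ?_ hc
    rw [Real.cosh_le_cosh, abs_of_nonneg (by linarith [hy.1]), abs_of_nonneg (by linarith)]
    exact hy.2.le
  have h3 : √(x / 2) ≤ 0.71 * √x := by
    rw [Real.sqrt_le_left (by positivity), mul_pow, Real.sq_sqrt hx]; linarith
  rw [e1, e2] at hmv
  have := Real.sqrt_nonneg x
  linarith

theorem cosh_mul_sinh_le {K s₁ s₂ : ℝ} (hK : 0 ≤ K) (h2 : 0 ≤ s₂) :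
    Real.cosh (K * s₂) * Real.sinh (K * (s₁ - s₂)) ≤ Real.sinh (K * s₁) := by
  have e : K * s₁ = K * s₂ + K * (s₁ - s₂) := by ring
  rw [e, Real.sinh_add]
  have := mul_nonneg (Real.sinh_nonneg_iff.2 (mul_nonneg hK h2))
    (Real.cosh_pos (K * (s₁ - s₂))).le
  linarith

/-- The ratio of the weighted polynomials at `x / 2` and at `x`. -/
theorem cheb_ratio {x : ℝ} (hx : 0 < x) (hx1 : x ≤ 1) (k : ℕ) :
    (x / 2 * cheb (x / 2) k ^ 2 + 1) * Real.sinh ((2 * k + 1) * (√x / 5)) ^ 2 ≤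
      x * cheb x k ^ 2 := by
  rw [mul_cheb_sq_of_nonneg hx.le, mul_cheb_sq_of_nonneg (by linarith)]
  set s₁ := Real.arsinh √x
  set s₂ := Real.arsinh √(x / 2)
  have h12 : s₂ ≤ s₁ := Real.arsinh_le_arsinh.2 (Real.sqrt_le_sqrt (by linarith))
  have h20 : 0 ≤ s₂ := Real.arsinh_nonneg_iff.2 (Real.sqrt_nonneg _)
  rw [← Real.cosh_sq, ← mul_pow]
  have hd := sub_le_arsinh_sub hx.le hx1
  have h0 : 0 ≤ Real.sinh ((2 * (k : ℝ) + 1) * (√x / 5)) := Real.sinh_nonneg_iff.2 (by positivity)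
  refine pow_le_pow_left₀ (mul_nonneg (Real.cosh_pos _).le h0) ?_ 2
  refine le_trans ?_ (cosh_mul_sinh_le (by positivity) h20)
  refine mul_le_mul_of_nonneg_left ?_ (Real.cosh_pos _).le
  exact Real.sinh_le_sinh.2 (mul_le_mul_of_nonneg_left hd (by positivity))

end

noncomputable section

/-! ## The inner product of matrices -/

section MatDot

variable {n : ℕ}

theorem matDot_eq_sum (A X : Matrix (Fin n) (Fin n) ℝ) :
    matDot A X = ∑ q : Fin n × Fin n, A q.1 q.2 * X q.1 q.2 := by
  rw [Fintype.sum_prod_type]; rfl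

theorem matDot_self_nonneg (A : Matrix (Fin n) (Fin n) ℝ) : 0 ≤ matDot A A :=
  Finset.sum_nonneg fun _ _ => Finset.sum_nonneg fun _ _ => mul_self_nonneg _

theorem matDot_comm (A B : Matrix (Fin n) (Fin n) ℝ) : matDot A B = matDot B A := by
  simp [matDot, mul_comm]

theorem matDot_add_right (A B C : Matrix (Fin n) (Fin n) ℝ) :
    matDot A (B + C) = matDot A B + matDot A C := by
  simp [matDot, mul_add, Finset.sum_add_distrib]

theorem matDot_smul_right (A B : Matrix (Fin n) (Fin n) ℝ) (c : ℝ) :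
    matDot A (c • B) = c * matDot A B := by
  simp only [matDot, Finset.mul_sum, Matrix.smul_apply, smul_eq_mul]
  exact Finset.sum_congr rfl fun _ _ => Finset.sum_congr rfl fun _ _ => by ring

theorem matDot_sub_right (A B C : Matrix (Fin n) (Fin n) ℝ) :
    matDot A (B - C) = matDot A B - matDot A C := by
  simp [matDot, mul_sub, Finset.sum_sub_distrib]

theorem matDot_add_left (A B C : Matrix (Fin n) (Fin n) ℝ) :
    matDot (A + B) C = matDot A C + matDot B C := by
  simp [matDot, add_mul, Finset.sum_add_distrib]

theorem matDot_sub_left (A B C : Matrix (Fin n) (Fin n) ℝ) :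
    matDot (A - B) C = matDot A C - matDot B C := by
  simp [matDot, sub_mul, Finset.sum_sub_distrib]

theorem matDot_smul_left (A B : Matrix (Fin n) (Fin n) ℝ) (c : ℝ) :
    matDot (c • A) B = c * matDot A B := by
  rw [matDot_comm, matDot_smul_right, matDot_comm]

theorem matDot_sq_le (A B : Matrix (Fin n) (Fin n) ℝ) :
    matDot A B ^ 2 ≤ matDot A A * matDot B B := by
  simp only [matDot_eq_sum, ← pow_two]
  exact Finset.sum_mul_sq_le_sq_mul_sq _ _ _

theorem abs_matDot_le_one {A B : Matrix (Fin n) (Fin n) ℝ} (hA : matDot A A ≤ 1)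
    (hB : matDot B B ≤ 1) : |matDot A B| ≤ 1 := by
  rw [← sq_le_one_iff_abs_le_one]
  have := matDot_sq_le A B
  have := matDot_self_nonneg B
  nlinarith

theorem matDot_self_eq_norm_sq (A : Matrix (Fin n) (Fin n) ℝ) : matDot A A = ‖A‖ ^ 2 := by
  have h0 : 0 ≤ ∑ i, ∑ j, ‖A i j‖ ^ (2 : ℝ) := by positivity
  rw [Matrix.frobenius_norm_def, ← Real.sqrt_eq_rpow, Real.sq_sqrt h0]
  simp [matDot, pow_two]

theorem matDot_self_le_one {A : Matrix (Fin n) (Fin n) ℝ} (h : ‖A‖ ≤ 1) : matDot A A ≤ 1 := by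
  rw [matDot_self_eq_norm_sq]; exact pow_le_one₀ (norm_nonneg _) h

open Matrix in
theorem dotProduct_mulVec_eq_matDot (X : Matrix (Fin n) (Fin n) ℝ) (x : Fin n → ℝ) :
    x ⬝ᵥ (X *ᵥ x) = matDot (vecMulVec x x) X := by
  simp only [dotProduct, mulVec, matDot, vecMulVec_apply, Finset.mul_sum]
  exact Finset.sum_congr rfl fun _ _ => Finset.sum_congr rfl fun _ _ => by ring

open Matrix in
theorem matDot_vecMulVec_self (x : Fin n → ℝ) :
    matDot (vecMulVec x x) (vecMulVec x x) = (x ⬝ᵥ x) ^ 2 := by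
  simp only [dotProduct, matDot, vecMulVec_apply, pow_two, Finset.sum_mul_sum]
  exact Finset.sum_congr rfl fun _ _ => Finset.sum_congr rfl fun _ _ => by ring

end MatDot

/-! ## Approximate eigenvectors -/

open Matrix

variable {n : ℕ}

/-- The numbers `μ i` are the eigenvalues of `-X`, so positive ones measure violations of
semidefiniteness and match the variable of `cheb`. -/
theorem exists_eigenbasis {X : Matrix (Fin n) (Fin n) ℝ} (hX : X.IsHermitian) :
    ∃ (U : Fin n → Fin n → ℝ) (μ : Fin n → ℝ),
      (∀ i x, U i ⬝ᵥ (X *ᵥ x) = -μ i * (U i ⬝ᵥ x)) ∧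
      (∀ x y, x ⬝ᵥ y = ∑ i, (U i ⬝ᵥ x) * (U i ⬝ᵥ y)) ∧ (∀ i, U i ⬝ᵥ U i = 1) := by
  let B := hX.eigenvectorBasis
  refine ⟨fun i => (B i).ofLp, fun i => -hX.eigenvalues i, fun i x => ?_, fun x y => ?_,
    fun i => ?_⟩
  · have h1 := hX.mulVec_eigenvectorBasis i
    have hs : Xᵀ = X := by simpa [Matrix.conjTranspose_eq_transpose_of_trivial] using hX.eq
    rw [dotProduct_mulVec, ← mulVec_transpose, hs]
    change (X *ᵥ (hX.eigenvectorBasis i).ofLp) ⬝ᵥ x = _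
    rw [h1, smul_dotProduct, neg_neg]; rfl
  · have h := B.sum_inner_mul_inner (WithLp.toLp 2 x) (WithLp.toLp 2 y)
    simp only [EuclideanSpace.inner_eq_star_dotProduct] at h
    simp only [star_trivial] at h
    rw [dotProduct_comm, ← h]
    refine Finset.sum_congr rfl fun i _ => ?_
    rw [dotProduct_comm y]
  · have h := B.orthonormal.1 i
    have h2 : inner ℝ (B i) (B i) = (1 : ℝ) := by rw [real_inner_self_eq_norm_sq, h]; norm_num
    rw [EuclideanSpace.inner_eq_star_dotProduct] at h2
    simpa using h2

/-- The largest eigenvalue of `-X`. -/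
def maxNegEig (X : Matrix (Fin n) (Fin n) ℝ) : ℝ :=
  sSup ((fun x : Fin n → ℝ => -(x ⬝ᵥ (X *ᵥ x))) '' {x | x ⬝ᵥ x = 1})

theorem isCompact_unitSphere : IsCompact {x : Fin n → ℝ | x ⬝ᵥ x = 1} := by
  refine Metric.isCompact_of_isClosed_isBounded
    (isClosed_eq (by fun_prop) continuous_const) ?_
  refine (Metric.isBounded_closedBall (x := (0 : Fin n → ℝ)) (r := 1)).subset fun x hx => ?_
  rw [mem_closedBall_zero_iff, pi_norm_le_iff_of_nonneg zero_le_one]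
  intro i
  rw [Real.norm_eq_abs, ← sq_le_one_iff_abs_le_one]
  have h : x i * x i ≤ x ⬝ᵥ x :=
    Finset.single_le_sum (f := fun i => x i * x i) (fun _ _ => mul_self_nonneg _) (Finset.mem_univ i)
  rw [Set.mem_ofPred_eq] at hx
  linarith [pow_two (x i)]

/-- The reason for defining `maxNegEig` as a supremum over a compact sphere: it is then visibly
continuous, hence measurable, in the matrix. -/
theorem continuous_maxNegEig :
    Continuous fun X : Fin n → Fin n → ℝ => maxNegEig (Matrix.of X) := by
  refine IsCompact.continuous_sSup (f := fun (X : Fin n → Fin n → ℝ) (x : Fin n → ℝ) =>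
    -(x ⬝ᵥ (Matrix.of X *ᵥ x))) isCompact_unitSphere ?_
  simp only [Function.HasUncurry.uncurry, dotProduct, mulVec, Matrix.of_apply, id]
  fun_prop

theorem neg_dotProduct_mulVec_le (X : Matrix (Fin n) (Fin n) ℝ) (x : Fin n → ℝ) :
    -(x ⬝ᵥ (X *ᵥ x)) ≤ maxNegEig X * (x ⬝ᵥ x) := by
  rcases eq_or_ne x 0 with rfl | hx
  · simp
  have hpos : 0 < x ⬝ᵥ x := by
    have : 0 ≤ x ⬝ᵥ x := Finset.sum_nonneg fun _ _ => mul_self_nonneg _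
    exact this.lt_of_ne' (by simpa using hx)
  have hb : BddAbove ((fun x : Fin n → ℝ => -(x ⬝ᵥ (X *ᵥ x))) '' {x | x ⬝ᵥ x = 1}) :=
    isCompact_unitSphere.bddAbove_image (by
      simp only [dotProduct, mulVec]; fun_prop)
  set c := √(x ⬝ᵥ x) with hc
  have hc0 : 0 < c := Real.sqrt_pos.2 hpos
  have hcc : c * c = x ⬝ᵥ x := Real.mul_self_sqrt hpos.le
  have h1 := le_csSup hb ⟨c⁻¹ • x, by
    simp only [Set.mem_ofPred_eq, smul_dotProduct, dotProduct_smul, smul_eq_mul, ← hcc]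
    field_simp, rfl⟩
  change _ ≤ maxNegEig X at h1
  simp only [mulVec_smul, smul_dotProduct, dotProduct_smul, smul_eq_mul] at h1
  rw [← hcc]
  calc -(x ⬝ᵥ (X *ᵥ x)) = -(c⁻¹ * (c⁻¹ * (x ⬝ᵥ (X *ᵥ x)))) * (c * c) := by field_simp
    _ ≤ _ := by gcongr

/-- The Chebyshev iterates of the vector `g` for the matrix `-X`. -/
def chebVecPair (X : Matrix (Fin n) (Fin n) ℝ) (g : Fin n → ℝ) :
    ℕ → (Fin n → ℝ) × (Fin n → ℝ)
  | 0 => (g, -g)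
  | k + 1 => (fun j => 2 * (chebVecPair X g k).1 j -
      4 * ∑ l, X j l * (chebVecPair X g k).1 l - (chebVecPair X g k).2 j, (chebVecPair X g k).1)

/-- The last Chebyshev iterate. -/
def chebVec (X : Matrix (Fin n) (Fin n) ℝ) (g : Fin n → ℝ) (k : ℕ) : Fin n → ℝ :=
  (chebVecPair X g k).1

/-- The vector recursion applies `-X` wherever the scalar one multiplies by its variable, so
eigencomponents evolve independently. -/
theorem dotProduct_chebVec {X : Matrix (Fin n) (Fin n) ℝ} {u : Fin n → ℝ} {μ : ℝ}
    (h : ∀ x, u ⬝ᵥ (X *ᵥ x) = -μ * (u ⬝ᵥ x)) (g : Fin n → ℝ) (k : ℕ) :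
    u ⬝ᵥ chebVec X g k = cheb μ k * (u ⬝ᵥ g) := by
  suffices H : u ⬝ᵥ (chebVecPair X g k).1 = (chebPair μ k).1 * (u ⬝ᵥ g) ∧
      u ⬝ᵥ (chebVecPair X g k).2 = (chebPair μ k).2 * (u ⬝ᵥ g) from H.1
  induction k with
  | zero => simp [chebVecPair, chebPair]
  | succ k ih =>
    refine ⟨?_, ih.1⟩
    have e : (chebVecPair X g (k + 1)).1 = (2 : ℝ) • (chebVecPair X g k).1 -
        (4 : ℝ) • (X *ᵥ (chebVecPair X g k).1) - (chebVecPair X g k).2 := by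
      ext j; simp [chebVecPair, mulVec, dotProduct]
    rw [e, dotProduct_sub, dotProduct_sub, dotProduct_smul, dotProduct_smul, h, ih.1, ih.2]
    simp only [chebPair, smul_eq_mul]; ring

/-- The weight of the penalty matrix `v vᵀ`. -/
def penalty (X : Matrix (Fin n) (Fin n) ℝ) (v : Fin n → ℝ) : ℝ :=
  open Classical in if v ⬝ᵥ (X *ᵥ v) < 0 then 2 / (v ⬝ᵥ v) else 0

/-- The value of the penalty. -/
def penaltyVal (X : Matrix (Fin n) (Fin n) ℝ) (v : Fin n → ℝ) : ℝ :=
  penalty X v * (v ⬝ᵥ (X *ᵥ v))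

theorem dotProduct_self_nonneg' (v : Fin n → ℝ) : 0 ≤ v ⬝ᵥ v :=
  Finset.sum_nonneg fun _ _ => mul_self_nonneg _

theorem penalty_nonneg (X : Matrix (Fin n) (Fin n) ℝ) (v : Fin n → ℝ) : 0 ≤ penalty X v := by
  unfold penalty; split_ifs
  · exact div_nonneg zero_le_two (dotProduct_self_nonneg' v)
  · exact le_rfl

theorem penaltyVal_nonpos (X : Matrix (Fin n) (Fin n) ℝ) (v : Fin n → ℝ) :
    penaltyVal X v ≤ 0 := by
  unfold penaltyVal penalty; split_ifs with h
  · exact mul_nonpos_of_nonneg_of_nonpos (div_nonneg zero_le_two (dotProduct_self_nonneg' v)) h.le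
  · simp

theorem penalty_mul_le (X : Matrix (Fin n) (Fin n) ℝ) (v : Fin n → ℝ) :
    penalty X v * (v ⬝ᵥ v) ≤ 2 := by
  unfold penalty; split_ifs with h
  · rcases eq_or_ne (v ⬝ᵥ v) 0 with h0 | h0
    · rw [h0]; simp
    · rw [div_mul_cancel₀ _ h0]
  · simp

/-- The penalty is the minimum of `0` and twice the Rayleigh quotient. Because of the factor `2`, a
direction with half of the largest violation already has a penalty that covers all of it. -/
theorem penaltyVal_mul_le (X : Matrix (Fin n) (Fin n) ℝ) (v : Fin n → ℝ) (hv : 0 < v ⬝ᵥ v) :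
    penaltyVal X v * (v ⬝ᵥ v) ≤ 2 * (v ⬝ᵥ (X *ᵥ v)) := by
  unfold penaltyVal penalty; split_ifs with h
  · rw [div_mul_eq_mul_div, div_mul_cancel₀ _ hv.ne']
  · simp only [zero_mul]; linarith

/-- The amount by which the penalty fails to detect the smallest eigenvalue of `X`. -/
def eigErr (X : Matrix (Fin n) (Fin n) ℝ) (v : Fin n → ℝ) : ℝ :=
  max 0 (maxNegEig X + penaltyVal X v)

theorem eigErr_nonneg (X : Matrix (Fin n) (Fin n) ℝ) (v : Fin n → ℝ) : 0 ≤ eigErr X v :=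
  le_max_left _ _

theorem neg_dotProduct_mulVec_le_eigErr (X : Matrix (Fin n) (Fin n) ℝ) (v x : Fin n → ℝ) :
    -(x ⬝ᵥ (X *ᵥ x)) ≤ (eigErr X v - penaltyVal X v) * (x ⬝ᵥ x) := by
  refine (neg_dotProduct_mulVec_le X x).trans ?_
  refine mul_le_mul_of_nonneg_right ?_ (dotProduct_self_nonneg' x)
  have := le_max_right 0 (maxNegEig X + penaltyVal X v)
  unfold eigErr; linarith

/-- The spectral data behind the error estimate: a unit eigenvector `u` for the largest
eigenvalue `μ` of `-X`. -/
theorem exists_eigErr_bound [NeZero n] {X : Matrix (Fin n) (Fin n) ℝ} (hX : X.IsHermitian)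
    (hX1 : matDot X X ≤ 1) :
    ∃ (u : Fin n → ℝ) (μ : ℝ), u ⬝ᵥ u = 1 ∧ μ ≤ 1 ∧
      (∀ v, eigErr X v ≤ max 0 μ) ∧
      (n = 1 → ∀ k g, u ⬝ᵥ g ≠ 0 → eigErr X (chebVec X g k) = 0) ∧
      (0 < μ → ∀ k g, eigErr X (chebVec X g k) *
        ((u ⬝ᵥ g) ^ 2 * Real.sinh ((2 * k + 1) * (√μ / 5)) ^ 2) ≤ 2 * μ * (g ⬝ᵥ g)) := by
  obtain ⟨U, μ, hU, hP, hN⟩ := exists_eigenbasis hX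
  obtain ⟨i₁, -, hi₁⟩ := Finset.exists_max_image Finset.univ μ ⟨0, Finset.mem_univ _⟩
  have hquad : ∀ x, -(x ⬝ᵥ (X *ᵥ x)) = ∑ i, μ i * (U i ⬝ᵥ x) ^ 2 := by
    intro x
    rw [hP, ← Finset.sum_neg_distrib]
    exact Finset.sum_congr rfl fun i _ => by rw [hU]; ring
  have hself : ∀ x, x ⬝ᵥ x = ∑ i, (U i ⬝ᵥ x) ^ 2 := fun x => by
    rw [hP]; simp [pow_two]
  have hlam : maxNegEig X ≤ μ i₁ := by
    refine csSup_le ⟨_, U i₁, hN i₁, rfl⟩ ?_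
    rintro _ ⟨x, hx, rfl⟩
    change -(x ⬝ᵥ (X *ᵥ x)) ≤ _
    rw [Set.mem_ofPred_eq] at hx
    rw [hquad, ← mul_one (μ i₁), ← hx, hself, Finset.mul_sum]
    exact Finset.sum_le_sum fun i _ =>
      mul_le_mul_of_nonneg_right (hi₁ i (Finset.mem_univ _)) (sq_nonneg _)
  have habs : ∀ i, |μ i| ≤ 1 := by
    intro i
    have h1 : μ i = -matDot (vecMulVec (U i) (U i)) X := by
      rw [← dotProduct_mulVec_eq_matDot, hU, hN]; ring
    rw [h1, abs_neg]
    exact abs_matDot_le_one (by rw [matDot_vecMulVec_self, hN]; norm_num) hX1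
  have hle : ∀ v, eigErr X v ≤ max 0 (μ i₁) := fun v =>
    max_le_max le_rfl (by linarith [penaltyVal_nonpos X v])
  refine ⟨U i₁, μ i₁, hN i₁, (abs_le.1 (habs i₁)).2, hle, ?_, ?_⟩
  -- In dimension one every nonzero vector is an eigenvector. The case is needed separately because
  -- then the logarithm of `n` is `0` and no iterations are made.
  · intro hn k g hg
    rcases le_or_gt (μ i₁) 0 with h0 | h0
    · refine le_antisymm ((hle _).trans (by simp [h0])) (eigErr_nonneg _ _)
    have huniv : (Finset.univ : Finset (Fin n)) = {i₁} := by
      ext i; simp only [Finset.mem_univ, Finset.mem_singleton, true_iff]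
      ext; have := i.2; have := i₁.2; omega
    set v := chebVec X g k with hv
    have hUv : U i₁ ⬝ᵥ v ≠ 0 := by
      rw [hv, dotProduct_chebVec (hU i₁)]
      exact mul_ne_zero (by linarith [one_le_cheb h0.le k]) hg
    have h1 : v ⬝ᵥ v = (U i₁ ⬝ᵥ v) ^ 2 := by rw [hself, huniv]; simp
    have h2 : -(v ⬝ᵥ (X *ᵥ v)) = μ i₁ * (v ⬝ᵥ v) := by rw [hquad, huniv, h1]; simp
    have hvv : 0 < v ⬝ᵥ v := by rw [h1]; positivity
    have h3 := penaltyVal_mul_le X v hvv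
    have h4 : penaltyVal X v ≤ -2 * μ i₁ := by
      refine le_of_mul_le_mul_right (h3.trans (le_of_eq ?_)) hvv
      linarith
    exact max_eq_left (by linarith)
  · intro h0 k g
    have hμ1 := (abs_le.1 (habs i₁)).2
    set lam := μ i₁
    set v := chebVec X g k with hv
    set σ := Real.sinh ((2 * k + 1) * (√lam / 5)) with hσ
    set B := lam / 2 * cheb (lam / 2) k ^ 2 + 1 with hB
    have hB0 : 0 < B := by positivity
    have hUv : ∀ i, U i ⬝ᵥ v = cheb (μ i) k * (U i ⬝ᵥ g) := fun i => dotProduct_chebVec (hU i) g k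
    have hratio : B * σ ^ 2 ≤ lam * cheb lam k ^ 2 := cheb_ratio h0 hμ1 k
    -- In the eigenbasis the coefficient of `(U i ⬝ᵥ g)²` is `(lam/2 - μ i) p(μ i)²`. It is
    -- nonpositive for `μ i ≥ lam/2`; on `[0, lam/2)` monotonicity bounds `p(μ i)` by `p(lam/2)`;
    -- for negative `μ i` one has `|p(μ i)| ≤ p(0) ≤ p(lam/2)` and `-μ i p(μ i)² ≤ 1`.
    have hnum : lam / 2 * (v ⬝ᵥ v) + v ⬝ᵥ (X *ᵥ v) ≤ B * (g ⬝ᵥ g) := by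
      have e : lam / 2 * (v ⬝ᵥ v) + v ⬝ᵥ (X *ᵥ v) =
          ∑ i, ((lam / 2 - μ i) * cheb (μ i) k ^ 2) * (U i ⬝ᵥ g) ^ 2 := by
        have := hquad v
        rw [show v ⬝ᵥ (X *ᵥ v) = -(-(v ⬝ᵥ (X *ᵥ v))) by ring, this, hself, Finset.mul_sum,
          ← sub_eq_add_neg, ← Finset.sum_sub_distrib]
        exact Finset.sum_congr rfl fun i _ => by rw [hUv]; ring
      rw [e, hself, Finset.mul_sum]
      refine Finset.sum_le_sum fun i _ => mul_le_mul_of_nonneg_right ?_ (sq_nonneg _)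
      rcases le_or_gt (lam / 2) (μ i) with h | h
      · exact (mul_nonpos_of_nonpos_of_nonneg (by linarith) (sq_nonneg _)).trans hB0.le
      rcases le_or_gt 0 (μ i) with h' | h'
      · have h1 : cheb (μ i) k ^ 2 ≤ cheb (lam / 2) k ^ 2 :=
          pow_le_pow_left₀ (by linarith [one_le_cheb h' k]) (cheb_le_cheb h' h.le k) 2
        have h2 := sq_nonneg (cheb (μ i) k)
        nlinarith
      · have h1 : cheb (μ i) k ^ 2 ≤ cheb (lam / 2) k ^ 2 := by
          rw [← sq_abs]
          refine pow_le_pow_left₀ (abs_nonneg _) ?_ 2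
          exact (abs_cheb_le_of_nonpos (abs_le.1 (habs i)).1 h'.le k).trans
            (cheb_le_cheb le_rfl (by linarith) k)
        have h2 := neg_mul_cheb_sq_le_one (abs_le.1 (habs i)).1 h'.le k
        nlinarith
    have hden : cheb lam k ^ 2 * (U i₁ ⬝ᵥ g) ^ 2 ≤ v ⬝ᵥ v := by
      rw [hself, ← mul_pow, ← hUv i₁]
      exact Finset.single_le_sum (f := fun i => (U i ⬝ᵥ v) ^ 2) (fun _ _ => sq_nonneg _)
        (Finset.mem_univ i₁)
    rcases eq_or_ne (U i₁ ⬝ᵥ g) 0 with hy | hy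
    · rw [hy]
      have := dotProduct_self_nonneg' g
      simp only [ne_eq, OfNat.ofNat_ne_zero, not_false_eq_true, zero_pow, zero_mul, mul_zero]
      positivity
    have hc1 := one_le_cheb h0.le k
    have hvv : 0 < v ⬝ᵥ v := lt_of_lt_of_le (by positivity) hden
    -- Up to the truncation at `0`, the left side is at most `lam |v|² + 2 vᵀXv`, twice the quantity
    -- bounded in `hnum`.
    have h1 : eigErr X v * (v ⬝ᵥ v) ≤ 2 * B * (g ⬝ᵥ g) := by
      have hgg := dotProduct_self_nonneg' g
      unfold eigErr
      rw [max_mul_of_nonneg _ _ hvv.le, zero_mul]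
      refine max_le (by positivity) ?_
      have := penaltyVal_mul_le X v hvv
      nlinarith
    have he := eigErr_nonneg X v
    have h2 : eigErr X v * (cheb lam k ^ 2 * (U i₁ ⬝ᵥ g) ^ 2) ≤ 2 * B * (g ⬝ᵥ g) :=
      (mul_le_mul_of_nonneg_left hden he).trans h1
    -- The unknown size `B` occurs both in the error bound and in the growth estimate `hratio`, and
    -- cancels.
    have h3 : B * (eigErr X v * ((U i₁ ⬝ᵥ g) ^ 2 * σ ^ 2)) ≤ B * (2 * lam * (g ⬝ᵥ g)) := by
      calc _ = eigErr X v * (U i₁ ⬝ᵥ g) ^ 2 * (B * σ ^ 2) := by ring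
        _ ≤ eigErr X v * (U i₁ ⬝ᵥ g) ^ 2 * (lam * cheb lam k ^ 2) := by gcongr
        _ = lam * (eigErr X v * (cheb lam k ^ 2 * (U i₁ ⬝ᵥ g) ^ 2)) := by ring
        _ ≤ lam * (2 * B * (g ⬝ᵥ g)) := by gcongr
        _ = _ := by ring
    exact le_of_mul_le_mul_left h3 hB0

end

noncomputable section

/-! ## The expected error of the approximate eigenvector -/

open Matrix RealRAM

/-- The integrand is a Cauchy kernel. Extending the integral to the whole line makes the bound
independent of the shift `c`. -/
theorem lintegral_inv_add_sq_le {A b : ℝ} (hA : 0 < A) (hb : b ≠ 0) (c : ℝ) :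
    ∫⁻ t : unitInterval, ENNReal.ofReal (2 * A / (A + (c + b * t) ^ 2)) ≤
      ENNReal.ofReal (2 * Real.pi * √A / |b|) := by
  have hs : 0 < √A := Real.sqrt_pos.2 hA
  have hss : √A ^ 2 = A := Real.sq_sqrt hA.le
  let f : ℝ → ℝ := fun x => (1 + x ^ 2)⁻¹
  have hr : b / √A ≠ 0 := div_ne_zero hb hs.ne'
  have e : ∀ t : ℝ, 2 * A / (A + (c + b * t) ^ 2) = 2 * f (b / √A * (t + c / b)) := by
    intro t
    have h1 : b / √A * (t + c / b) = (c + b * t) / √A := by field_simp; ring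
    simp only [f]
    rw [h1, div_pow, hss]
    have : 0 < A + (c + b * t) ^ 2 := by positivity
    field_simp
  have hf : Integrable f := integrable_inv_one_add_sq
  have h1 : Integrable fun t : ℝ => f (b / √A * t) := hf.comp_mul_left' hr
  have h2 : Integrable fun t : ℝ => f (b / √A * (t + c / b)) := h1.comp_add_right (c / b)
  calc ∫⁻ t : unitInterval, ENNReal.ofReal (2 * A / (A + (c + b * t) ^ 2))
      = ∫⁻ t in Set.Icc (0 : ℝ) 1, ENNReal.ofReal (2 * A / (A + (c + b * t) ^ 2)) :=
        lintegral_subtype_comap measurableSet_Icc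
          (fun t : ℝ => ENNReal.ofReal (2 * A / (A + (c + b * t) ^ 2)))
    _ ≤ ∫⁻ t : ℝ, ENNReal.ofReal (2 * A / (A + (c + b * t) ^ 2)) := setLIntegral_le_lintegral _ _
    _ = ENNReal.ofReal (∫ t : ℝ, 2 * f (b / √A * (t + c / b))) := by
        rw [ofReal_integral_eq_lintegral_ofReal (h2.const_mul 2)]
        · simp_rw [e]
        · exact Filter.Eventually.of_forall fun t => by
            simp only [f, Pi.zero_apply]; positivity
    _ = _ := by
        rw [integral_const_mul, integral_add_right_eq_self (fun t => f (b / √A * t)),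
          Measure.integral_comp_mul_left, integral_univ_inv_one_add_sq, inv_div, abs_div,
          abs_of_pos hs, smul_eq_mul]
        congr 1; ring

/-- Let `r = √(μ/ε) ≥ 1/4`. The argument of `sinh` is at least `40 Ln r ≥ 5 Ln + 20 r`. The factor
`exp (5 Ln) ≥ 64 * 2 ^ Ln` beats the dimension and `exp (20 r) ≥ 200 r²` beats `μ/ε = r²`. The
constant `288` is the one required in `lintegral_eigErr_le`. -/
theorem iterations_suffice {n Ln k : ℕ} {ε μ : ℝ} (hε : 0 < ε) (hn : n ≤ 2 ^ Ln) (hL : 1 ≤ Ln)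
    (hk : 100 * Ln / √ε ≤ k) (hμ : ε / 16 ≤ μ) :
    288 * n * μ ≤ ε * Real.sinh ((2 * k + 1) * (√μ / 5)) := by
  have hse : 0 < √ε := Real.sqrt_pos.2 hε
  have hμ0 : 0 < μ := by linarith
  set r := √μ / √ε with hr
  have hr2 : μ = ε * r ^ 2 := by
    rw [hr, div_pow, Real.sq_sqrt hμ0.le, Real.sq_sqrt hε.le]; field_simp
  have hr0 : 0 ≤ r := by positivity
  have hr4 : 1 / 4 ≤ r := by
    have h1 : 1 / 16 ≤ r ^ 2 := by
      refine le_of_mul_le_mul_left ?_ hε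
      rw [← hr2]; linarith
    nlinarith
  have hL' : (1 : ℝ) ≤ Ln := by exact_mod_cast hL
  have hn' : (n : ℝ) ≤ 2 ^ Ln := by exact_mod_cast hn
  have hz : 40 * Ln * r ≤ (2 * k + 1) * (√μ / 5) := by
    have h1 : 100 * Ln ≤ k * √ε := by rwa [div_le_iff₀ hse] at hk
    have h2 : √μ = r * √ε := by rw [hr]; field_simp
    rw [h2]
    nlinarith
  have hsinh : Real.sinh (40 * Ln * r) ≤ Real.sinh ((2 * k + 1) * (√μ / 5)) :=
    Real.sinh_le_sinh.2 hz
  have hexp : 6400 * 2 ^ Ln * (2 * r ^ 2) ≤ Real.exp (40 * Ln * r) := by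
    have h1 : Real.exp (5 * Ln) * Real.exp (20 * r) ≤ Real.exp (40 * Ln * r) := by
      rw [← Real.exp_add]
      refine Real.exp_le_exp.2 ?_
      nlinarith [mul_nonneg (sub_nonneg.2 hL') hr0, mul_nonneg (sub_nonneg.2 hr4)
        (by linarith : (0 : ℝ) ≤ Ln)]
    have h2 : 64 * 2 ^ Ln ≤ Real.exp (5 * Ln) := by
      have h5 : (128 : ℝ) ≤ Real.exp 5 := by
        have := Real.exp_one_gt_d9
        calc (128 : ℝ) ≤ 2.7 ^ 5 := by norm_num
          _ ≤ Real.exp 1 ^ 5 := pow_le_pow_left₀ (by norm_num) (by linarith) 5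
          _ = Real.exp 5 := by rw [← Real.exp_nat_mul]; norm_num
      calc (64 : ℝ) * 2 ^ Ln ≤ 64 ^ Ln * 2 ^ Ln := by
            gcongr; exact le_self_pow₀ (by norm_num) (by omega)
        _ = 128 ^ Ln := by rw [← mul_pow]; norm_num
        _ ≤ Real.exp 5 ^ Ln := by gcongr
        _ = _ := by rw [← Real.exp_nat_mul]; ring_nf
    have h3 : 200 * r ^ 2 ≤ Real.exp (20 * r) := by
      have := Real.quadratic_le_exp_of_nonneg (by positivity : 0 ≤ 20 * r)
      nlinarith
    refine le_trans ?_ h1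
    calc _ = (64 * 2 ^ Ln) * (200 * r ^ 2) := by ring
      _ ≤ _ := by gcongr
  have hge : 576 * n * r ^ 2 ≤ Real.exp (40 * Ln * r) - 1 := by
    have h2 : (1 : ℝ) ≤ 2 ^ Ln := one_le_pow₀ (by norm_num)
    have h3 : (1 : ℝ) / 16 ≤ r ^ 2 := by nlinarith
    nlinarith [mul_le_mul_of_nonneg_right hn' (sq_nonneg r)]
  have hs : 288 * n * r ^ 2 ≤ Real.sinh (40 * Ln * r) := by
    have : Real.exp (-(40 * Ln * r)) ≤ 1 := Real.exp_le_one_iff.2 (by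
      have : (0 : ℝ) ≤ 40 * Ln * r := by positivity
      linarith)
    rw [Real.sinh_eq]; linarith
  calc 288 * n * μ = ε * (288 * n * r ^ 2) := by rw [hr2]; ring
    _ ≤ _ := mul_le_mul_of_nonneg_left (hs.trans hsinh) hε.le

variable {n : ℕ}

/-- The random start vector stored on the tape from position `p` on. -/
def startVec (n p : ℕ) (ω : ℕ → unitInterval) : Fin n → ℝ := fun j => 1 + ω (p + j)

theorem startVec_dotProduct_self_le (p : ℕ) (ω : ℕ → unitInterval) :
    startVec n p ω ⬝ᵥ startVec n p ω ≤ 4 * n := by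
  have : ∀ j ∈ (Finset.univ : Finset (Fin n)), startVec n p ω j * startVec n p ω j ≤ 4 := by
    intro j _
    have h0 := (ω (p + j)).2.1
    have h1 := (ω (p + j)).2.2
    simp only [startVec]
    nlinarith
  refine (Finset.sum_le_sum this).trans ?_
  simp [mul_comm]

theorem exists_one_le_mul_sq [NeZero n] {u : Fin n → ℝ} (hu : u ⬝ᵥ u = 1) :
    ∃ j, 1 ≤ n * (u j) ^ 2 := by
  by_contra! h
  have h1 : ∑ j : Fin n, (n : ℝ) * u j ^ 2 < ∑ _j : Fin n, (1 : ℝ) :=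
    Finset.sum_lt_sum_of_nonempty ⟨0, Finset.mem_univ _⟩ fun j _ => h j
  rw [← Finset.mul_sum] at h1
  have h2 : ∑ j, u j ^ 2 = 1 := by rw [← hu]; simp [dotProduct, pow_two]
  simp [h2] at h1

/-- The bound degenerates only when `y = u ⬝ᵥ g` is small. Some coordinate has `|u j| ≥ 1/√n`;
drawing this coordinate of the start vector afresh spreads `y` uniformly over an interval of length
`|u j|`, so small values are rare, and there the error is still at most `μ`. -/
theorem lintegral_eigErr_le [NeZero n] {X : Matrix (Fin n) (Fin n) ℝ} (hX : X.IsHermitian)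
    (hX1 : matDot X X ≤ 1) {Ln k p : ℕ} {ε : ℝ} (hε : 0 < ε) (hn : n ≤ 2 ^ Ln)
    (hk : 100 * Ln / √ε ≤ k) :
    ∫⁻ ω, ENNReal.ofReal (eigErr X (chebVec X (startVec n p ω) k)) ∂uniformTape ≤
      ENNReal.ofReal (ε / 16) := by
  obtain ⟨u, μ, hu, hμ1, hle, hone, hbd⟩ := exists_eigErr_bound hX hX1
  rcases le_or_gt μ (ε / 16) with hμ | hμ
  · calc _ ≤ ∫⁻ _ω, ENNReal.ofReal (ε / 16) ∂uniformTape :=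
          lintegral_mono fun ω => ENNReal.ofReal_le_ofReal
            ((hle _).trans (max_le (by positivity) hμ))
      _ = _ := by simp
  have hμ0 : 0 < μ := lt_trans (by positivity) hμ
  rcases eq_or_ne n 1 with h1 | h1
  · subst h1
    have : ∀ ω, eigErr X (chebVec X (startVec 1 p ω) k) = 0 := by
      intro ω
      refine hone rfl k _ ?_
      have h0 := (ω (p + (0 : Fin 1))).2.1
      simp only [dotProduct, Finset.univ_unique, Finset.sum_singleton] at hu ⊢
      refine mul_ne_zero (fun h => by rw [h] at hu; simp at hu) ?_
      simp only [startVec]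
      positivity
    simp [this]
  have hL : 1 ≤ Ln := by
    rcases Nat.eq_zero_or_pos Ln with h | h
    · subst h
      have := NeZero.ne n
      omega
    · exact h
  obtain ⟨j, hj⟩ := exists_one_le_mul_sq hu
  set σ := Real.sinh ((2 * k + 1) * (√μ / 5)) with hσ
  have hσ0 : 0 < σ := Real.sinh_pos_iff.2 (by positivity)
  have hnpos : (0 : ℝ) < n := by exact_mod_cast Nat.pos_of_ne_zero (NeZero.ne n)
  -- From `2 μ (g ⬝ᵥ g) ≤ 8 μ n`: the error times `y²` is at most `μ A`. Adding the bound `μ` times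
  -- `A` gives the single expression `2 μ A / (A + y²)` used below.
  set A := 8 * n / σ ^ 2 with hA
  have hA0 : 0 < A := by positivity
  have huj : u j ≠ 0 := fun h => by rw [h] at hj; norm_num at hj
  have hpt : ∀ ω, eigErr X (chebVec X (startVec n p ω) k) ≤
      μ * (2 * A / (A + (u ⬝ᵥ startVec n p ω) ^ 2)) := by
    intro ω
    set y := u ⬝ᵥ startVec n p ω
    set E := eigErr X (chebVec X (startVec n p ω) k)
    have h1 : E ≤ μ := (hle _).trans (max_le hμ0.le le_rfl)
    have h2 : E * y ^ 2 ≤ μ * A := by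
      have h3 := (hbd hμ0 k (startVec n p ω)).trans
        (mul_le_mul_of_nonneg_left (startVec_dotProduct_self_le p ω) (by positivity))
      rw [hA, ← mul_div_assoc, le_div_iff₀ (by positivity)]
      linarith
    rw [← mul_div_assoc, le_div_iff₀ (by positivity)]
    nlinarith
  have hmeas : Measurable fun ω : ℕ → unitInterval => u ⬝ᵥ startVec n p ω := by
    simp only [dotProduct, startVec]
    fun_prop
  calc _ ≤ ∫⁻ ω, ENNReal.ofReal μ *
        ENNReal.ofReal (2 * A / (A + (u ⬝ᵥ startVec n p ω) ^ 2)) ∂uniformTape := by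
        refine lintegral_mono fun ω => ?_
        dsimp only
        rw [← ENNReal.ofReal_mul hμ0.le]
        exact ENNReal.ofReal_le_ofReal (hpt ω)
    _ = ENNReal.ofReal μ * ∫⁻ ω,
        ENNReal.ofReal (2 * A / (A + (u ⬝ᵥ startVec n p ω) ^ 2)) ∂uniformTape :=
        lintegral_const_mul' _ _ ENNReal.ofReal_ne_top
    _ ≤ ENNReal.ofReal μ * ENNReal.ofReal (2 * Real.pi * √A / |u j|) := by
        gcongr
        refine lintegral_le_of_resample (p + j) (by fun_prop) fun ω => ?_
        have e : ∀ t : unitInterval, u ⬝ᵥ startVec n p (Function.update ω (p + j) t) =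
            (u ⬝ᵥ startVec n p ω - u j * ω (p + j)) + u j * t := by
          intro t
          have : startVec n p (Function.update ω (p + j) t) =
              startVec n p ω + Pi.single j ((t : ℝ) - ω (p + j)) := by
            ext i
            by_cases hij : i = j
            · subst hij; simp [startVec]
            · have h2 : (i : ℕ) ≠ j := fun h => hij (Fin.ext h)
              simp [startVec, hij, h2]
          rw [this, dotProduct_add, dotProduct_single]; ring
        simp_rw [e]
        exact lintegral_inv_add_sq_le hA0 huj _
    _ ≤ _ := by
        rw [← ENNReal.ofReal_mul hμ0.le]
        refine ENNReal.ofReal_le_ofReal ?_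
        have hit := iterations_suffice hε hn hL hk hμ.le
        rw [← hσ] at hit
        -- `√8 < 2.83` and `1 / |u j| ≤ √n`; in the end `16 * (2 * 3.15) * 2.83 < 288`.
        have hq : √A / |u j| ≤ 2.83 * n / σ := by
          rw [div_le_iff₀ (abs_pos.2 huj), Real.sqrt_le_left (by positivity), mul_pow, sq_abs,
            div_pow, hA, div_mul_eq_mul_div]
          refine div_le_div_of_nonneg_right ?_ (by positivity)
          nlinarith
        have hpi := Real.pi_lt_d2
        have hpi0 := Real.pi_pos
        calc μ * (2 * Real.pi * √A / |u j|) = μ * (2 * Real.pi) * (√A / |u j|) := by ring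
          _ ≤ μ * (2 * 3.15) * (2.83 * n / σ) := by gcongr
          _ ≤ ε / 16 := by
              rw [← mul_div_assoc, div_le_iff₀ hσ0]
              nlinarith [mul_pos hμ0 hnpos]

/-- The exponential moment of the error. -/
theorem lintegral_exp_eigErr_le [NeZero n] {X : Matrix (Fin n) (Fin n) ℝ} (hX : X.IsHermitian)
    (hX1 : matDot X X ≤ 1) {Ln k p : ℕ} {ε β : ℝ} (hε : 0 < ε) (hn : n ≤ 2 ^ Ln)
    (hk : 100 * Ln / √ε ≤ k) (hβ : 0 ≤ β) (hβ1 : β ≤ 1) :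
    ∫⁻ ω, ENNReal.ofReal (Real.exp (β * eigErr X (chebVec X (startVec n p ω) k))) ∂uniformTape ≤
      ENNReal.ofReal (Real.exp (β * ε / 8)) := by
  obtain ⟨u, μ, hu, hμ1, hle, -⟩ := exists_eigErr_bound hX hX1
  calc _ ≤ ∫⁻ ω, (1 + ENNReal.ofReal (2 * β) *
        ENNReal.ofReal (eigErr X (chebVec X (startVec n p ω) k))) ∂uniformTape := by
        refine lintegral_mono fun ω => ?_
        dsimp only
        set E := eigErr X (chebVec X (startVec n p ω) k)
        have h0 : 0 ≤ E := eigErr_nonneg _ _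
        -- Boundedness by `1` lets the mean alone control the exponential moment, through `exp x ≤ 1
        -- + 2x` on `[0, 1]`. No tail bound for the error is needed.
        have h1 : E ≤ 1 := (hle _).trans (max_le zero_le_one hμ1)
        rw [← ENNReal.ofReal_mul (by positivity), ← ENNReal.ofReal_one,
          ← ENNReal.ofReal_add zero_le_one (by positivity)]
        refine ENNReal.ofReal_le_ofReal ?_
        have hb : β * E ≤ 1 := mul_le_one₀ hβ1 h0 h1
        have hb0 : 0 ≤ β * E := by positivity
        have := (abs_le.1 (Real.abs_exp_sub_one_sub_id_le (abs_le.2 ⟨by linarith, hb⟩))).2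
        nlinarith
    _ = 1 + ENNReal.ofReal (2 * β) * ∫⁻ ω,
        ENNReal.ofReal (eigErr X (chebVec X (startVec n p ω) k)) ∂uniformTape := by
        rw [lintegral_add_left measurable_const, lintegral_const_mul' _ _ ENNReal.ofReal_ne_top]
        simp
    _ ≤ 1 + ENNReal.ofReal (2 * β) * ENNReal.ofReal (ε / 16) := by
        gcongr; exact lintegral_eigErr_le hX hX1 hε hn hk
    _ ≤ _ := by
        rw [← ENNReal.ofReal_mul (by positivity), ← ENNReal.ofReal_one,
          ← ENNReal.ofReal_add zero_le_one (by positivity)]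
        refine ENNReal.ofReal_le_ofReal ?_
        have := Real.add_one_le_exp (β * ε / 8)
        linarith

end

noncomputable section

/-! ## Exponential moments of the sampling errors -/

open RealRAM

theorem exp_le_one_add_add_sq {x : ℝ} (hx : x ≤ 1) : Real.exp x ≤ 1 + x + x ^ 2 := by
  rcases le_or_gt (-1) x with h | h
  · have := (abs_le.1 (Real.abs_exp_sub_one_sub_id_le (abs_le.2 ⟨h, hx⟩))).2
    linarith
  · have : Real.exp x ≤ 1 := Real.exp_le_one_iff.2 (by linarith)
    nlinarith

/-- The mean of `f` with respect to the weights `w`. -/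
def wmean {N : ℕ} (w f : Fin N → ℝ) : ℝ := (∑ i, w i * f i) / ∑ i, w i

theorem wmean_eq {N : ℕ} (w f : Fin N → ℝ) : wmean w f = ∑ i, w i / (∑ j, w j) * f i := by
  rw [wmean, Finset.sum_div]
  exact Finset.sum_congr rfl fun i _ => by ring

theorem sum_pos_of_pos {N : ℕ} [NeZero N] {w : Fin N → ℝ} (hw : ∀ i, 0 < w i) : 0 < ∑ i, w i :=
  Finset.sum_pos (fun i _ => hw i) ⟨0, Finset.mem_univ _⟩

theorem abs_wmean_le {N : ℕ} [NeZero N] {w f : Fin N → ℝ} (hw : ∀ i, 0 < w i) {c : ℝ}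
    (hf : ∀ i, |f i| ≤ c) : |wmean w f| ≤ c := by
  have hW := sum_pos_of_pos hw
  rw [wmean, abs_div, abs_of_pos hW, div_le_iff₀ hW, Finset.mul_sum]
  refine (Finset.abs_sum_le_sum_abs _ _).trans (Finset.sum_le_sum fun i _ => ?_)
  rw [abs_mul, abs_of_pos (hw i), mul_comm]
  exact mul_le_mul_of_nonneg_right (hf i) (hw i).le

theorem sum_mul_exp_le {Q : Type*} [Fintype Q] {P x : Q → ℝ} (hP : ∀ q, 0 ≤ P q)
    (hP1 : ∑ q, P q = 1) (hx : ∀ q, x q ≤ 1) {c : ℝ}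
    (hc : ∑ q, P q * x q + ∑ q, P q * x q ^ 2 ≤ c) :
    ∑ q, P q * Real.exp (x q) ≤ Real.exp c := by
  calc ∑ q, P q * Real.exp (x q) ≤ ∑ q, P q * (1 + x q + x q ^ 2) :=
        Finset.sum_le_sum fun q _ => mul_le_mul_of_nonneg_left (exp_le_one_add_add_sq (hx q)) (hP q)
    _ = 1 + (∑ q, P q * x q + ∑ q, P q * x q ^ 2) := by
        simp only [mul_add, mul_one, Finset.sum_add_distrib, hP1]; ring
    _ ≤ 1 + c := by linarith
    _ ≤ _ := by linarith [Real.add_one_le_exp c]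

/-- The deviation has mean `0` and size at most `4`, so only the quadratic term `16 β²` survives in
the second-order bound of `exp`. -/
theorem lintegral_exp_pick_le {N : ℕ} [NeZero N] {w f : Fin N → ℝ} (hw : ∀ i, 0 < w i)
    (hf : ∀ i, |f i| ≤ 2) {β : ℝ} (hβ : 0 ≤ β) (hβ1 : β ≤ 1 / 8) :
    ∫⁻ u : unitInterval, ENNReal.ofReal (Real.exp (β * (f (pick w u) - wmean w f))) ≤
      ENNReal.ofReal (Real.exp (16 * β ^ 2)) := by
  have hW := sum_pos_of_pos hw
  refine (lintegral_pick_le hW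
    (fun i => ENNReal.ofReal (Real.exp (β * (f i - wmean w f))))).trans ?_
  have hp : ∀ i, 0 ≤ w i / ∑ j, w j := fun i => div_nonneg (hw i).le hW.le
  have hp1 : ∑ i, w i / ∑ j, w j = 1 := by rw [← Finset.sum_div, div_self hW.ne']
  simp_rw [← ENNReal.ofReal_mul (hp _)]
  rw [← ENNReal.ofReal_sum_of_nonneg fun i _ => mul_nonneg (hp i) (Real.exp_pos _).le]
  refine ENNReal.ofReal_le_ofReal ?_
  have hm := abs_le.1 (abs_wmean_le hw hf)
  have hd : ∀ i, |f i - wmean w f| ≤ 4 := fun i => by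
    have := abs_le.1 (hf i)
    exact abs_le.2 ⟨by linarith, by linarith⟩
  refine sum_mul_exp_le hp hp1 (fun i => ?_) ?_
  · have := (abs_le.1 (hd i)).2
    nlinarith
  · have h1 : ∑ i, w i / (∑ j, w j) * (β * (f i - wmean w f)) = 0 := by
      have : ∑ i, w i / (∑ j, w j) * (β * (f i - wmean w f)) =
          β * (∑ i, w i / (∑ j, w j) * f i) - β * wmean w f * ∑ i, w i / ∑ j, w j := by
        rw [Finset.mul_sum, Finset.mul_sum, ← Finset.sum_sub_distrib]
        exact Finset.sum_congr rfl fun i _ => by ring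
      rw [this, hp1, ← wmean_eq]; ring
    have h2 : ∑ i, w i / (∑ j, w j) * (β * (f i - wmean w f)) ^ 2 ≤
        ∑ i, w i / (∑ j, w j) * (16 * β ^ 2) := by
      refine Finset.sum_le_sum fun i _ => mul_le_mul_of_nonneg_left ?_ (hp i)
      rw [mul_pow]
      have := sq_le_sq' (abs_le.1 (hd i)).1 (abs_le.1 (hd i)).2
      nlinarith [sq_nonneg β]
    rw [← Finset.sum_mul, hp1, one_mul] at h2
    linarith

/-- The exponential moment of the error of the estimated losses. -/
theorem sum_mul_exp_estimate_le {Q : Type*} [Fintype Q] {N : ℕ} [NeZero N] {P : Q → ℝ}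
    (hP : ∀ q, 0 ≤ P q) (hP1 : ∑ q, P q = 1) {w : Fin N → ℝ} (hw : ∀ i, 0 < w i)
    {e : Fin N → Q → ℝ} {t b : Fin N → ℝ} {β : ℝ} (hβ : 0 < β) (hβ1 : β ≤ 1 / 8)
    (he : ∀ i q, |e i q| ≤ 1 / (8 * β)) (hm : ∀ i, ∑ q, P q * e i q ^ 2 ≤ 1)
    (hbias : ∀ i, |∑ q, P q * e i q - t i| ≤ 2 * β) (ht : ∀ i, |t i| ≤ 1) (hb : ∀ i, |b i| ≤ 1)
    (i : Fin N) :
    ∑ q, P q * Real.exp (β * (e i q - t i - wmean w (fun i' => e i' q - t i') +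
      β * wmean w (fun i' => (e i' q - b i') ^ 2))) ≤ Real.exp (40 * β ^ 2) := by
  have hW := sum_pos_of_pos hw
  set p : Fin N → ℝ := fun i => w i / ∑ j, w j with hp_def
  have hp : ∀ i, 0 ≤ p i := fun i => div_nonneg (hw i).le hW.le
  have hp1 : ∑ i, p i = 1 := by simp only [hp_def]; rw [← Finset.sum_div, div_self hW.ne']
  have hav : ∀ (F : Fin N → Q → ℝ), ∑ q, P q * ∑ i, p i * F i q = ∑ i, p i * ∑ q, P q * F i q := by
    intro F
    simp only [Finset.mul_sum]
    rw [Finset.sum_comm]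
    exact Finset.sum_congr rfl fun _ _ => Finset.sum_congr rfl fun _ _ => by ring
  have hple : ∀ (G : Fin N → ℝ) (c : ℝ), (∀ i, G i ≤ c) → ∑ i, p i * G i ≤ c := by
    intro G c h
    calc ∑ i, p i * G i ≤ ∑ i, p i * c :=
          Finset.sum_le_sum fun i _ => mul_le_mul_of_nonneg_left (h i) (hp i)
      _ = c := by rw [← Finset.sum_mul, hp1, one_mul]
  set y : Q → ℝ := fun q => ∑ i', p i' * (e i' q - t i') with hy
  set z : Q → ℝ := fun q => ∑ i', p i' * (e i' q - b i') ^ 2 with hz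
  have hwy : ∀ q, wmean w (fun i' => e i' q - t i') = y q := fun q => wmean_eq _ _
  have hwz : ∀ q, wmean w (fun i' => (e i' q - b i') ^ 2) = z q := fun q => wmean_eq _ _
  simp_rw [hwy, hwz]
  have hβe : ∀ i q, |β * e i q| ≤ 1 / 8 := by
    intro i q
    rw [abs_mul, abs_of_pos hβ]
    calc β * |e i q| ≤ β * (1 / (8 * β)) := by gcongr; exact he i q
      _ = 1 / 8 := by field_simp
  have hdev : ∀ (c : Fin N → ℝ), (∀ i, |c i| ≤ 1) → ∀ i, ∑ q, P q * (e i q - c i) ^ 2 ≤ 4 := by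
    intro c hc i
    calc ∑ q, P q * (e i q - c i) ^ 2 ≤ ∑ q, (2 * (P q * e i q ^ 2) + P q * 2) := by
          refine Finset.sum_le_sum fun q _ => ?_
          have h1 : c i ^ 2 ≤ 1 := (sq_le_one_iff_abs_le_one _).2 (hc i)
          have h2 : (e i q - c i) ^ 2 ≤ 2 * e i q ^ 2 + 2 := by nlinarith [sq_nonneg (e i q + c i)]
          have := mul_le_mul_of_nonneg_left h2 (hP q)
          linarith
      _ = 2 * (∑ q, P q * e i q ^ 2) + 2 := by
          rw [Finset.sum_add_distrib, ← Finset.mul_sum, ← Finset.sum_mul, hP1, one_mul]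
      _ ≤ 4 := by linarith [hm i]
  have hmean : ∀ i, ∑ q, P q * (e i q - t i) = ∑ q, P q * e i q - t i := by
    intro i
    simp only [mul_sub, Finset.sum_sub_distrib]
    rw [← Finset.sum_mul, hP1, one_mul]
  have hEy : -(2 * β) ≤ ∑ q, P q * y q := by
    rw [hy, hav (fun i q => e i q - t i)]
    have := hple (fun i => -∑ q, P q * (e i q - t i)) (2 * β) fun i => by
      rw [hmean]; linarith [(abs_le.1 (hbias i)).1]
    simp only [mul_neg, Finset.sum_neg_distrib] at this
    linarith
  have hEz : ∑ q, P q * z q ≤ 4 := by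
    rw [hz, hav (fun i q => (e i q - b i) ^ 2)]
    exact hple _ _ (hdev b hb)
  have hEy2 : ∑ q, P q * y q ^ 2 ≤ 4 := by
    calc ∑ q, P q * y q ^ 2 ≤ ∑ q, P q * ∑ i, p i * (e i q - t i) ^ 2 := by
          refine Finset.sum_le_sum fun q _ => mul_le_mul_of_nonneg_left ?_ (hP q)
          -- Jensen's inequality for the square, as Cauchy–Schwarz with the vectors `√(p i)` and
          -- `√(p i) * (e i q - t i)`.
          have h := Finset.sum_mul_sq_le_sq_mul_sq Finset.univ (fun i => √(p i))
            (fun i => √(p i) * (e i q - t i))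
          simp only [← mul_assoc, mul_pow, Real.sq_sqrt (hp _), Real.mul_self_sqrt (hp _),
            hp1, one_mul] at h
          exact h
      _ ≤ 4 := by
          rw [hav (fun i q => (e i q - t i) ^ 2)]
          exact hple _ _ (hdev t ht)
  have hzb : ∀ q, 0 ≤ z q ∧ β * (β * z q) ≤ 1 / 16 := by
    intro q
    refine ⟨Finset.sum_nonneg fun i _ => mul_nonneg (hp i) (sq_nonneg _), ?_⟩
    have := hple (fun i => (β * (e i q - b i)) ^ 2) (1 / 16) fun i => by
      have h1 := abs_le.1 (hβe i q)
      have h2 := abs_le.1 (hb i)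
      have h3 : |β * (e i q - b i)| ≤ 1 / 4 := abs_le.2 ⟨by nlinarith, by nlinarith⟩
      calc (β * (e i q - b i)) ^ 2 = |β * (e i q - b i)| ^ 2 := (sq_abs _).symm
        _ ≤ (1 / 4) ^ 2 := pow_le_pow_left₀ (abs_nonneg _) h3 2
        _ = 1 / 16 := by norm_num
    calc β * (β * z q) = ∑ i, p i * (β * (e i q - b i)) ^ 2 := by
          rw [hz]; simp only [Finset.mul_sum]
          exact Finset.sum_congr rfl fun _ _ => by ring
      _ ≤ 1 / 16 := this
  have hxb : ∀ i q, |β * (e i q - t i)| ≤ 1 / 4 := by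
    intro i q
    have h1 := abs_le.1 (hβe i q)
    have h2 := abs_le.1 (ht i)
    exact abs_le.2 ⟨by nlinarith, by nlinarith⟩
  have hyb : ∀ q, -(1 / 4) ≤ β * y q := by
    intro q
    have := hple (fun i => -(β * (e i q - t i))) (1 / 4) fun i => by
      linarith [(abs_le.1 (hxb i q)).1]
    have h2 : ∑ i, p i * -(β * (e i q - t i)) = -(β * y q) := by
      rw [hy]; simp only [Finset.mul_sum, ← Finset.sum_neg_distrib]
      exact Finset.sum_congr rfl fun _ _ => by ring
    linarith
  refine sum_mul_exp_le hP hP1 (fun q => ?_) ?_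
  -- The exponent is at most `1/4 + 1/4 + 1/16`, within the range of the second-order bound of
  -- `exp`.
  · have h1 := (abs_le.1 (hxb i q)).2
    have h2 := hyb q
    have h3 := (hzb q).2
    nlinarith
  -- The mean of the bracket is at most `2β` from the bias of `e i`, `2β` from that of the average
  -- `y`, and `4β` from the quadratic correction `z`.
  · have hE : ∑ q, P q * (β * (e i q - t i - y q + β * z q)) ≤ 8 * β ^ 2 := by
      have : ∑ q, P q * (β * (e i q - t i - y q + β * z q)) =
          β * (∑ q, P q * (e i q - t i)) - β * (∑ q, P q * y q) + β * β * ∑ q, P q * z q := by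
        rw [Finset.mul_sum, Finset.mul_sum, Finset.mul_sum, ← Finset.sum_sub_distrib,
          ← Finset.sum_add_distrib]
        exact Finset.sum_congr rfl fun _ _ => by ring
      rw [this, hmean]
      have := (abs_le.1 (hbias i)).2
      nlinarith [mul_le_mul_of_nonneg_left hEz (mul_pos hβ hβ).le]
    -- Second moments: `3 * 4 + 3 * 4 + 3/16 * 4 < 25`. Together with the mean this leaves `33 β²`,
    -- below the claimed `40 β²`.
    have hE2 : ∑ q, P q * (β * (e i q - t i - y q + β * z q)) ^ 2 ≤ 25 * β ^ 2 := by
      calc ∑ q, P q * (β * (e i q - t i - y q + β * z q)) ^ 2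
          ≤ ∑ q, (3 * β ^ 2 * (P q * (e i q - t i) ^ 2) + 3 * β ^ 2 * (P q * y q ^ 2) +
              3 / 16 * β ^ 2 * (P q * z q)) := by
            refine Finset.sum_le_sum fun q _ => ?_
            have h1 : (e i q - t i - y q + β * z q) ^ 2 ≤
                3 * (e i q - t i) ^ 2 + 3 * y q ^ 2 + 3 * (β * z q) ^ 2 := by
              nlinarith [sq_nonneg (e i q - t i + y q), sq_nonneg (e i q - t i - β * z q),
                sq_nonneg (y q + β * z q)]
            have h2 : (β * z q) ^ 2 ≤ 1 / 16 * z q := by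
              have := mul_le_mul_of_nonneg_right (hzb q).2 (hzb q).1
              linarith
            have h3 := mul_le_mul_of_nonneg_left
              (h1.trans (by linarith : _ ≤ 3 * (e i q - t i) ^ 2 + 3 * y q ^ 2 + 3 / 16 * z q))
              (mul_nonneg (hP q) (sq_nonneg β))
            linarith
        _ = 3 * β ^ 2 * (∑ q, P q * (e i q - t i) ^ 2) + 3 * β ^ 2 * (∑ q, P q * y q ^ 2) +
              3 / 16 * β ^ 2 * ∑ q, P q * z q := by
            rw [Finset.sum_add_distrib, Finset.sum_add_distrib, Finset.mul_sum, Finset.mul_sum,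
              Finset.mul_sum]
        _ ≤ 3 * β ^ 2 * 4 + 3 * β ^ 2 * 4 + 3 / 16 * β ^ 2 * 4 := by
            gcongr
            exact hdev t ht i
        _ ≤ _ := by nlinarith [sq_nonneg β]
    nlinarith [sq_nonneg β]

/-! ## Sampling an entry of a matrix -/

variable {n N : ℕ}

/-- The sum of the squares of a row. -/
def rowSq (X : Matrix (Fin n) (Fin n) ℝ) (j : Fin n) : ℝ := ∑ l, X j l ^ 2

theorem sum_rowSq (X : Matrix (Fin n) (Fin n) ℝ) : ∑ j, rowSq X j = matDot X X := by
  simp [rowSq, matDot, pow_two]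

/-- Truncation to the interval `[-c, c]`. -/
def clip (c y : ℝ) : ℝ := max (-c) (min c y)

theorem abs_clip_le {c : ℝ} (hc : 0 ≤ c) (y : ℝ) : |clip c y| ≤ c :=
  abs_le.2 ⟨le_max_left _ _, max_le (by linarith) (min_le_left _ _)⟩

theorem clip_sq_le {c : ℝ} (hc : 0 ≤ c) (y : ℝ) : clip c y ^ 2 ≤ y ^ 2 := by
  rw [sq_le_sq, clip]
  rcases le_total c y with h | h
  · rw [min_eq_left h, max_eq_right (by linarith), abs_of_nonneg hc, abs_of_nonneg (by linarith)]
    exact h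
  · rw [min_eq_right h]
    rcases le_total (-c) y with h' | h'
    · rw [max_eq_right h']
    · rw [max_eq_left h', abs_neg, abs_of_nonneg hc, abs_of_nonpos (by linarith)]
      linarith

/-- This is `(|y| - 2c)² ≥ 0`. A quadratic bound is wanted because it controls the bias caused by
clipping through the second moment. -/
theorem abs_clip_sub_le {c : ℝ} (hc : 0 < c) (y : ℝ) : |clip c y - y| ≤ y ^ 2 / (4 * c) := by
  rw [le_div_iff₀ (by positivity), clip]
  rcases le_total c y with h | h
  · rw [min_eq_left h, max_eq_right (by linarith), abs_of_nonpos (by linarith)]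
    nlinarith [sq_nonneg (y - 2 * c)]
  · rw [min_eq_right h]
    rcases le_total (-c) y with h' | h'
    · rw [max_eq_right h']; simp; positivity
    · rw [max_eq_left h', abs_of_nonneg (by linarith)]
      nlinarith [sq_nonneg (y + 2 * c)]

/-- The estimate of `a • X` obtained from the entry `(J, L)`. -/
def entryEst (a X : Matrix (Fin n) (Fin n) ℝ) (β : ℝ) (J L : Fin n) : ℝ :=
  clip (1 / (8 * β)) ((∑ j, rowSq X j) * a J L / X J L)

/-- Sampling a row by its squared norm and then a column within the row gives `(J, L)` probability
`X(J,L)² / ‖X‖²`, with time linear in `n` after the row norms are known. The column draw is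
integrated first, for a fixed row. -/
theorem lintegral_pick_pick_le [NeZero n] {X : Matrix (Fin n) (Fin n) ℝ} (hX : 0 < matDot X X)
    {p q : ℕ} (hpq : p ≠ q) (f : Fin n → Fin n → ENNReal) :
    ∫⁻ ω, f (pick (rowSq X) (ω p)) (pick (fun l => X (pick (rowSq X) (ω p)) l ^ 2) (ω q))
      ∂uniformTape ≤ ∑ x : Fin n × Fin n, ENNReal.ofReal (X x.1 x.2 ^ 2 / matDot X X) *
        f x.1 x.2 := by
  classical
  set c := ∑ j, ∑ l, f j l
  have hf : ∀ j l, f j l ≤ c := fun j l =>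
    (Finset.single_le_sum (f := f j) (fun _ _ => zero_le) (Finset.mem_univ l)).trans
      (Finset.single_le_sum (f := fun j => ∑ l, f j l) (fun _ _ => zero_le) (Finset.mem_univ j))
  have hmJ : Measurable fun ω : ℕ → unitInterval => pick (rowSq X) (ω p) :=
    measurable_pick (fun _ => measurable_const) (by fun_prop)
  have hmL : ∀ j, Measurable fun ω : ℕ → unitInterval => pick (fun l => X j l ^ 2) (ω q) :=
    fun j => measurable_pick (fun _ => measurable_const) (by fun_prop)
  have hmG : Measurable fun ω : ℕ → unitInterval =>
      f (pick (rowSq X) (ω p)) (pick (fun l => X (pick (rowSq X) (ω p)) l ^ 2) (ω q)) := by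
    have h : ∀ j, Measurable fun ω : ℕ → unitInterval => f j (pick (fun l => X j l ^ 2) (ω q)) :=
      fun j => (measurable_from_top (f := f j)).comp (hmL j)
    exact (measurable_from_prod_countable_left (f := fun x : (ℕ → unitInterval) × Fin n =>
      f x.2 (pick (fun l => X x.2 l ^ 2) (x.1 q))) h).comp (measurable_id.prodMk hmJ)
  -- A zero row admits no column distribution. It gets the crude bound `c`, which is harmless
  -- because the row has probability `0`.
  let φ : Fin n → ENNReal := fun j => if rowSq X j = 0 then c else
    ∑ l, ENNReal.ofReal (X j l ^ 2 / rowSq X j) * f j l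
  have hrow : ∀ j, 0 ≤ rowSq X j := fun j => Finset.sum_nonneg fun _ _ => sq_nonneg _
  have h1 := lintegral_mul_le_of_resample q (F := fun _ => 1) (G' := fun ω =>
    φ (pick (rowSq X) (ω p))) measurable_one hmG (fun _ _ => rfl) fun ω => by
      simp only [Function.update_of_ne hpq, Function.update_self]
      set J := pick (rowSq X) (ω p)
      simp only [φ]
      split_ifs with h
      · calc _ ≤ ∫⁻ _u : unitInterval, c := lintegral_mono fun u => hf _ _
          _ = c := by simp
      · exact lintegral_pick_le (lt_of_le_of_ne (hrow J) (Ne.symm h)) (f J)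
  simp only [one_mul] at h1
  refine h1.trans ?_
  refine lintegral_le_of_resample p ((measurable_from_top (f := φ)).comp hmJ) fun ω => ?_
  simp only [Function.update_self]
  have hX' : 0 < ∑ j, rowSq X j := by rwa [sum_rowSq]
  refine (lintegral_pick_le hX' φ).trans ?_
  rw [Fintype.sum_prod_type]
  refine Finset.sum_le_sum fun j _ => ?_
  simp only [φ]
  split_ifs with h
  · rw [h]; simp
  · have hj : 0 < rowSq X j := lt_of_le_of_ne (hrow j) (Ne.symm h)
    rw [Finset.mul_sum]
    refine Finset.sum_le_sum fun l _ => ?_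
    rw [← mul_assoc, ← ENNReal.ofReal_mul (div_nonneg hj.le hX'.le), sum_rowSq]
    refine le_of_eq ?_
    congr 2
    field_simp

/-- Dividing by the entry cancels against its probability, leaving at most `‖X‖² ‖a‖²`; zero entries
of `X` have probability `0`. Clipping only decreases the square. -/
theorem sum_entryEst_sq_le {a X : Matrix (Fin n) (Fin n) ℝ} (ha : matDot a a ≤ 1)
    (hpos : 0 < matDot X X) (hX : matDot X X ≤ 1) {β : ℝ} (hβ : 0 < β) :
    ∑ x : Fin n × Fin n, X x.1 x.2 ^ 2 / matDot X X * entryEst a X β x.1 x.2 ^ 2 ≤ 1 := by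
  have hc : 0 ≤ 1 / (8 * β) := by positivity
  calc _ ≤ ∑ x : Fin n × Fin n, matDot X X * (a x.1 x.2 * a x.1 x.2) := by
        refine Finset.sum_le_sum fun x _ => ?_
        refine (mul_le_mul_of_nonneg_left (clip_sq_le hc _)
          (div_nonneg (sq_nonneg _) hpos.le)).trans ?_
        rw [sum_rowSq]
        rcases eq_or_ne (X x.1 x.2) 0 with h | h
        · rw [h]
          have := mul_nonneg hpos.le (mul_self_nonneg (a x.1 x.2))
          simpa using this
        · refine le_of_eq ?_
          field_simp
    _ = matDot X X * matDot a a := by rw [matDot_eq_sum a a, Finset.mul_sum]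
    _ ≤ 1 := by nlinarith [matDot_self_nonneg a]

/-- Without clipping the estimate is unbiased. Clipping at `c = 1/(8β)` changes the mean by at most
the second moment over `4c`, which is `2β`. -/
theorem abs_sum_entryEst_sub_le {a X : Matrix (Fin n) (Fin n) ℝ} (ha : matDot a a ≤ 1)
    (hpos : 0 < matDot X X) (hX : matDot X X ≤ 1) {β : ℝ} (hβ : 0 < β) :
    |∑ x : Fin n × Fin n, X x.1 x.2 ^ 2 / matDot X X * entryEst a X β x.1 x.2 - matDot a X| ≤
      2 * β := by
  have hc : 0 < 1 / (8 * β) := by positivity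
  rw [matDot_eq_sum a X, ← Finset.sum_sub_distrib]
  refine (Finset.abs_sum_le_sum_abs _ _).trans ?_
  calc _ ≤ ∑ x : Fin n × Fin n, 2 * β * (matDot X X * (a x.1 x.2 * a x.1 x.2)) := by
        refine Finset.sum_le_sum fun x _ => ?_
        rcases eq_or_ne (X x.1 x.2) 0 with h | h
        · have := mul_nonneg (mul_pos two_pos hβ).le
            (mul_nonneg hpos.le (mul_self_nonneg (a x.1 x.2)))
          simpa [h] using this
        · have e : a x.1 x.2 * X x.1 x.2 = X x.1 x.2 ^ 2 / matDot X X *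
              (matDot X X * a x.1 x.2 / X x.1 x.2) := by field_simp
          have hP : 0 ≤ X x.1 x.2 ^ 2 / matDot X X := div_nonneg (sq_nonneg _) hpos.le
          rw [e, ← mul_sub, abs_mul, abs_of_nonneg hP, entryEst, sum_rowSq]
          refine (mul_le_mul_of_nonneg_left (abs_clip_sub_le hc _) hP).trans (le_of_eq ?_)
          field_simp; ring
    _ = 2 * β * (matDot X X * matDot a a) := by
        rw [matDot_eq_sum a a, Finset.mul_sum, Finset.mul_sum]
    _ ≤ 2 * β := by
        have : matDot X X * matDot a a ≤ 1 := by nlinarith [matDot_self_nonneg a]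
        nlinarith

/-- The contribution of the sampled entry `(J, L)` to the error for the constraint `i`. -/
def estDev (a : Fin N → Matrix (Fin n) (Fin n) ℝ) (b w : Fin N → ℝ)
    (X : Matrix (Fin n) (Fin n) ℝ) (β : ℝ) (i : Fin N) (J L : Fin n) : ℝ :=
  entryEst (a i) X β J L - matDot (a i) X -
    wmean w (fun i' => entryEst (a i') X β J L - matDot (a i') X) +
    β * wmean w (fun i' => (entryEst (a i') X β J L - b i') ^ 2)

/-- The exponential moment of the error of the estimated losses. -/
theorem lintegral_exp_estimate_le [NeZero n] [NeZero N] {a : Fin N → Matrix (Fin n) (Fin n) ℝ}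
    {b w : Fin N → ℝ} {X : Matrix (Fin n) (Fin n) ℝ} {β : ℝ} (ha : ∀ i, matDot (a i) (a i) ≤ 1)
    (hb : ∀ i, |b i| ≤ 1) (hw : ∀ i, 0 < w i) (hX : matDot X X ≤ 1) (hβ : 0 < β)
    (hβ1 : β ≤ 1 / 8) {p q : ℕ} (hpq : p ≠ q) (i : Fin N) :
    ∫⁻ ω, ENNReal.ofReal (Real.exp (β * estDev a b w X β i (pick (rowSq X) (ω p))
        (pick (fun l => X (pick (rowSq X) (ω p)) l ^ 2) (ω q)))) ∂uniformTape ≤ ENNReal.ofReal (Real.exp (40 * β ^ 2)) := by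
  have hc : 0 < 1 / (8 * β) := by positivity
  -- The point `X = 0` does occur, as the initial one. All estimates then vanish and only `β` times
  -- the mean of `b²` is left.
  rcases (matDot_self_nonneg X).eq_or_lt with h0 | hpos
  · have hX0 : ∀ i, matDot (a i) X = 0 := fun i => by
      have := matDot_sq_le (a i) X
      rw [← h0, mul_zero] at this
      exact pow_eq_zero_iff two_ne_zero |>.1 (le_antisymm this (sq_nonneg _))
    have he0 : ∀ i J L, entryEst (a i) X β J L = 0 := fun i J L => by
      simp only [entryEst, sum_rowSq, ← h0, zero_mul, zero_div, clip]
      rw [min_eq_right hc.le, max_eq_right (by linarith)]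
    simp only [estDev, hX0, he0, sub_self, zero_sub, neg_sq]
    have hz : wmean w (fun _ : Fin N => (0 : ℝ)) = 0 := by simp [wmean]
    have hle : wmean w (fun i => b i ^ 2) ≤ 1 := (le_abs_self _).trans
      (abs_wmean_le hw fun i => by
        rw [abs_of_nonneg (sq_nonneg _)]; exact (sq_le_one_iff_abs_le_one _).2 (hb i))
    rw [lintegral_const, measure_univ, mul_one, hz]
    refine ENNReal.ofReal_le_ofReal (Real.exp_le_exp.2 ?_)
    nlinarith [mul_pos hβ hβ]
  let P : Fin n × Fin n → ℝ := fun x => X x.1 x.2 ^ 2 / matDot X X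
  have hP : ∀ x, 0 ≤ P x := fun x => div_nonneg (sq_nonneg _) hpos.le
  have hP1 : ∑ x, P x = 1 := by
    simp only [P]
    rw [← Finset.sum_div, div_eq_one_iff_eq hpos.ne', matDot_eq_sum]
    exact Finset.sum_congr rfl fun _ _ => pow_two _
  have key := sum_mul_exp_estimate_le hP hP1 hw
    (e := fun i x => entryEst (a i) X β x.1 x.2) (t := fun i => matDot (a i) X) (b := b) hβ hβ1
    (fun i x => abs_clip_le hc.le _) (fun i => sum_entryEst_sq_le (ha i) hpos hX hβ)
    (fun i => abs_sum_entryEst_sub_le (ha i) hpos hX hβ)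
    (fun i => abs_matDot_le_one (ha i) hX) hb i
  have key' : ∑ x, P x * Real.exp (β * estDev a b w X β i x.1 x.2) ≤ Real.exp (40 * β ^ 2) := key
  clear key
  have h := lintegral_pick_pick_le hpos hpq
    fun J L => ENNReal.ofReal (Real.exp (β * estDev a b w X β i J L))
  refine h.trans (le_trans (le_of_eq ?_) (ENNReal.ofReal_le_ofReal key'))
  rw [ENNReal.ofReal_sum_of_nonneg fun x _ => mul_nonneg (hP x) (Real.exp_pos _).le]
  exact Finset.sum_congr rfl fun x _ => (ENNReal.ofReal_mul (hP x)).symm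

end

noncomputable section

/-! ## The primal-dual iteration -/

open Matrix RealRAM

variable {n N : ℕ}

/-- The variables of the iteration: the dual weights, the primal point and the sum of the
previous primal points. -/
structure IterState (n N : ℕ) where
  /-- the dual weights -/
  w : Fin N → ℝ
  /-- the primal point -/
  X : Matrix (Fin n) (Fin n) ℝ
  /-- the sum of the previous primal points -/
  sum : Matrix (Fin n) (Fin n) ℝ

/-- The gradient step for the constraint matrix `a` and the penalty direction `v`. -/
def ascent (a X : Matrix (Fin n) (Fin n) ℝ) (β : ℝ) (v : Fin n → ℝ) :
    Matrix (Fin n) (Fin n) ℝ :=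
  Matrix.of fun j l => X j l + β * ((a j l + a l j) / 2 + penalty X v * (v j * v l))

/-- The divisor used to project onto the unit ball. -/
def ballDiv (r : ℝ) : ℝ := open Classical in if 1 < r then √r else 1

/-- The projection onto the unit ball. -/
def ballProj (Y : Matrix (Fin n) (Fin n) ℝ) : Matrix (Fin n) (Fin n) ℝ :=
  Matrix.of fun j l => Y j l / ballDiv (matDot Y Y)

/-- The factor by which a weight is multiplied. -/
def weightFactor (β y : ℝ) : ℝ := 1 - β * y + (β * y) * (β * y)

/-- The quadratic factor replaces `exp (-βy)`, which the machine cannot evaluate. It is positive for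
every `y`, so the weights never degenerate. -/
theorem weightFactor_pos (β y : ℝ) : 0 < weightFactor β y := by
  unfold weightFactor
  nlinarith [sq_nonneg (β * y - 1 / 2)]

theorem ballProj_eq (Y : Matrix (Fin n) (Fin n) ℝ) :
    ballProj Y = (ballDiv (matDot Y Y))⁻¹ • Y := by
  ext j l; simp [ballProj, div_eq_inv_mul]

theorem matDot_ballProj_self_le (Y : Matrix (Fin n) (Fin n) ℝ) :
    matDot (ballProj Y) (ballProj Y) ≤ 1 := by
  rw [ballProj_eq, matDot_smul_left, matDot_smul_right, ballDiv]
  split_ifs with h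
  · have h1 := Real.mul_self_sqrt (matDot_self_nonneg Y)
    have h2 : 0 < √(matDot Y Y) := Real.sqrt_pos.2 (by linarith)
    rw [← mul_assoc, ← mul_inv, h1, inv_mul_cancel₀ (by linarith)]
  · simpa using h

/-- The projection onto the unit ball does not increase the distance to a point of the ball. -/
theorem matDot_ballProj_sub_le (Y : Matrix (Fin n) (Fin n) ℝ) {U : Matrix (Fin n) (Fin n) ℝ}
    (hU : matDot U U ≤ 1) :
    matDot (ballProj Y - U) (ballProj Y - U) ≤ matDot (Y - U) (Y - U) := by
  rw [ballProj_eq, ballDiv]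
  split_ifs with h
  · set c := √(matDot Y Y)
    have h1 : c * c = matDot Y Y := Real.mul_self_sqrt (matDot_self_nonneg Y)
    have h2 : 1 < c := by rw [Real.lt_sqrt zero_le_one]; simpa using h
    have h3 : matDot Y U ≤ c := by
      have h4 := matDot_sq_le Y U
      have h5 : matDot Y U ^ 2 ≤ c ^ 2 := by nlinarith
      exact abs_le_of_sq_le_sq' h5 (by linarith) |>.2
    simp only [matDot_sub_left, matDot_sub_right, matDot_smul_left, matDot_smul_right,
      matDot_comm U Y, ← h1]
    have e : c⁻¹ * (c⁻¹ * (c * c) - matDot Y U) = 1 - c⁻¹ * matDot Y U := by field_simp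
    rw [e]
    have h6 : c⁻¹ * matDot Y U ≤ 1 := by
      rw [inv_mul_le_iff₀ (by linarith)]; linarith
    have h7 : matDot Y U = c * (c⁻¹ * matDot Y U) := by field_simp
    set x := c⁻¹ * matDot Y U
    rw [h7]
    nlinarith
  · simp

theorem ascent_eq (a X : Matrix (Fin n) (Fin n) ℝ) (β : ℝ) (v : Fin n → ℝ) :
    ascent a X β v =
      X + β • ((1 / 2 : ℝ) • (a + aᵀ) + penalty X v • vecMulVec v v) := by
  ext j l
  simp [ascent, vecMulVec_apply]
  ring

theorem matDot_transpose_left (a X : Matrix (Fin n) (Fin n) ℝ) :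
    matDot aᵀ X = matDot a Xᵀ := by
  rw [matDot, Finset.sum_comm]; rfl

/-- The constraint matrices need not be symmetric. Symmetrizing the gradient keeps the iterates
symmetric and costs nothing, since only pairings with symmetric matrices matter. -/
theorem matDot_sym_left (a : Matrix (Fin n) (Fin n) ℝ) {X : Matrix (Fin n) (Fin n) ℝ}
    (hX : Xᵀ = X) : matDot ((1 / 2 : ℝ) • (a + aᵀ)) X = matDot a X := by
  rw [matDot_smul_left, matDot_add_left, matDot_transpose_left, hX]; ring

theorem transpose_ballProj {Y : Matrix (Fin n) (Fin n) ℝ} (hY : Yᵀ = Y) :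
    (ballProj Y)ᵀ = ballProj Y := by
  rw [ballProj_eq, transpose_smul, hY]

theorem transpose_ascent (a : Matrix (Fin n) (Fin n) ℝ) {X : Matrix (Fin n) (Fin n) ℝ}
    (hX : Xᵀ = X) (β : ℝ) (v : Fin n → ℝ) : (ascent a X β v)ᵀ = ascent a X β v := by
  ext j l
  have : X l j = X j l := congrFun (congrFun hX j) l
  simp only [transpose_apply, ascent, of_apply, this]; ring

theorem wmean_sub (w f g : Fin N → ℝ) :
    wmean w (fun i => f i - g i) = wmean w f - wmean w g := by
  simp only [wmean, mul_sub, Finset.sum_sub_distrib, sub_div]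

variable [NeZero n] [NeZero N]

/-- The sampled row. -/
def rowIdx (X : Matrix (Fin n) (Fin n) ℝ) (ω : ℕ → unitInterval) (p : ℕ) : Fin n :=
  pick (rowSq X) (ω p)

/-- The sampled column. -/
def colIdx (X : Matrix (Fin n) (Fin n) ℝ) (ω : ℕ → unitInterval) (p : ℕ) : Fin n :=
  pick (fun l => X (rowIdx X ω p) l ^ 2) (ω (p + 1))

/-- One round of the iteration, with the random numbers from position `p` on. -/
def iterStep (a : Fin N → Matrix (Fin n) (Fin n) ℝ) (b : Fin N → ℝ) (β : ℝ) (k : ℕ)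
    (ω : ℕ → unitInterval) (p : ℕ) (s : IterState n N) : IterState n N where
  w i := s.w i * weightFactor β
    (entryEst (a i) s.X β (rowIdx s.X ω (p + 1)) (colIdx s.X ω (p + 1)) - b i)
  X := ballProj (ascent (a (pick s.w (ω p))) s.X β (chebVec s.X (startVec n (p + 3) ω) k))
  sum := s.sum + s.X

/-- The state after `t` rounds. -/
def iterRun (a : Fin N → Matrix (Fin n) (Fin n) ℝ) (b : Fin N → ℝ) (β : ℝ) (k : ℕ)
    (ω : ℕ → unitInterval) : ℕ → IterState n N
  | 0 => ⟨fun _ => 1, 0, 0⟩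
  | t + 1 => iterStep a b β k ω ((n + 3) * t) (iterRun a b β k ω t)

section Run

variable (a : Fin N → Matrix (Fin n) (Fin n) ℝ) (b : Fin N → ℝ) (β : ℝ) (k : ℕ)
  (ω : ℕ → unitInterval)

theorem iterRun_w_pos (t : ℕ) (i : Fin N) : 0 < (iterRun a b β k ω t).w i := by
  induction t with
  | zero => exact one_pos
  | succ t ih => exact mul_pos ih (weightFactor_pos _ _)

theorem iterRun_transpose (t : ℕ) : (iterRun a b β k ω t).Xᵀ = (iterRun a b β k ω t).X := by
  induction t with
  | zero => exact transpose_zero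
  | succ t ih => exact transpose_ballProj (transpose_ascent _ ih _ _)

theorem iterRun_matDot_le (t : ℕ) :
    matDot (iterRun a b β k ω t).X (iterRun a b β k ω t).X ≤ 1 := by
  cases t with
  | zero => simp [iterRun, matDot]
  | succ t => exact matDot_ballProj_self_le _

theorem iterRun_sum (T : ℕ) :
    (iterRun a b β k ω T).sum = ∑ t ∈ Finset.range T, (iterRun a b β k ω t).X := by
  induction T with
  | zero => rfl
  | succ t ih => rw [Finset.sum_range_succ, ← ih]; rfl

/-- The constraint sampled in round `t`. -/
def constrIdx (t : ℕ) : Fin N := pick (iterRun a b β k ω t).w (ω ((n + 3) * t))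

/-- The approximate eigenvector of round `t`. -/
def roundVec (t : ℕ) : Fin n → ℝ :=
  chebVec (iterRun a b β k ω t).X (startVec n ((n + 3) * t + 3) ω) k

/-- The slack of the constraint `i` in round `t`. -/
def slack (t : ℕ) (i : Fin N) : ℝ := matDot (a i) (iterRun a b β k ω t).X - b i

/-- The estimated slack of the constraint `i` in round `t`. -/
def slackEst (t : ℕ) (i : Fin N) : ℝ :=
  entryEst (a i) (iterRun a b β k ω t).X β (rowIdx (iterRun a b β k ω t).X ω ((n + 3) * t + 1))
    (colIdx (iterRun a b β k ω t).X ω ((n + 3) * t + 1)) - b i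

/-- The error from sampling the constraint in round `t`. -/
def constrDev (t : ℕ) : ℝ := slack a b β k ω t (constrIdx a b β k ω t) -
  wmean (iterRun a b β k ω t).w (slack a b β k ω t)

/-- The error from estimating the slacks in round `t`. -/
def slackDev (t : ℕ) (i : Fin N) : ℝ :=
  estDev a b (iterRun a b β k ω t).w (iterRun a b β k ω t).X β i
    (rowIdx (iterRun a b β k ω t).X ω ((n + 3) * t + 1))
    (colIdx (iterRun a b β k ω t).X ω ((n + 3) * t + 1))

/-- The value of the penalty of round `t`. -/
def roundPenalty (t : ℕ) : ℝ := penaltyVal (iterRun a b β k ω t).X (roundVec a b β k ω t)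

/-- The error of the approximate eigenvector of round `t`. -/
def roundEigErr (t : ℕ) : ℝ := eigErr (iterRun a b β k ω t).X (roundVec a b β k ω t)

theorem slackDev_eq (t : ℕ) (i : Fin N) :
    slackDev a b β k ω t i = slackEst a b β k ω t i - slack a b β k ω t i -
      wmean (iterRun a b β k ω t).w (slackEst a b β k ω t) +
      wmean (iterRun a b β k ω t).w (slack a b β k ω t) +
      β * wmean (iterRun a b β k ω t).w (fun i => slackEst a b β k ω t i ^ 2) := by
  have h : ∀ i', entryEst (a i') (iterRun a b β k ω t).X β
      (rowIdx (iterRun a b β k ω t).X ω ((n + 3) * t + 1))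
      (colIdx (iterRun a b β k ω t).X ω ((n + 3) * t + 1)) - matDot (a i') (iterRun a b β k ω t).X =
      slackEst a b β k ω t i' - slack a b β k ω t i' := fun i' => by
    rw [slackEst, slack]; ring
  rw [slackDev, estDev]
  simp only [h, wmean_sub]
  rw [show (fun i' => (entryEst (a i') (iterRun a b β k ω t).X β
    (rowIdx (iterRun a b β k ω t).X ω ((n + 3) * t + 1))
    (colIdx (iterRun a b β k ω t).X ω ((n + 3) * t + 1)) - b i') ^ 2) =
    fun i => slackEst a b β k ω t i ^ 2 from rfl]
  ring

variable {a b β}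

/-- The regret bound of the primal player. -/
theorem primal_regret (ha : ∀ i, matDot (a i) (a i) ≤ 1) (hβ : 0 ≤ β)
    {U : Matrix (Fin n) (Fin n) ℝ} (hU : U.PosSemidef) (hU1 : matDot U U ≤ 1)
    (hfeas : ∀ i, b i ≤ matDot (a i) U) (T : ℕ) :
    -(2 * β) * ∑ t ∈ Finset.range T, (slack a b β k ω t (constrIdx a b β k ω t) +
      roundPenalty a b β k ω t) ≤ 1 + 9 * β ^ 2 * T := by
  have hUt : Uᵀ = U := by
    simpa [conjTranspose_eq_transpose_of_trivial] using hU.isHermitian.eq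
  -- The potential is the squared distance to the feasible point `U`; it is at most `1` initially
  -- because the iteration starts at `0`.
  suffices H : matDot ((iterRun a b β k ω T).X - U) ((iterRun a b β k ω T).X - U) ≤
      1 + 2 * β * (∑ t ∈ Finset.range T, (slack a b β k ω t (constrIdx a b β k ω t) +
      roundPenalty a b β k ω t)) + 9 * β ^ 2 * T by
    have := matDot_self_nonneg ((iterRun a b β k ω T).X - U)
    linarith
  induction T with
  | zero =>
    have : (iterRun a b β k ω 0).X = 0 := rfl
    simp only [this, zero_sub, Finset.range_zero, Finset.sum_empty]
    have : matDot (-U) (-U) = matDot U U := by simp [matDot]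
    rw [this]; simpa using hU1
  | succ t ih =>
    set X := (iterRun a b β k ω t).X with hX
    set v := roundVec a b β k ω t
    set I := constrIdx a b β k ω t
    set S := (1 / 2 : ℝ) • (a I + (a I)ᵀ) with hS
    set Z := vecMulVec v v with hZ
    set z := penalty X v with hz
    have hXt : Xᵀ = X := iterRun_transpose a b β k ω t
    have e1 : (iterRun a b β k ω (t + 1)).X = ballProj (X + β • (S + z • Z)) := by
      rw [hS, hZ, hz, ← ascent_eq]; rfl
    rw [e1, Finset.sum_range_succ]
    refine (matDot_ballProj_sub_le _ hU1).trans ?_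
    have hSX : matDot S X = matDot (a I) X := matDot_sym_left _ hXt
    have hSU : matDot S U = matDot (a I) U := matDot_sym_left _ hUt
    have hZX : z * matDot Z X = roundPenalty a b β k ω t := by
      rw [hZ, ← dotProduct_mulVec_eq_matDot]; rfl
    have hz0 : 0 ≤ z := penalty_nonneg _ _
    have hZU : 0 ≤ z * matDot Z U := by
      refine mul_nonneg hz0 ?_
      rw [hZ, ← dotProduct_mulVec_eq_matDot]
      simpa using hU.dotProduct_mulVec_nonneg v
    have hSS : matDot S S ≤ 1 := by
      have h1 : matDot (a I)ᵀ (a I)ᵀ = matDot (a I) (a I) := by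
        rw [matDot_transpose_left, transpose_transpose]
      have h2 := (abs_le.1 (abs_matDot_le_one (ha I) (h1.trans_le (ha I)))).2
      have h3 := ha I
      rw [hS, matDot_smul_left, matDot_smul_right]
      simp only [matDot_add_left, matDot_add_right]
      rw [h1, matDot_comm (a I)ᵀ]
      linarith
    have hzZ : matDot (z • Z) (z • Z) ≤ 4 := by
      rw [matDot_smul_left, matDot_smul_right, hZ, matDot_vecMulVec_self]
      have h1 := penalty_mul_le X v
      have h2 : 0 ≤ z * (v ⬝ᵥ v) := mul_nonneg hz0 (dotProduct_self_nonneg' v)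
      nlinarith
    have hcross : matDot S (z • Z) ≤ 2 := by
      have h1 := matDot_sq_le S (z • Z)
      have h2 := matDot_self_nonneg (z • Z)
      nlinarith
    -- `9 = 1 + 2 * 2 + 4`, as the symmetrized constraint has norm at most `1` and the penalty
    -- matrix at most `2`.
    have hGG : matDot (S + z • Z) (S + z • Z) ≤ 9 := by
      simp only [matDot_add_left, matDot_add_right]
      rw [matDot_comm (z • Z) S]
      linarith
    have hexp : matDot (X + β • (S + z • Z) - U) (X + β • (S + z • Z) - U) =
        matDot (X - U) (X - U) + 2 * β * (matDot S X + z * matDot Z X - matDot S U -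
          z * matDot Z U) + β ^ 2 * matDot (S + z • Z) (S + z • Z) := by
      have e : X + β • (S + z • Z) - U = (X - U) + β • (S + z • Z) := by abel
      rw [e]
      set G := S + z • Z with hG
      have h1 : matDot G (X - U) = matDot S X + z * matDot Z X - matDot S U - z * matDot Z U := by
        rw [hG, matDot_sub_right, matDot_add_left, matDot_add_left, matDot_smul_left Z X z,
          matDot_smul_left Z U z]; ring
      rw [matDot_add_left, matDot_add_right, matDot_add_right, matDot_smul_left, matDot_smul_left,
        matDot_smul_right, matDot_smul_right, matDot_comm (X - U) G, h1]
      ring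
    rw [hexp, hSX, hSU, hZX]
    have hI := hfeas I
    have hsl : slack a b β k ω t I = matDot (a I) X - b I := rfl
    rw [hsl]
    push_cast
    -- Feasibility of `U` is used twice: it satisfies the sampled constraint, and its pairing with
    -- the penalty matrix is nonnegative.
    have h1 : 2 * β * (matDot (a I) X + roundPenalty a b β k ω t - matDot (a I) U -
        z * matDot Z U) ≤ 2 * β * (matDot (a I) X - b I + roundPenalty a b β k ω t) :=
      mul_le_mul_of_nonneg_left (by linarith) (by linarith)
    have h2 : β ^ 2 * matDot (S + z • Z) (S + z • Z) ≤ β ^ 2 * 9 :=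
      mul_le_mul_of_nonneg_left hGG (sq_nonneg _)
    linarith

theorem abs_mul_slackEst_le (hb : ∀ i, |b i| ≤ 1) (hβ : 0 < β) (hβ1 : β ≤ 1 / 8) (t : ℕ)
    (i : Fin N) : |β * slackEst a b β k ω t i| ≤ 1 := by
  have hc : 0 ≤ 1 / (8 * β) := by positivity
  rw [slackEst]
  set e := entryEst (a i) (iterRun a b β k ω t).X β
    (rowIdx (iterRun a b β k ω t).X ω ((n + 3) * t + 1))
    (colIdx (iterRun a b β k ω t).X ω ((n + 3) * t + 1))
  have h1 : |e| ≤ 1 / (8 * β) := abs_clip_le hc _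
  have h2 : |e - b i| ≤ 1 / (8 * β) + 1 := (abs_sub _ _).trans (add_le_add h1 (hb i))
  rw [abs_mul, abs_of_pos hβ]
  calc β * |e - b i| ≤ β * (1 / (8 * β) + 1) := by gcongr
    _ = 1 / 8 + β := by field_simp
    _ ≤ 1 := by linarith

/-- The regret bound of the dual player. -/
theorem dual_regret (hb : ∀ i, |b i| ≤ 1) (hβ : 0 < β) (hβ1 : β ≤ 1 / 8) (T : ℕ) (i : Fin N) :
    β * ∑ t ∈ Finset.range T, (wmean (iterRun a b β k ω t).w (slackEst a b β k ω t) -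
      β * wmean (iterRun a b β k ω t).w (fun i => slackEst a b β k ω t i ^ 2) -
      slackEst a b β k ω t i) ≤ Real.log N := by
  -- The weight of `i` is bounded below here, using `exp x ≤ 1 + x + x²`; the total weight is
  -- bounded above in `hup` by `1 + x ≤ exp x`. Comparing logarithms gives the regret.
  have hlow : Real.exp (-(β * ∑ t ∈ Finset.range T, slackEst a b β k ω t i)) ≤
      (iterRun a b β k ω T).w i := by
    induction T with
    | zero => simp [iterRun]
    | succ t ih =>
      rw [Finset.sum_range_succ, mul_add, neg_add, Real.exp_add]
      refine mul_le_mul ih ?_ (Real.exp_pos _).le (iterRun_w_pos a b β k ω t i).le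
      have h := abs_le.1 (abs_mul_slackEst_le (a := a) k ω hb hβ hβ1 t i)
      refine (exp_le_one_add_add_sq (by linarith)).trans (le_of_eq ?_)
      rw [weightFactor, ← slackEst]; ring
  have hup : ∑ j, (iterRun a b β k ω T).w j ≤ N * Real.exp (-(β * ∑ t ∈ Finset.range T,
      (wmean (iterRun a b β k ω t).w (slackEst a b β k ω t) -
      β * wmean (iterRun a b β k ω t).w (fun i => slackEst a b β k ω t i ^ 2)))) := by
    clear hlow
    induction T with
    | zero => simp [iterRun]
    | succ t ih =>
      rw [Finset.sum_range_succ, mul_add, neg_add, Real.exp_add, ← mul_assoc]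
      set w := (iterRun a b β k ω t).w with hw
      have hW : 0 < ∑ j, w j := sum_pos_of_pos (iterRun_w_pos a b β k ω t)
      have e : ∑ j, (iterRun a b β k ω (t + 1)).w j = (∑ j, w j) *
          (1 - β * (wmean w (slackEst a b β k ω t) -
          β * wmean w (fun i => slackEst a b β k ω t i ^ 2))) := by
        have h1 : ∀ j, (iterRun a b β k ω (t + 1)).w j = w j * (1 - β * slackEst a b β k ω t j +
            (β * slackEst a b β k ω t j) * (β * slackEst a b β k ω t j)) := fun j => rfl
        have hm : ∀ f, (∑ j, w j) * wmean w f = ∑ j, w j * f j := fun f =>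
          mul_div_cancel₀ _ hW.ne'
        have h3 : (∑ j, w j) * (1 - β * (wmean w (slackEst a b β k ω t) -
            β * wmean w (fun i => slackEst a b β k ω t i ^ 2))) =
            (∑ j, w j) - β * ((∑ j, w j) * wmean w (slackEst a b β k ω t)) + β * β *
              ((∑ j, w j) * wmean w (fun i => slackEst a b β k ω t i ^ 2)) := by ring
        rw [h3, hm, hm, Finset.mul_sum, Finset.mul_sum, ← Finset.sum_sub_distrib,
          ← Finset.sum_add_distrib]
        simp only [h1]
        exact Finset.sum_congr rfl fun _ _ => by ring
      rw [e]
      have h2 := Real.add_one_le_exp (-(β * (wmean w (slackEst a b β k ω t) -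
          β * wmean w (fun i => slackEst a b β k ω t i ^ 2))))
      calc _ ≤ (∑ j, w j) * Real.exp (-(β * (wmean w (slackEst a b β k ω t) -
          β * wmean w (fun i => slackEst a b β k ω t i ^ 2)))) := by
            refine mul_le_mul_of_nonneg_left ?_ hW.le
            linarith
        _ ≤ _ := mul_le_mul_of_nonneg_right ih (Real.exp_pos _).le
  have hN : (0 : ℝ) < N := by exact_mod_cast Nat.pos_of_ne_zero (NeZero.ne N)
  have h1 := (hlow.trans (Finset.single_le_sum (f := (iterRun a b β k ω T).w)
    (fun j _ => (iterRun_w_pos a b β k ω T j).le) (Finset.mem_univ i))).trans hup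
  have h2 := Real.log_le_log (Real.exp_pos _) h1
  rw [Real.log_exp, Real.log_mul hN.ne' (Real.exp_pos _).ne', Real.log_exp] at h2
  rw [Finset.sum_sub_distrib (g := fun t => slackEst a b β k ω t i)]
  linarith

/-- The bound on the violations in terms of the sampling errors. -/
theorem violation_le (ha : ∀ i, matDot (a i) (a i) ≤ 1) (hb : ∀ i, |b i| ≤ 1) (hβ : 0 < β)
    (hβ1 : β ≤ 1 / 8) {U : Matrix (Fin n) (Fin n) ℝ} (hU : U.PosSemidef) (hU1 : matDot U U ≤ 1)
    (hfeas : ∀ i, b i ≤ matDot (a i) U) (T : ℕ) (i : Fin N) :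
    ∑ t ∈ Finset.range T, (-slack a b β k ω t i - roundPenalty a b β k ω t) ≤
      1 / (2 * β) + 9 * β * T / 2 + Real.log N / β +
      ∑ t ∈ Finset.range T, (constrDev a b β k ω t + slackDev a b β k ω t i) := by
  have h1 := primal_regret k ω ha hβ.le hU hU1 hfeas T
  have h2 := dual_regret (a := a) k ω hb hβ hβ1 T i
  have h3 : ∑ t ∈ Finset.range T, (wmean (iterRun a b β k ω t).w (slackEst a b β k ω t) -
      β * wmean (iterRun a b β k ω t).w (fun i => slackEst a b β k ω t i ^ 2) -
      slackEst a b β k ω t i) ≤ Real.log N / β := by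
    rw [le_div_iff₀ hβ]; linarith
  have h4 : -∑ t ∈ Finset.range T, (slack a b β k ω t (constrIdx a b β k ω t) +
      roundPenalty a b β k ω t) ≤ 1 / (2 * β) + 9 * β * T / 2 := by
    have : 1 / (2 * β) + 9 * β * T / 2 = (1 + 9 * β ^ 2 * T) / (2 * β) := by field_simp
    rw [this, le_div_iff₀ (by positivity)]
    linarith
  -- An identity in every round: the two errors are defined as precisely what has to be added to the
  -- two regrets to produce the true slack of `i`.
  have h5 : ∑ t ∈ Finset.range T, (-slack a b β k ω t i - roundPenalty a b β k ω t) =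
      -∑ t ∈ Finset.range T, (slack a b β k ω t (constrIdx a b β k ω t) +
        roundPenalty a b β k ω t) +
      ∑ t ∈ Finset.range T, (wmean (iterRun a b β k ω t).w (slackEst a b β k ω t) -
      β * wmean (iterRun a b β k ω t).w (fun i => slackEst a b β k ω t i ^ 2) -
      slackEst a b β k ω t i) +
      ∑ t ∈ Finset.range T, (constrDev a b β k ω t + slackDev a b β k ω t i) := by
    rw [← Finset.sum_neg_distrib, ← Finset.sum_add_distrib, ← Finset.sum_add_distrib]
    refine Finset.sum_congr rfl fun t _ => ?_
    rw [slackDev_eq, constrDev]; ring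
  rw [h5]
  linarith

end Run

end

noncomputable section

/-! ## Measurability of the iteration -/

open Matrix RealRAM

/-- Lets a sampled index be substituted into quantities that are measurable for each fixed index. -/
theorem measurable_comp_index {Ω ι γ : Type*} [MeasurableSpace Ω] [MeasurableSpace ι]
    [Countable ι] [MeasurableSingletonClass ι] [MeasurableSpace γ] {f : ι → Ω → γ} {J : Ω → ι}
    (hf : ∀ x, Measurable (f x)) (hJ : Measurable J) : Measurable fun ω => f (J ω) ω :=
  (measurable_from_prod_countable_left (f := fun x : Ω × ι => f x.2 x.1) hf).comp
    (measurable_id.prodMk hJ)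

section Measurability

variable {n N : ℕ} {Ω : Type*} [MeasurableSpace Ω]

theorem measurable_matDot {A X : Ω → Matrix (Fin n) (Fin n) ℝ}
    (hA : ∀ j l, Measurable fun ω => A ω j l) (hX : ∀ j l, Measurable fun ω => X ω j l) :
    Measurable fun ω => matDot (A ω) (X ω) :=
  Finset.measurable_sum _ fun j _ => Finset.measurable_sum _ fun l _ => (hA j l).mul (hX j l)

theorem measurable_rowSq {X : Ω → Matrix (Fin n) (Fin n) ℝ}
    (hX : ∀ j l, Measurable fun ω => X ω j l) (j : Fin n) : Measurable fun ω => rowSq (X ω) j :=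
  Finset.measurable_sum _ fun l _ => (hX j l).pow_const 2

theorem measurable_entryEst (a : Matrix (Fin n) (Fin n) ℝ) (β : ℝ)
    {X : Ω → Matrix (Fin n) (Fin n) ℝ} (hX : ∀ j l, Measurable fun ω => X ω j l) (J L : Fin n) :
    Measurable fun ω => entryEst a (X ω) β J L := by
  refine measurable_const.max (measurable_const.min ?_)
  exact ((Finset.measurable_sum _ fun j _ => measurable_rowSq hX j).mul_const _).div (hX J L)

theorem measurable_wmean {w f : Ω → Fin N → ℝ} (hw : ∀ i, Measurable fun ω => w ω i)
    (hf : ∀ i, Measurable fun ω => f ω i) : Measurable fun ω => wmean (w ω) (f ω) :=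
  (Finset.measurable_sum _ fun i _ => (hw i).mul (hf i)).div
    (Finset.measurable_sum _ fun i _ => hw i)

theorem measurable_estDev (a : Fin N → Matrix (Fin n) (Fin n) ℝ) (b : Fin N → ℝ) (β : ℝ)
    {w : Ω → Fin N → ℝ} {X : Ω → Matrix (Fin n) (Fin n) ℝ} (hw : ∀ i, Measurable fun ω => w ω i)
    (hX : ∀ j l, Measurable fun ω => X ω j l) (i : Fin N) (J L : Fin n) :
    Measurable fun ω => estDev a b (w ω) (X ω) β i J L := by
  have he := fun i => measurable_entryEst (a i) β hX J L
  have hd : ∀ i, Measurable fun ω => matDot (a i) (X ω) := fun i =>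
    measurable_matDot (fun _ _ => measurable_const) hX
  exact (((he i).sub (hd i)).sub (measurable_wmean hw fun i => (he i).sub (hd i))).add
    ((measurable_wmean hw fun i => ((he i).sub_const _).pow_const 2).const_mul β)

theorem measurable_chebVecPair {X : Ω → Matrix (Fin n) (Fin n) ℝ} {g : Ω → Fin n → ℝ}
    (hX : ∀ j l, Measurable fun ω => X ω j l) (hg : ∀ j, Measurable fun ω => g ω j) (k : ℕ) :
    (∀ j, Measurable fun ω => (chebVecPair (X ω) (g ω) k).1 j) ∧
      ∀ j, Measurable fun ω => (chebVecPair (X ω) (g ω) k).2 j := by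
  induction k with
  | zero => exact ⟨hg, fun j => (hg j).neg⟩
  | succ k ih =>
    exact ⟨fun j => (((ih.1 j).const_mul 2).sub ((Finset.measurable_sum _ fun l _ =>
      (hX j l).mul (ih.1 l)).const_mul 4)).sub (ih.2 j), ih.1⟩

theorem measurable_quadForm {X : Ω → Matrix (Fin n) (Fin n) ℝ} {v : Ω → Fin n → ℝ}
    (hX : ∀ j l, Measurable fun ω => X ω j l) (hv : ∀ j, Measurable fun ω => v ω j) :
    Measurable fun ω => v ω ⬝ᵥ (X ω *ᵥ v ω) := by
  simp only [mulVec, dotProduct]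
  exact Finset.measurable_sum _ fun j _ => (hv j).mul
    (Finset.measurable_sum _ fun l _ => (hX j l).mul (hv l))

theorem measurable_penalty {X : Ω → Matrix (Fin n) (Fin n) ℝ} {v : Ω → Fin n → ℝ}
    (hX : ∀ j l, Measurable fun ω => X ω j l) (hv : ∀ j, Measurable fun ω => v ω j) :
    Measurable fun ω => penalty (X ω) (v ω) := by
  classical
  refine Measurable.ite (measurableSet_lt (measurable_quadForm hX hv) measurable_const) ?_
    measurable_const
  exact measurable_const.div (Finset.measurable_sum _ fun j _ => (hv j).mul (hv j))

theorem measurable_eigErr {X : Ω → Matrix (Fin n) (Fin n) ℝ} {v : Ω → Fin n → ℝ}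
    (hX : ∀ j l, Measurable fun ω => X ω j l) (hv : ∀ j, Measurable fun ω => v ω j) :
    Measurable fun ω => eigErr (X ω) (v ω) := by
  refine measurable_const.max (Measurable.add ?_
    ((measurable_penalty hX hv).mul (measurable_quadForm hX hv)))
  have h : Measurable fun ω => (fun j l => X ω j l : Fin n → Fin n → ℝ) :=
    measurable_pi_lambda _ fun j => measurable_pi_lambda _ fun l => hX j l
  exact continuous_maxNegEig.measurable.comp h

theorem measurable_ballProj {Y : Ω → Matrix (Fin n) (Fin n) ℝ}
    (hY : ∀ j l, Measurable fun ω => Y ω j l) (j l : Fin n) :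
    Measurable fun ω => ballProj (Y ω) j l := by
  classical
  refine (hY j l).div ?_
  have h := measurable_matDot hY hY
  exact Measurable.ite (measurableSet_lt measurable_const h) h.sqrt measurable_const

theorem measurable_startVec (p : ℕ) (j : Fin n) : Measurable fun ω => startVec n p ω j := by
  unfold startVec; fun_prop

end Measurability

variable {n N : ℕ} [NeZero n] [NeZero N]

section Run

variable (a : Fin N → Matrix (Fin n) (Fin n) ℝ) (b : Fin N → ℝ) (β : ℝ) (k : ℕ)

theorem measurable_rowIdx {X : (ℕ → unitInterval) → Matrix (Fin n) (Fin n) ℝ}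
    (hX : ∀ j l, Measurable fun ω => X ω j l) (p : ℕ) : Measurable fun ω => rowIdx (X ω) ω p :=
  measurable_pick (fun j => measurable_rowSq hX j) (by fun_prop)

theorem measurable_colIdx {X : (ℕ → unitInterval) → Matrix (Fin n) (Fin n) ℝ}
    (hX : ∀ j l, Measurable fun ω => X ω j l) (p : ℕ) : Measurable fun ω => colIdx (X ω) ω p :=
  measurable_comp_index (f := fun j ω => pick (fun l => X ω j l ^ 2) (ω (p + 1)))
    (fun j => measurable_pick (fun l => (hX j l).pow_const 2) (by fun_prop))
    (measurable_rowIdx hX p)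

theorem measurable_iterRun (t : ℕ) :
    (∀ i, Measurable fun ω => (iterRun a b β k ω t).w i) ∧
      ∀ j l, Measurable fun ω => (iterRun a b β k ω t).X j l := by
  induction t with
  | zero => exact ⟨fun i => measurable_const, fun j l => measurable_const⟩
  | succ t ih =>
    obtain ⟨hw, hX⟩ := ih
    refine ⟨fun i => ?_, fun j l => ?_⟩
    · have hy : Measurable fun ω => entryEst (a i) (iterRun a b β k ω t).X β
          (rowIdx (iterRun a b β k ω t).X ω ((n + 3) * t + 1))
          (colIdx (iterRun a b β k ω t).X ω ((n + 3) * t + 1)) - b i :=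
        (measurable_comp_index (f := fun (x : Fin n × Fin n) ω =>
          entryEst (a i) (iterRun a b β k ω t).X β x.1 x.2)
          (fun x => measurable_entryEst (a i) β hX x.1 x.2)
          ((measurable_rowIdx hX _).prodMk (measurable_colIdx hX _))).sub_const _
      exact (hw i).mul (((hy.const_mul β).const_sub 1).add ((hy.const_mul β).mul (hy.const_mul β)))
    · have hI : Measurable fun ω => pick (iterRun a b β k ω t).w (ω ((n + 3) * t)) :=
        measurable_pick hw (by fun_prop)
      have hv : ∀ j, Measurable fun ω =>
          chebVec (iterRun a b β k ω t).X (startVec n ((n + 3) * t + 3) ω) k j :=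
        (measurable_chebVecPair hX (measurable_startVec _) k).1
      refine measurable_ballProj (fun j l => ?_) j l
      refine (hX j l).add (Measurable.const_mul ?_ β)
      refine Measurable.add ?_ ((measurable_penalty hX hv).mul ((hv j).mul (hv l)))
      exact (measurable_from_top (f := fun i => (a i j l + a i l j) / 2)).comp hI

/-- The state after `t` rounds depends only on the random numbers drawn so far. -/
theorem iterRun_congr {ω ω' : ℕ → unitInterval} (t : ℕ)
    (h : ∀ i < (n + 3) * t, ω i = ω' i) : iterRun a b β k ω t = iterRun a b β k ω' t := by
  induction t with
  | zero => rfl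
  | succ t ih =>
    have h' : ∀ i < n + 3, ω ((n + 3) * t + i) = ω' ((n + 3) * t + i) := fun i hi =>
      h _ (by rw [mul_add, mul_one]; omega)
    have e := ih fun i hi => h i (by rw [mul_add, mul_one]; omega)
    have hg : startVec n ((n + 3) * t + 3) ω = startVec n ((n + 3) * t + 3) ω' := by
      ext j
      rw [startVec, startVec, add_assoc, h' _ (by have := j.2; omega)]
    have h0 : ω ((n + 3) * t) = ω' ((n + 3) * t) := h' 0 (by omega)
    have h1 : ω ((n + 3) * t + 1) = ω' ((n + 3) * t + 1) := h' 1 (by omega)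
    have h2 : ω ((n + 3) * t + 1 + 1) = ω' ((n + 3) * t + 1 + 1) := h' 2 (by omega)
    simp only [iterRun, e, iterStep, rowIdx, colIdx, hg, h0, h1, h2]

/-! ## The probability of success -/

/-- The exponential of the total error for the constraint `i` after `T` rounds. -/
def expErr (i : Fin N) (T : ℕ) (ω : ℕ → unitInterval) : ENNReal :=
  ∏ t ∈ Finset.range T, (ENNReal.ofReal (Real.exp (β * constrDev a b β k ω t)) *
    ENNReal.ofReal (Real.exp (β * slackDev a b β k ω t i)) *
    ENNReal.ofReal (Real.exp (β * roundEigErr a b β k ω t)))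

theorem expErr_eq (i : Fin N) (T : ℕ) (ω : ℕ → unitInterval) :
    expErr a b β k i T ω = ENNReal.ofReal (Real.exp (β * ∑ t ∈ Finset.range T,
      (constrDev a b β k ω t + slackDev a b β k ω t i + roundEigErr a b β k ω t))) := by
  rw [expErr, Finset.mul_sum, Real.exp_sum, ENNReal.ofReal_prod_of_nonneg
    fun _ _ => (Real.exp_pos _).le]
  refine Finset.prod_congr rfl fun t _ => ?_
  rw [← ENNReal.ofReal_mul (Real.exp_pos _).le, ← ENNReal.ofReal_mul (by positivity),
    ← Real.exp_add, ← Real.exp_add]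
  congr 2; ring

theorem measurable_constrDev (t : ℕ) : Measurable fun ω => constrDev a b β k ω t := by
  obtain ⟨hw, hX⟩ := measurable_iterRun a b β k t
  have hd : ∀ i, Measurable fun ω => matDot (a i) (iterRun a b β k ω t).X := fun i =>
    measurable_matDot (A := fun _ => a i) (fun _ _ => measurable_const) hX
  have hs : ∀ i, Measurable fun ω => slack a b β k ω t i := fun i => (hd i).sub_const (b i)
  have hI : Measurable fun ω => constrIdx a b β k ω t := measurable_pick hw (by fun_prop)
  have h1 : Measurable fun ω => slack a b β k ω t (constrIdx a b β k ω t) :=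
    measurable_comp_index (f := fun i ω => slack a b β k ω t i) hs hI
  exact h1.sub (measurable_wmean hw hs)

theorem measurable_slackDev (t : ℕ) (i : Fin N) :
    Measurable fun ω => slackDev a b β k ω t i := by
  obtain ⟨hw, hX⟩ := measurable_iterRun a b β k t
  have h1 : ∀ x : Fin n × Fin n, Measurable fun ω =>
      estDev a b (iterRun a b β k ω t).w (iterRun a b β k ω t).X β i x.1 x.2 :=
    fun x => measurable_estDev (w := fun ω => (iterRun a b β k ω t).w)
      (X := fun ω => (iterRun a b β k ω t).X) a b β hw hX i x.1 x.2
  have h2 : Measurable fun ω => (rowIdx (iterRun a b β k ω t).X ω ((n + 3) * t + 1),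
      colIdx (iterRun a b β k ω t).X ω ((n + 3) * t + 1)) :=
    (measurable_rowIdx (X := fun ω => (iterRun a b β k ω t).X) hX _).prodMk
      (measurable_colIdx (X := fun ω => (iterRun a b β k ω t).X) hX _)
  unfold slackDev
  exact measurable_comp_index (f := fun (x : Fin n × Fin n) ω =>
    estDev a b (iterRun a b β k ω t).w (iterRun a b β k ω t).X β i x.1 x.2)
    (J := fun ω => (rowIdx (iterRun a b β k ω t).X ω ((n + 3) * t + 1),
      colIdx (iterRun a b β k ω t).X ω ((n + 3) * t + 1))) h1 h2

theorem measurable_roundEigErr (t : ℕ) : Measurable fun ω => roundEigErr a b β k ω t := by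
  obtain ⟨hw, hX⟩ := measurable_iterRun a b β k t
  exact measurable_eigErr hX (measurable_chebVecPair hX (measurable_startVec _) k).1

theorem measurable_expErr (i : Fin N) (T : ℕ) : Measurable (expErr a b β k i T) :=
  Finset.measurable_prod _ fun t _ =>
    ((((measurable_constrDev a b β k t).const_mul β).exp.ennreal_ofReal).mul
      (((measurable_slackDev a b β k t i).const_mul β).exp.ennreal_ofReal)).mul
      (((measurable_roundEigErr a b β k t).const_mul β).exp.ennreal_ofReal)

theorem expErr_congr (i : Fin N) {ω ω' : ℕ → unitInterval} (T : ℕ)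
    (h : ∀ i < (n + 3) * T, ω i = ω' i) : expErr a b β k i T ω = expErr a b β k i T ω' := by
  refine Finset.prod_congr rfl fun t ht => ?_
  have hle : (n + 3) * (t + 1) ≤ (n + 3) * T :=
    Nat.mul_le_mul_left _ (Finset.mem_range.1 ht)
  rw [mul_add, mul_one] at hle
  have h' : ∀ i < n + 3, ω ((n + 3) * t + i) = ω' ((n + 3) * t + i) := fun i hi =>
    h _ (by omega)
  have e := iterRun_congr a b β k t fun i hi => h i (by omega)
  have hg : startVec n ((n + 3) * t + 3) ω = startVec n ((n + 3) * t + 3) ω' := by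
    ext j
    rw [startVec, startVec, add_assoc, h' _ (by have := j.2; omega)]
  have h0 : ω ((n + 3) * t) = ω' ((n + 3) * t) := h' 0 (by omega)
  have h1 : ω ((n + 3) * t + 1) = ω' ((n + 3) * t + 1) := h' 1 (by omega)
  have h2 : ω ((n + 3) * t + 1 + 1) = ω' ((n + 3) * t + 1 + 1) := h' 2 (by omega)
  have es : slack a b β k ω t = slack a b β k ω' t := by ext; simp only [slack, e]
  simp only [constrDev, es, constrIdx, slackDev, rowIdx, colIdx, roundEigErr, roundVec, e, hg, h0,
    h1, h2]

variable {a b β k}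

/-- The factors of a round are removed in reverse order of their random numbers. Each is bounded
conditionally on all earlier draws: first the eigenvector error, then the estimate of the slacks,
then the choice of the constraint. The exponents add up to `16 β² + 40 β² + β ε / 8`. -/
theorem lintegral_expErr_le (ha : ∀ i, matDot (a i) (a i) ≤ 1) (hb : ∀ i, |b i| ≤ 1)
    (hβ : 0 < β) (hβ1 : β ≤ 1 / 8) {ε : ℝ} (hε : 0 < ε) {Ln : ℕ} (hn : n ≤ 2 ^ Ln)
    (hk : 100 * Ln / √ε ≤ k) (i : Fin N) (T : ℕ) :
    ∫⁻ ω, expErr a b β k i T ω ∂uniformTape ≤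
      ENNReal.ofReal (Real.exp (56 * β ^ 2 + β * ε / 8)) ^ T := by
  induction T with
  | zero => simp [expErr]
  | succ t ih =>
    set fA : (ℕ → unitInterval) → ENNReal := fun ω =>
      ENNReal.ofReal (Real.exp (β * constrDev a b β k ω t)) with hfA
    set fB : (ℕ → unitInterval) → ENNReal := fun ω =>
      ENNReal.ofReal (Real.exp (β * slackDev a b β k ω t i)) with hfB
    set fC : (ℕ → unitInterval) → ENNReal := fun ω =>
      ENNReal.ofReal (Real.exp (β * roundEigErr a b β k ω t)) with hfC
    have mA : Measurable fA := ((measurable_constrDev a b β k t).const_mul β).exp.ennreal_ofReal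
    have mB : Measurable fB := ((measurable_slackDev a b β k t i).const_mul β).exp.ennreal_ofReal
    have mC : Measurable fC := ((measurable_roundEigErr a b β k t).const_mul β).exp.ennreal_ofReal
    have mH := measurable_expErr a b β k i t
    set H := expErr a b β k i t
    -- In this round position `q` selects the constraint, `q + 1` and `q + 2` the entry, and the `n`
    -- positions from `q + 3` on give the start vector.
    set q := (n + 3) * t with hq
    have hov : ∀ (r : ℕ) (ω ω' : ℕ → unitInterval) (x : ℕ), x < r →
        override (Set.Ici r) ω ω' x = ω x := fun r ω ω' x hx =>
      override_of_notMem (by simpa using hx) ω ω'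
    have hov' : ∀ (r : ℕ) (ω ω' : ℕ → unitInterval) (x : ℕ), r ≤ x →
        override (Set.Ici r) ω ω' x = ω' x := fun r ω ω' x hx =>
      override_of_mem (by simpa using hx) ω ω'
    have hrun : ∀ r, q ≤ r → ∀ ω ω', iterRun a b β k (override (Set.Ici r) ω ω') t =
        iterRun a b β k ω t := fun r hr ω ω' =>
      iterRun_congr a b β k t fun x hx => hov _ _ _ _ (by omega)
    have hHr : ∀ r, q ≤ r → ∀ ω ω', H (override (Set.Ici r) ω ω') = H ω := fun r hr ω ω' =>
      expErr_congr a b β k i t fun x hx => hov _ _ _ _ (by omega)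
    have hAr : ∀ r, q + 1 ≤ r → ∀ ω ω', fA (override (Set.Ici r) ω ω') = fA ω := by
      intro r hr ω ω'
      have e := hrun r (by omega) ω ω'
      have es : slack a b β k (override (Set.Ici r) ω ω') t = slack a b β k ω t := by
        ext; simp only [slack, e]
      simp only [hfA, constrDev, es, constrIdx, e, ← hq, hov r ω ω' q (by omega)]
    have hBr : ∀ r, q + 3 ≤ r → ∀ ω ω', fB (override (Set.Ici r) ω ω') = fB ω := by
      intro r hr ω ω'
      have e := hrun r (by omega) ω ω'
      simp only [hfB, slackDev, rowIdx, colIdx, e, ← hq, hov r ω ω' (q + 1) (by omega),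
        hov r ω ω' (q + 1 + 1) (by omega)]
    have hw := fun ω => iterRun_w_pos a b β k ω t
    have hX1 := fun ω => iterRun_matDot_le a b β k ω t
    have cC : ∀ ω, ∫⁻ ω', fC (override (Set.Ici (q + 3)) ω ω') ∂uniformTape ≤
        ENNReal.ofReal (Real.exp (β * ε / 8)) := by
      intro ω
      have hherm : (iterRun a b β k ω t).X.IsHermitian := by
        rw [IsHermitian, conjTranspose_eq_transpose_of_trivial, iterRun_transpose]
      refine le_trans (le_of_eq ?_) (lintegral_exp_eigErr_le (k := k) (p := q + 3) hherm (hX1 ω)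
        hε hn hk hβ.le (by linarith))
      refine lintegral_congr fun ω' => ?_
      have hg : startVec n (q + 3) (override (Set.Ici (q + 3)) ω ω') = startVec n (q + 3) ω' := by
        ext j; rw [startVec, startVec, hov' _ _ _ _ (by omega)]
      simp only [hfC, roundEigErr, roundVec, ← hq, hrun (q + 3) (by omega) ω ω', hg]
    have cB : ∀ ω, ∫⁻ ω', fB (override (Set.Ici (q + 1)) ω ω') ∂uniformTape ≤
        ENNReal.ofReal (Real.exp (40 * β ^ 2)) := by
      intro ω
      refine le_trans (le_of_eq ?_) (lintegral_exp_estimate_le (a := a) (b := b) ha hb (hw ω)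
        (hX1 ω) hβ hβ1 (p := q + 1) (q := q + 1 + 1) (by omega) i)
      refine lintegral_congr fun ω' => ?_
      simp only [hfB, slackDev, rowIdx, colIdx, ← hq, hrun (q + 1) (by omega) ω ω',
        hov' (q + 1) ω ω' (q + 1) (by omega), hov' (q + 1) ω ω' (q + 1 + 1) (by omega)]
    have cA : ∀ ω, ∫⁻ ω', fA (override (Set.Ici q) ω ω') ∂uniformTape ≤
        ENNReal.ofReal (Real.exp (16 * β ^ 2)) := by
      intro ω
      have hs : ∀ i, |slack a b β k ω t i| ≤ 2 := fun i => by
        have h1 := abs_matDot_le_one (ha i) (hX1 ω)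
        have h2 := abs_sub (matDot (a i) (iterRun a b β k ω t).X) (b i)
        rw [slack]; linarith [hb i]
      have e : ∀ ω', fA (override (Set.Ici q) ω ω') = ENNReal.ofReal (Real.exp (β *
          (slack a b β k ω t (pick (iterRun a b β k ω t).w (ω' q)) -
          wmean (iterRun a b β k ω t).w (slack a b β k ω t)))) := by
        intro ω'
        have e := hrun q le_rfl ω ω'
        have es : slack a b β k (override (Set.Ici q) ω ω') t = slack a b β k ω t := by
          ext; simp only [slack, e]
        simp only [hfA, constrDev, es, constrIdx, e, ← hq, hov' q ω ω' q le_rfl]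
      simp_rw [e]
      refine lintegral_le_of_resample q ?_ fun ω' => ?_
      · have hp : Measurable fun ω' : ℕ → unitInterval =>
            pick (iterRun a b β k ω t).w (ω' q : ℝ) :=
          measurable_pick (fun _ => measurable_const) (by fun_prop)
        exact (measurable_from_top (f := fun j => ENNReal.ofReal (Real.exp (β *
          (slack a b β k ω t j - wmean (iterRun a b β k ω t).w (slack a b β k ω t)))))).comp hp
      · simp only [Function.update_self]
        exact lintegral_exp_pick_le (hw ω) hs hβ.le hβ1
    have e : ∀ ω, expErr a b β k i (t + 1) ω = H ω * fA ω * fB ω * fC ω := fun ω => by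
      simp only [H, expErr, Finset.prod_range_succ, hfA, hfB, hfC, mul_assoc]
    simp_rw [e]
    calc ∫⁻ ω, H ω * fA ω * fB ω * fC ω ∂uniformTape
        ≤ ENNReal.ofReal (Real.exp (β * ε / 8)) * ∫⁻ ω, H ω * fA ω * fB ω ∂uniformTape :=
          lintegral_mul_le_of_override (Set.Ici (q + 3)) ((mH.mul mA).mul mB) mC
            (fun ω ω' => by
              simp only [hHr (q + 3) (by omega), hAr (q + 3) (by omega), hBr (q + 3) le_rfl]) cC
      _ ≤ ENNReal.ofReal (Real.exp (β * ε / 8)) * (ENNReal.ofReal (Real.exp (40 * β ^ 2)) *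
            ∫⁻ ω, H ω * fA ω ∂uniformTape) := by
          gcongr
          exact lintegral_mul_le_of_override (Set.Ici (q + 1)) (mH.mul mA) mB
            (fun ω ω' => by simp only [hHr (q + 1) (by omega), hAr (q + 1) le_rfl]) cB
      _ ≤ ENNReal.ofReal (Real.exp (β * ε / 8)) * (ENNReal.ofReal (Real.exp (40 * β ^ 2)) *
            (ENNReal.ofReal (Real.exp (16 * β ^ 2)) * ∫⁻ ω, H ω ∂uniformTape)) := by
          gcongr
          exact lintegral_mul_le_of_override (Set.Ici q) mH mA (hHr q le_rfl) cA
      _ = ENNReal.ofReal (Real.exp (56 * β ^ 2 + β * ε / 8)) * ∫⁻ ω, H ω ∂uniformTape := by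
          rw [← mul_assoc, ← mul_assoc, ← ENNReal.ofReal_mul (Real.exp_pos _).le,
            ← ENNReal.ofReal_mul (by positivity), ← Real.exp_add, ← Real.exp_add]
          congr 3; ring
      _ ≤ _ := by rw [pow_succ' (ENNReal.ofReal _)]; exact mul_le_mul' le_rfl ih

end Run

/-- The output of the iteration. -/
def iterOutput (a : Fin N → Matrix (Fin n) (Fin n) ℝ) (b : Fin N → ℝ) (β : ℝ) (k T : ℕ)
    (ω : ℕ → unitInterval) : Matrix (Fin n) (Fin n) ℝ :=
  Matrix.of fun j l => (iterRun a b β k ω T).sum j l / T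

/-- Penalties are nonpositive and eigenvector errors nonnegative, so dropping both leaves the
violation of a constraint. For the trivial constraint `i₀` the slack vanishes, and what remains
bounds the sum of `-xᵀXx / xᵀx` over the rounds. -/
theorem iterOutput_isApprox {a : Fin N → Matrix (Fin n) (Fin n) ℝ} {b : Fin N → ℝ} {β ε : ℝ}
    {k T : ℕ} (hT : 0 < T) {ω : ℕ → unitInterval} {i₀ : Fin N} (ha₀ : a i₀ = 0) (hb₀ : b i₀ = 0)
    (h : ∀ i, ∑ t ∈ Finset.range T, (-slack a b β k ω t i - roundPenalty a b β k ω t +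
      roundEigErr a b β k ω t) ≤ ε * T) :
    (∀ i, b i - ε ≤ matDot (a i) (iterOutput a b β k T ω)) ∧
      (iterOutput a b β k T ω + ε • (1 : Matrix (Fin n) (Fin n) ℝ)).PosSemidef := by
  have hT0 : (0 : ℝ) < T := by exact_mod_cast hT
  have eo : iterOutput a b β k T ω =
      (T : ℝ)⁻¹ • ∑ t ∈ Finset.range T, (iterRun a b β k ω t).X := by
    rw [← iterRun_sum]; ext j l; simp [iterOutput, div_eq_inv_mul]
  have hp : ∀ t, roundPenalty a b β k ω t ≤ 0 := fun t => penaltyVal_nonpos _ _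
  have he : ∀ t, 0 ≤ roundEigErr a b β k ω t := fun t => eigErr_nonneg _ _
  refine ⟨fun i => ?_, ?_⟩
  · have h1 : ∑ t ∈ Finset.range T, -slack a b β k ω t i ≤ ε * T :=
      (Finset.sum_le_sum fun t _ => by linarith [hp t, he t]).trans (h i)
    have h2 : ∑ t ∈ Finset.range T, -slack a b β k ω t i =
        T * b i - matDot (a i) (∑ t ∈ Finset.range T, (iterRun a b β k ω t).X) := by
      have : ∀ M : ℕ, matDot (a i) (∑ t ∈ Finset.range M, (iterRun a b β k ω t).X) =
          ∑ t ∈ Finset.range M, matDot (a i) (iterRun a b β k ω t).X := by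
        intro M
        induction M with
        | zero => simp [matDot]
        | succ M ih => rw [Finset.sum_range_succ, matDot_add_right, ih, Finset.sum_range_succ]
      rw [this]
      simp only [slack, neg_sub, Finset.sum_sub_distrib]
      simp
    rw [eo, matDot_smul_right, le_inv_mul_iff₀ hT0]
    linarith
  · refine PosSemidef.of_dotProduct_mulVec_nonneg ?_ fun x => ?_
    · have h1 : (∑ t ∈ Finset.range T, (iterRun a b β k ω t).X)ᵀ =
          ∑ t ∈ Finset.range T, (iterRun a b β k ω t).X := by
        rw [transpose_sum]
        exact Finset.sum_congr rfl fun t _ => iterRun_transpose _ _ _ _ _ _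
      rw [IsHermitian, conjTranspose_eq_transpose_of_trivial, eo, transpose_add, transpose_smul,
        h1, transpose_smul, transpose_one]
    · have hs : ∀ t, slack a b β k ω t i₀ = 0 := fun t => by
        simp [slack, ha₀, hb₀, matDot]
      have h0 := h i₀
      simp only [hs] at h0
      have hxx := dotProduct_self_nonneg' x
      have h3 : -(x ⬝ᵥ ((∑ t ∈ Finset.range T, (iterRun a b β k ω t).X) *ᵥ x)) ≤
          ε * T * (x ⬝ᵥ x) := by
        refine le_trans ?_ (mul_le_mul_of_nonneg_right h0 hxx)
        have : ∀ M : ℕ, -(x ⬝ᵥ ((∑ t ∈ Finset.range M, (iterRun a b β k ω t).X) *ᵥ x)) =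
            ∑ t ∈ Finset.range M, -(x ⬝ᵥ ((iterRun a b β k ω t).X *ᵥ x)) := by
          intro M
          induction M with
          | zero => simp
          | succ M ih =>
            rw [Finset.sum_range_succ, add_mulVec, dotProduct_add, neg_add, ih,
              Finset.sum_range_succ]
        rw [this, Finset.sum_mul]
        refine Finset.sum_le_sum fun t _ => ?_
        refine (neg_dotProduct_mulVec_le_eigErr (iterRun a b β k ω t).X
          (roundVec a b β k ω t) x).trans (le_of_eq ?_)
        rw [roundEigErr, roundPenalty]; ring
      rw [star_trivial, eo, add_mulVec, dotProduct_add, smul_mulVec, smul_mulVec,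
        dotProduct_smul, dotProduct_smul, one_mulVec, smul_eq_mul, smul_eq_mul]
      have h4 : (T : ℝ)⁻¹ * -(x ⬝ᵥ ((∑ t ∈ Finset.range T, (iterRun a b β k ω t).X) *ᵥ x)) ≤
          ε * (x ⬝ᵥ x) := by
        rw [inv_mul_le_iff₀ hT0]; linarith
      linarith

/-- The iteration succeeds with probability at least `1 / 2`. -/
theorem half_le_uniformTape_iterOutput {a : Fin N → Matrix (Fin n) (Fin n) ℝ} {b : Fin N → ℝ}
    (ha : ∀ i, matDot (a i) (a i) ≤ 1) (hb : ∀ i, |b i| ≤ 1) {i₀ : Fin N} (ha₀ : a i₀ = 0)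
    (hb₀ : b i₀ = 0) {U : Matrix (Fin n) (Fin n) ℝ} (hU : U.PosSemidef) (hU1 : matDot U U ≤ 1)
    (hfeas : ∀ i, b i ≤ matDot (a i) U) {ε : ℝ} (hε : 0 < ε) (hε1 : ε ≤ 1) {L Ln k T : ℕ}
    (hn : n ≤ 2 ^ Ln) (hk : 100 * Ln / √ε ≤ k) (hN : 2 * N ≤ 2 ^ L)
    (hT : 4000 * L / ε ^ 2 ≤ T) :
    1 / 2 ≤ uniformTape {ω | (∀ i, b i - ε ≤ matDot (a i) (iterOutput a b (ε / 800) k T ω)) ∧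
      (iterOutput a b (ε / 800) k T ω + ε • (1 : Matrix (Fin n) (Fin n) ℝ)).PosSemidef} := by
  set β := ε / 800 with hβdef
  have hβ : 0 < β := by positivity
  have hβ1 : β ≤ 1 / 8 := by rw [hβdef]; linarith
  have hN0 : 0 < N := Nat.pos_of_ne_zero (NeZero.ne N)
  have hNr : (1 : ℝ) ≤ N := by exact_mod_cast hN0
  have hL1 : 1 ≤ L := by
    rcases Nat.eq_zero_or_pos L with h | h
    · subst h; omega
    · exact h
  have hL1' : (1 : ℝ) ≤ L := by exact_mod_cast hL1
  have hT' : 4000 * (L : ℝ) ≤ T * ε ^ 2 := by rwa [div_le_iff₀ (by positivity)] at hT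
  have hT0 : (0 : ℝ) < T := by
    by_contra hc
    have h1 : (T : ℝ) ≤ 0 := not_lt.1 hc
    nlinarith [sq_nonneg ε]
  have hTn : 0 < T := by exact_mod_cast hT0
  have hlog : Real.log (2 * N) ≤ L := by
    have h1 : (2 * N : ℝ) ≤ Real.exp L := by
      calc (2 * N : ℝ) ≤ 2 ^ L := by exact_mod_cast hN
        _ ≤ Real.exp 1 ^ L := by
            gcongr
            linarith [Real.exp_one_gt_d9]
        _ = Real.exp L := by rw [← Real.exp_nat_mul, mul_one]
    rw [Real.log_le_iff_le_exp (by positivity)]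
    exact h1
  have hlogN : Real.log N ≤ L :=
    (Real.log_le_log (by positivity) (by linarith)).trans hlog
  -- Half of the allowance `εT` is reserved for the random errors; the deterministic terms of
  -- `violation_le` take less than a third of it.
  set θ := ENNReal.ofReal (Real.exp (β * (ε * T / 2))) with hθ
  set bad : Fin N → Set (ℕ → unitInterval) := fun i => {ω | θ ≤ expErr a b β k i T ω} with hbad
  have hbadle : ∀ i, uniformTape (bad i) ≤ ENNReal.ofReal (1 / (2 * N)) := by
    intro i
    have h1 := (mul_meas_ge_le_lintegral (μ := uniformTape) (measurable_expErr a b β k i T) θ).trans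
      (lintegral_expErr_le ha hb hβ hβ1 hε hn hk i T)
    rw [← ENNReal.ofReal_pow (Real.exp_pos _).le, ← Real.exp_nat_mul] at h1
    have hθ0 : θ ≠ 0 := by
      rw [hθ]; exact (ENNReal.ofReal_pos.2 (Real.exp_pos _)).ne'
    rw [mul_comm, ← ENNReal.le_div_iff_mul_le (Or.inl hθ0) (Or.inl ENNReal.ofReal_ne_top), hθ,
      ← ENNReal.ofReal_div_of_pos (Real.exp_pos _), ← Real.exp_sub] at h1
    refine h1.trans (ENNReal.ofReal_le_ofReal ?_)
    rw [one_div, ← Real.exp_log (by positivity : (0 : ℝ) < 2 * N), ← Real.exp_neg]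
    refine Real.exp_le_exp.2 ?_
    -- For `β = ε/800` the left side is about `-0.00038 T ε²`. The choice of `T` makes `T ε² / 4000`
    -- at least `L`, hence at least `log (2N)`, so each constraint fails with probability at most
    -- `1/(2N)`.
    have h2 : T * (56 * β ^ 2 + β * ε / 8) - β * (ε * T / 2) ≤ -(T * ε ^ 2 / 4000) := by
      rw [hβdef]
      nlinarith [mul_pos hT0 (sq_pos_of_pos hε)]
    linarith
  -- A covering and subadditivity are used in place of complements, so the success event need not be
  -- shown to be measurable.
  have hcover : Set.univ ⊆ {ω | (∀ i, b i - ε ≤ matDot (a i) (iterOutput a b β k T ω)) ∧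
      (iterOutput a b β k T ω + ε • (1 : Matrix (Fin n) (Fin n) ℝ)).PosSemidef} ∪
      ⋃ i, bad i := by
    intro ω _
    by_cases hω : ω ∈ ⋃ i, bad i
    · exact Or.inr hω
    left
    refine iterOutput_isApprox hTn ha₀ hb₀ fun i => ?_
    have h1 : expErr a b β k i T ω < θ := by
      by_contra hc
      exact hω (Set.mem_iUnion.2 ⟨i, not_lt.1 hc⟩)
    rw [expErr_eq, hθ, ENNReal.ofReal_lt_ofReal_iff (Real.exp_pos _), Real.exp_lt_exp] at h1
    have h2 := lt_of_mul_lt_mul_left h1 hβ.le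
    have h3 := violation_le (a := a) (b := b) k ω ha hb hβ hβ1 hU hU1 hfeas T i
    rw [Finset.sum_add_distrib] at h2 ⊢
    have h4 : 1 / (2 * β) ≤ ε * T / 10 := by
      rw [hβdef, div_le_iff₀ (by positivity)]
      nlinarith
    have h5 : Real.log N / β ≤ ε * T / 5 := by
      rw [hβdef, div_le_iff₀ (by positivity)]
      nlinarith
    have h6 : 9 * β * T / 2 ≤ ε * T / 100 := by
      rw [hβdef]; nlinarith [mul_pos hε hT0]
    nlinarith [mul_pos hε hT0]
  have hsum : uniformTape (⋃ i, bad i) ≤ 1 / 2 := by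
    calc uniformTape (⋃ i, bad i) ≤ ∑ i, uniformTape (bad i) := measure_iUnion_fintype_le _ _
      _ ≤ ∑ _i : Fin N, ENNReal.ofReal (1 / (2 * N)) := Finset.sum_le_sum fun i _ => hbadle i
      _ = ENNReal.ofReal (1 / 2) := by
          rw [Finset.sum_const, Finset.card_univ, Fintype.card_fin, nsmul_eq_mul,
            ← ENNReal.ofReal_natCast, ← ENNReal.ofReal_mul (by positivity)]
          congr 1; field_simp
      _ = 1 / 2 := by
          rw [ENNReal.ofReal_div_of_pos two_pos]; simp
  have h1 := (measure_mono hcover).trans (measure_union_le (μ := uniformTape) _ _)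
  rw [measure_univ] at h1
  have h2 : (1 : ENNReal) = 1 / 2 + 1 / 2 := by simp [ENNReal.inv_two_add_inv_two]
  have h3 : (1 : ENNReal) / 2 + 1 / 2 ≤ uniformTape {ω | (∀ i, b i - ε ≤
      matDot (a i) (iterOutput a b β k T ω)) ∧
      (iterOutput a b β k T ω + ε • (1 : Matrix (Fin n) (Fin n) ℝ)).PosSemidef} + 1 / 2 := by
    rw [← h2]; exact h1.trans (by gcongr)
  exact (ENNReal.add_le_add_iff_right (by simp)).1 h3

end

noncomputable section

/-! ## Reasoning about programs -/

namespace RealRAM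

section States

variable (s : State)

@[simp] theorem State.setNat_nat (x v y : ℕ) :
    (s.setNat x v).nat y = if y = x then v else s.nat y := by
  simp [State.setNat, Function.update_apply]
@[simp] theorem State.setNat_real (x v y : ℕ) : (s.setNat x v).real y = s.real y := rfl
@[simp] theorem State.setNat_arr (x v k i j : ℕ) : (s.setNat x v).arr k i j = s.arr k i j := rfl
@[simp] theorem State.setNat_pos (x v : ℕ) : (s.setNat x v).pos = s.pos := rfl
@[simp] theorem State.setReal_nat (x : ℕ) (v : ℝ) (y : ℕ) : (s.setReal x v).nat y = s.nat y := rfl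
@[simp] theorem State.setReal_real (x : ℕ) (v : ℝ) (y : ℕ) :
    (s.setReal x v).real y = if y = x then v else s.real y := by
  simp [State.setReal, Function.update_apply]
@[simp] theorem State.setReal_arr (x : ℕ) (v : ℝ) (k i j : ℕ) :
    (s.setReal x v).arr k i j = s.arr k i j := rfl
@[simp] theorem State.setReal_pos (x : ℕ) (v : ℝ) : (s.setReal x v).pos = s.pos := rfl
@[simp] theorem State.store_nat (k i j : ℕ) (v : ℝ) (y : ℕ) :
    (s.store k i j v).nat y = s.nat y := rfl
@[simp] theorem State.store_real (k i j : ℕ) (v : ℝ) (y : ℕ) :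
    (s.store k i j v).real y = s.real y := rfl
@[simp] theorem State.store_arr (k i j : ℕ) (v : ℝ) (k' i' j' : ℕ) :
    (s.store k i j v).arr k' i' j' =
      if k' = k ∧ i' = i ∧ j' = j then v else s.arr k' i' j' := rfl
@[simp] theorem State.store_pos (k i j : ℕ) (v : ℝ) : (s.store k i j v).pos = s.pos := rfl
@[simp] theorem State.draw_nat (ω : ℕ → unitInterval) (x y : ℕ) :
    (s.draw ω x).nat y = s.nat y := rfl
@[simp] theorem State.draw_real (ω : ℕ → unitInterval) (x y : ℕ) :
    (s.draw ω x).real y = if y = x then (ω s.pos : ℝ) else s.real y := by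
  simp [State.draw, Function.update_apply]
@[simp] theorem State.draw_arr (ω : ℕ → unitInterval) (x k i j : ℕ) :
    (s.draw ω x).arr k i j = s.arr k i j := rfl
@[simp] theorem State.draw_pos (ω : ℕ → unitInterval) (x : ℕ) :
    (s.draw ω x).pos = s.pos + 1 := rfl

end States

/-- `s'` differs from `s` only in the integer registers `ns`, the real registers `rs` and the
arrays `as`, and `d` random numbers were drawn in between. -/
structure Frame (ns rs as : List ℕ) (d : ℕ) (s s' : State) : Prop where
  nat : ∀ x, x ∉ ns → s'.nat x = s.nat x
  real : ∀ x, x ∉ rs → s'.real x = s.real x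
  arr : ∀ k, k ∉ as → ∀ i j, s'.arr k i j = s.arr k i j
  pos : s'.pos = s.pos + d

section Frames

variable {ns rs as ns' rs' as' : List ℕ} {d d' : ℕ} {s s' s'' : State}

theorem Frame.refl : Frame ns rs as 0 s s := ⟨fun _ _ => rfl, fun _ _ => rfl, fun _ _ _ _ => rfl, rfl⟩

theorem Frame.trans (h : Frame ns rs as d s s') (h' : Frame ns rs as d' s' s'') :
    Frame ns rs as (d + d') s s'' :=
  ⟨fun x hx => (h'.nat x hx).trans (h.nat x hx), fun x hx => (h'.real x hx).trans (h.real x hx),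
    fun k hk i j => (h'.arr k hk i j).trans (h.arr k hk i j), by
      rw [h'.pos, h.pos, add_assoc]⟩

theorem Frame.mono (h : Frame ns rs as d s s') (hn : ns ⊆ ns') (hr : rs ⊆ rs') (ha : as ⊆ as') :
    Frame ns' rs' as' d s s' :=
  ⟨fun x hx => h.nat x fun h' => hx (hn h'), fun x hx => h.real x fun h' => hx (hr h'),
    fun x hx => h.arr x fun h' => hx (ha h'), h.pos⟩

theorem Frame.setNat (h : Frame ns rs as d s s') {x : ℕ} (hx : x ∈ ns) (v : ℕ) :
    Frame ns rs as d s (s'.setNat x v) := by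
  refine ⟨fun y hy => ?_, h.real, h.arr, h.pos⟩
  rw [State.setNat_nat, if_neg (fun e : y = x => hy (e ▸ hx)), h.nat y hy]

theorem Frame.setReal (h : Frame ns rs as d s s') {x : ℕ} (hx : x ∈ rs) (v : ℝ) :
    Frame ns rs as d s (s'.setReal x v) := by
  refine ⟨h.nat, fun y hy => ?_, h.arr, h.pos⟩
  rw [State.setReal_real, if_neg (fun e : y = x => hy (e ▸ hx)), h.real y hy]

theorem Frame.store (h : Frame ns rs as d s s') {k : ℕ} (hk : k ∈ as) (i j : ℕ) (v : ℝ) :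
    Frame ns rs as d s (s'.store k i j v) := by
  refine ⟨h.nat, h.real, fun k' hk' i' j' => ?_, h.pos⟩
  rw [State.store_arr, if_neg (fun e : k' = k ∧ _ => hk' (e.1 ▸ hk)), h.arr k' hk']

theorem Frame.draw (h : Frame ns rs as d s s') {x : ℕ} (hx : x ∈ rs) (ω : ℕ → unitInterval) :
    Frame ns rs as (d + 1) s (s'.draw ω x) := by
  refine ⟨h.nat, fun y hy => ?_, h.arr, ?_⟩
  · rw [State.draw_real, if_neg (fun e : y = x => hy (e ▸ hx)), h.real y hy]
  · rw [State.draw_pos, h.pos, add_assoc]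

end Frames

variable {m n : ℕ} {S : SDP m n} {ε : ℝ} {ω : ℕ → unitInterval}

/-- Started in `s`, the program `c` halts within `B` steps in a state that satisfies `Q`. -/
def Runs (S : SDP m n) (ε : ℝ) (ω : ℕ → unitInterval) (c : Cmd) (s : State) (B : ℕ)
    (Q : State → Prop) : Prop := ∃ t s', Exec S ε ω c s t s' ∧ t ≤ B ∧ Q s'

variable {c d : Cmd} {s : State} {B B' : ℕ} {Q Q' : State → Prop}

theorem Runs.mono (h : Runs S ε ω c s B Q) (hB : B ≤ B') : Runs S ε ω c s B' Q := by
  obtain ⟨t, s', h1, h2, h3⟩ := h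
  exact ⟨t, s', h1, h2.trans hB, h3⟩

theorem Runs.imp (h : Runs S ε ω c s B Q) (hQ : ∀ s', Q s' → Q' s') : Runs S ε ω c s B Q' := by
  obtain ⟨t, s', h1, h2, h3⟩ := h
  exact ⟨t, s', h1, h2, hQ s' h3⟩

theorem Runs.seq (h : Runs S ε ω c s B Q') (h' : ∀ s', Q' s' → Runs S ε ω d s' B' Q) :
    Runs S ε ω (c.seq d) s (B + B') Q := by
  obtain ⟨t, s', h1, h2, h3⟩ := h
  obtain ⟨t', s'', h1', h2', h3'⟩ := h' s' h3
  exact ⟨t + t', s'', .seq h1 h1', by omega, h3'⟩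

theorem Runs.skip (h : Q s) : Runs S ε ω .skip s 1 Q := ⟨_, _, .skip s, le_rfl, h⟩

theorem Runs.setNat {x : ℕ} {e : NatExpr} (h : Q (s.setNat x (e.eval m n s))) :
    Runs S ε ω (.setNat x e) s (1 + e.cost) Q := ⟨_, _, .setNat s x e, le_rfl, h⟩

theorem Runs.setReal {x : ℕ} {e : RealExpr} (h : Q (s.setReal x (e.eval S ε s))) :
    Runs S ε ω (.setReal x e) s (1 + e.cost) Q := ⟨_, _, .setReal s x e, le_rfl, h⟩

theorem Runs.store {k : ℕ} {i j : NatExpr} {e : RealExpr}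
    (h : Q (s.store k (i.eval m n s) (j.eval m n s) (e.eval S ε s))) :
    Runs S ε ω (.store k i j e) s (1 + i.cost + j.cost + e.cost) Q :=
  ⟨_, _, .store s k i j e, le_rfl, h⟩

theorem Runs.sample {x : ℕ} (h : Q (s.draw ω x)) : Runs S ε ω (.sample x) s 1 Q :=
  ⟨_, _, .sample s x, le_rfl, h⟩

theorem Runs.ite {t : Test} (h : t.Holds S ε s → Runs S ε ω c s B Q)
    (h' : ¬ t.Holds S ε s → Runs S ε ω d s B' Q) :
    Runs S ε ω (.ite t c d) s (1 + t.cost + (B + B')) Q := by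
  by_cases ht : t.Holds S ε s
  · obtain ⟨k, s', h1, h2, h3⟩ := h ht
    exact ⟨_, s', .iteTrue ht h1, by omega, h3⟩
  · obtain ⟨k, s', h1, h2, h3⟩ := h' ht
    exact ⟨_, s', .iteFalse ht h1, by omega, h3⟩

/-- A loop whose number of rounds is known. -/
theorem Runs.loop {t : Test} {N : ℕ} (I : ℕ → State → Prop) (h0 : I 0 s)
    (hbody : ∀ k < N, ∀ s', I k s' → t.Holds S ε s' ∧ Runs S ε ω c s' B (I (k + 1)))
    (hend : ∀ s', I N s' → ¬ t.Holds S ε s') :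
    Runs S ε ω (.loop t c) s ((N + 1) * (B + 1 + t.cost)) (I N) := by
  suffices H : ∀ k ≤ N, ∀ s', I (N - k) s' →
      Runs S ε ω (.loop t c) s' ((k + 1) * (B + 1 + t.cost)) (I N) from
    H N le_rfl s (by rwa [Nat.sub_self])
  intro k
  induction k with
  | zero =>
    intro _ s' h
    exact ⟨_, s', .loopFalse (hend s' h), by omega, h⟩
  | succ k ih =>
    intro hk s' h
    obtain ⟨ht, k', s'', h1, h2, h3⟩ := hbody (N - (k + 1)) (by omega) s' h
    rw [show N - (k + 1) + 1 = N - k by omega] at h3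
    obtain ⟨k'', s3, h1', h2', h3'⟩ := ih (by omega) s'' h3
    refine ⟨_, s3, .loopTrue ht h1 h1', ?_, h3'⟩
    calc 1 + t.cost + k' + k'' ≤ 1 + t.cost + B + (k + 1) * (B + 1 + t.cost) := by omega
      _ = _ := by ring

/-- The loop in which the register `x` runs from `0` to `e - 1`. -/
def forLoop (x : ℕ) (e : NatExpr) (c : Cmd) : Cmd :=
  .seq (.setNat x (.const 0)) (.loop (.natLt (.var x) e)
    (.seq c (.setNat x (.add (.var x) (.const 1)))))

/-- The invariant must survive any assignment to the loop register, because the counter is reset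
before the loop and incremented after the body. The body in turn must leave the register at its
value. -/
theorem Runs.forLoop {x N : ℕ} {e : NatExpr} (he : ∀ s', e.eval m n s' = N)
    (I : ℕ → State → Prop) (h0 : I 0 s) (hI : ∀ k s' v, I k s' → I k (s'.setNat x v))
    (hbody : ∀ k < N, ∀ s', s'.nat x = k → I k s' →
      Runs S ε ω c s' B (fun s'' => s''.nat x = k ∧ I (k + 1) s'')) :
    Runs S ε ω (forLoop x e c) s ((N + 1) * (B + e.cost + 10)) (I N) := by
  have h1 := Runs.seq (S := S) (ε := ε) (ω := ω) (s := s) (c := .setNat x (.const 0))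
    (Q' := fun s' => s'.nat x = 0 ∧ I 0 s')
    (Runs.setNat (by simpa [NatExpr.eval] using hI 0 s 0 h0)) (fun s' h =>
      Runs.loop (N := N) (t := .natLt (.var x) e)
        (c := .seq c (.setNat x (.add (.var x) (.const 1)))) (B := B + 4)
        (fun k s' => s'.nat x = k ∧ I k s') h
        (fun k hk s' hs => ⟨by simpa [Test.Holds, NatExpr.eval, he, hs.1] using hk,
          (hbody k hk s' hs.1 hs.2).seq fun s'' h'' => Runs.setNat (by
            refine ⟨by simp [NatExpr.eval, h''.1], hI _ _ _ h''.2⟩)⟩)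
        (fun s' hs => by simp [Test.Holds, NatExpr.eval, he, hs.1]))
  refine (h1.mono ?_).imp fun s' h => h.2
  simp only [NatExpr.cost, Test.cost]
  nlinarith

/-- The program that accumulates the values of `f` in the register `r`. -/
def accLoop (x : ℕ) (e : NatExpr) (r : ℕ) (f : RealExpr) : Cmd :=
  RealRAM.forLoop x e (.setReal r (.add (.var r) f))

theorem Runs.accLoop {x N r : ℕ} {e : NatExpr} {f : RealExpr} (he : ∀ s', e.eval m n s' = N)
    (g : Fin N → ℝ) (hf : ∀ k : Fin N, ∀ s', s'.nat x = k.1 → Frame [x] [r] [] 0 s s' →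
      f.eval S ε s' = g k) :
    Runs S ε ω (accLoop x e r f) s ((N + 1) * (f.cost + e.cost + 13))
      (fun s' => Frame [x] [r] [] 0 s s' ∧ s'.real r = s.real r + ∑ k, g k) := by
  refine ((Runs.forLoop (B := f.cost + 3) he (fun k s' => Frame [x] [r] [] 0 s s' ∧
    s'.real r = s.real r + prefixSum g k) ⟨Frame.refl, by simp⟩
    (fun k s' v h => ⟨h.1.setNat (by simp) v, h.2⟩) fun k hk s' hs h => ?_).mono (by
    nlinarith)).imp fun s' h => ⟨h.1, by rw [h.2, prefixSum_self]⟩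
  refine (Runs.setReal ?_).mono (by simp only [RealExpr.cost]; omega)
  refine ⟨by simpa using hs, h.1.setReal (by simp) _, ?_⟩
  simp [RealExpr.eval, hf ⟨k, hk⟩ s' hs h.1, h.2, prefixSum_succ g hk, add_assoc]

/-! ## Sampling an index -/

/-- The program for `pick`: the loop register is `x`, the random number is in the real register
`2`, the weights are the values of `f`, and the result is left in the integer register `y`. The
total weight is left in the real register `3`. -/
def pickCmd (x : ℕ) (e : NatExpr) (f : RealExpr) (y : ℕ) : Cmd :=
  .seq (.setReal 3 (.const 0)) <| .seq (accLoop x e 3 f) <|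
  .seq (.setReal 5 (.mul (.var 2) (.var 3))) <| .seq (.setReal 4 (.const 0)) <|
  .seq (.setNat y (.const 0)) <|
  RealRAM.forLoop x e (.seq (.ite (.realLt (.var 5) (.var 4)) .skip (.setNat y (.var x)))
    (.setReal 4 (.add (.var 4) f)))

theorem pickNat_succ {N : ℕ} (w : Fin N → ℝ) (u : ℝ) (k : ℕ) [Decidable
    (prefixSum w (k + 1) ≤ u * ∑ j, w j)] : pickNat w u (k + 1) =
    if prefixSum w (k + 1) ≤ u * ∑ j, w j then k + 1 else pickNat w u k := by
  simp only [pickNat]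
  rw [Nat.findGreatest_succ]
  congr

/-- One pass computes the total weight. A second keeps the running prefix sum and overwrites `y`
whenever this sum is at most `u` times the total, so `y` ends at the last such index; prefix sums
need not be monotone. -/
theorem Runs.pickCmd {x N y : ℕ} [NeZero N] {e : NatExpr} {f : RealExpr}
    (he : ∀ s', e.eval m n s' = N) (hxy : x ≠ y) (w : Fin N → ℝ)
    (hf : ∀ k : Fin N, ∀ s', s'.nat x = k.1 → Frame [x, y] [3, 4, 5] [] 0 s s' →
      f.eval S ε s' = w k) :
    Runs S ε ω (pickCmd x e f y) s ((N + 1) * (2 * f.cost + 2 * e.cost + 50))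
      (fun s' => Frame [x, y] [3, 4, 5] [] 0 s s' ∧ s'.nat y = (pick w (s.real 2)).1 ∧
        s'.real 3 = ∑ i, w i) := by
  classical
  have key : Runs S ε ω (RealRAM.pickCmd x e f y) s ((1 + 1) + ((N + 1) * (f.cost + e.cost + 13) +
      ((1 + 3) + ((1 + 1) + ((1 + 1) + (N + 1) * ((10 + f.cost) + e.cost + 10))))))
      (fun s' => Frame [x, y] [3, 4, 5] [] 0 s s' ∧ s'.nat y = (pick w (s.real 2)).1 ∧
        s'.real 3 = ∑ i, w i) := by
    refine Runs.seq (Q' := fun s1 => Frame [x, y] [3, 4, 5] [] 0 s s1 ∧ s1.real 3 = 0)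
      (Runs.setReal ⟨Frame.refl.setReal (by simp) _, by simp [RealExpr.eval]⟩) ?_
    rintro s1 ⟨hF1, h1⟩
    refine Runs.seq (Q' := fun s2 => Frame [x, y] [3, 4, 5] [] 0 s s2 ∧ s2.real 3 = ∑ i, w i) ?_ ?_
    · refine (Runs.accLoop he w fun k s' hs hF => ?_).imp fun s' h => ⟨?_, ?_⟩
      · exact hf k s' hs (hF1.trans (hF.mono (by simp) (by simp) (by simp)))
      · exact hF1.trans (h.1.mono (by simp) (by simp) (by simp))
      · rw [h.2, h1, zero_add]
    rintro s2 ⟨hF2, h2⟩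
    refine Runs.seq (Q' := fun s3 => Frame [x, y] [3, 4, 5] [] 0 s s3 ∧ s3.real 3 = ∑ i, w i ∧
      s3.real 5 = s.real 2 * ∑ i, w i) (Runs.setReal ⟨hF2.setReal (by simp) _, by simp [h2], by
        simp [RealExpr.eval, h2, hF2.real 2 (by simp)]⟩) ?_
    rintro s3 ⟨hF3, h3, h35⟩
    refine Runs.seq (Q' := fun s4 => Frame [x, y] [3, 4, 5] [] 0 s s4 ∧ s4.real 3 = ∑ i, w i ∧
      s4.real 5 = s.real 2 * ∑ i, w i ∧ s4.real 4 = 0) (Runs.setReal ⟨hF3.setReal (by simp) _, by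
        simp [h3], by simp [h35], by simp [RealExpr.eval]⟩) ?_
    rintro s4 ⟨hF4, h4, h45, h44⟩
    refine Runs.seq (Q' := fun s5 => Frame [x, y] [3, 4, 5] [] 0 s s5 ∧ s5.real 3 = ∑ i, w i ∧
      s5.real 5 = s.real 2 * ∑ i, w i ∧ s5.real 4 = 0 ∧ s5.nat y = 0)
      (Runs.setNat ⟨hF4.setNat (by simp) _, h4, h45, h44, by simp [NatExpr.eval]⟩) ?_
    rintro s5 ⟨hF5, h53, h55, h54, h5y⟩
    -- After `k` rounds the indices up to `k - 1` have been tested. At `k = 0` the truncated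
    -- difference is `0`, which agrees with the initial value of `y`.
    refine (Runs.forLoop (B := 10 + f.cost) he (fun k s' => Frame [x, y] [3, 4, 5] [] 0 s s' ∧
      s'.real 3 = ∑ i, w i ∧ s'.real 5 = s.real 2 * ∑ i, w i ∧ s'.real 4 = prefixSum w k ∧
      s'.nat y = pickNat w (s.real 2) (k - 1)) ⟨hF5, h53, h55, by simp [h54], by
        simp [h5y, pickNat]⟩
      (fun k s' v h => ⟨h.1.setNat (by simp) v, h.2.1, h.2.2.1, h.2.2.2.1, by
        simpa [hxy.symm] using h.2.2.2.2⟩) ?_).imp fun s' h => ⟨h.1, h.2.2.2.2, h.2.1⟩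
    rintro k hk s6 hs ⟨hF6, h63, h65, h64, h6y⟩
    refine (Runs.seq (Q' := fun s7 => s7.nat x = k ∧ Frame [x, y] [3, 4, 5] [] 0 s s7 ∧
      s7.real 3 = ∑ i, w i ∧ s7.real 5 = s.real 2 * ∑ i, w i ∧ s7.real 4 = prefixSum w k ∧
      s7.nat y = pickNat w (s.real 2) k) (B := 7) (B' := f.cost + 3) ?_ ?_).mono (by omega)
    · refine Runs.mono (Runs.ite (B := 1) (B' := 2) (fun ht => Runs.skip ?_)
        (fun ht => Runs.setNat ?_)) (by simp [Test.cost, RealExpr.cost])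
      · simp only [Test.Holds, RealExpr.eval, h65, h64] at ht
        refine ⟨hs, hF6, h63, h65, h64, ?_⟩
        rw [h6y]
        rcases k with _ | k
        · rfl
        · rw [pickNat_succ, if_neg (not_le.2 ht), Nat.add_sub_cancel]
      · simp only [Test.Holds, RealExpr.eval, h65, h64, not_lt] at ht
        refine ⟨by simpa [hxy] using hs, hF6.setNat (by simp) _, h63, h65, h64, ?_⟩
        simp only [State.setNat_nat, if_pos, NatExpr.eval, hs]
        rcases k with _ | k
        · simp [pickNat]
        · rw [pickNat_succ, if_pos ht]
    · rintro s7 ⟨hs7, hF7, h73, h75, h74, h7y⟩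
      refine (Runs.setReal ?_).mono (by simp only [RealExpr.cost]; omega)
      refine ⟨by simpa using hs7, hF7.setReal (by simp) _, by simp [h73], by simp [h75], ?_, by
        simpa using h7y⟩
      simp [RealExpr.eval, h74, hf ⟨k, hk⟩ s7 hs7 hF7, prefixSum_succ w hk]
  refine key.mono ?_
  nlinarith

/-! ## Computing a binary logarithm -/

/-- The program that computes the binary logarithm of `e`, rounded up, in the register `y`. -/
def clogCmd (e : NatExpr) (y : ℕ) : Cmd :=
  .seq (.setNat y (.const 0)) <| .seq (.setNat 3 (.const 1)) <|
  .loop (.natLt (.var 3) e) (.seq (.setNat 3 (.add (.var 3) (.var 3)))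
    (.setNat y (.add (.var y) (.const 1))))

/-- Repeated doubling, since index arithmetic is additive and reals cannot be rounded: `2 ^ k < M`
holds exactly for `k < Nat.clog 2 M`. -/
theorem Runs.clogCmd {y M : ℕ} {e : NatExpr} (he : ∀ s', e.eval m n s' = M) (hy : 3 ≠ y) :
    Runs S ε ω (clogCmd e y) s ((Nat.clog 2 M + 1) * (e.cost + 20))
      (fun s' => Frame [3, y] [] [] 0 s s' ∧ s'.nat y = Nat.clog 2 M) := by
  have hlt : ∀ k, 2 ^ k < M ↔ k < Nat.clog 2 M := fun k => by
    rw [← not_le, ← not_le, Nat.clog_le_iff_le_pow one_lt_two]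
  have key : Runs S ε ω (RealRAM.clogCmd e y) s ((1 + 1) + ((1 + 1) +
      (Nat.clog 2 M + 1) * (8 + 1 + (2 + e.cost))))
      (fun s' => Frame [3, y] [] [] 0 s s' ∧ s'.nat 3 = 2 ^ Nat.clog 2 M ∧
        s'.nat y = Nat.clog 2 M) := by
    refine Runs.seq (Q' := fun s1 => Frame [3, y] [] [] 0 s s1 ∧ s1.nat y = 0)
      (Runs.setNat ⟨Frame.refl.setNat (by simp) _, by simp [NatExpr.eval]⟩) ?_
    rintro s1 ⟨hF1, h1⟩
    refine Runs.seq (Q' := fun s2 => Frame [3, y] [] [] 0 s s2 ∧ s2.nat 3 = 2 ^ 0 ∧ s2.nat y = 0)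
      (Runs.setNat ⟨hF1.setNat (by simp) _, by simp [NatExpr.eval], by simp [hy.symm, h1]⟩) ?_
    intro s2 h2
    refine Runs.mono (Runs.loop (B := 8) (fun k s' => Frame [3, y] [] [] 0 s s' ∧
      s'.nat 3 = 2 ^ k ∧ s'.nat y = k) h2 ?_ ?_) (by simp [Test.cost, NatExpr.cost])
    · rintro k hk s' ⟨hF, h3, h4⟩
      refine ⟨by simpa [Test.Holds, NatExpr.eval, h3, he] using (hlt k).2 hk, ?_⟩
      refine (Runs.seq (Q' := fun s' => Frame [3, y] [] [] 0 s s' ∧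
        s'.nat 3 = 2 ^ (k + 1) ∧ s'.nat y = k) (B := 4) (B' := 4) (Runs.setNat
        ⟨hF.setNat (by simp) _, by simp [NatExpr.eval, h3, pow_succ]; ring, by simp [hy.symm, h4]⟩)
        fun s'' h'' => Runs.setNat ⟨h''.1.setNat (by simp) _, by simp [hy, h''.2.1], by
          simp [NatExpr.eval, h''.2.2]⟩)
    · rintro s' ⟨hF, h3, h4⟩
      simp only [Test.Holds, NatExpr.eval, h3, he, hlt, lt_irrefl, not_false_eq_true]
  refine (key.mono ?_).imp fun s' h => ⟨h.1, h.2.2⟩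
  nlinarith

end RealRAM

end

noncomputable section

/-! ## Loops over the cells of an array -/

namespace RealRAM

variable {m n : ℕ} {S : SDP m n} {ε : ℝ} {ω : ℕ → unitInterval}
  {c : Cmd} {s : State} {B : ℕ}

/-- A loop whose `k`-th round fills the cell `(k, 0)` of some arrays. -/
theorem Runs.fillLoop {x N d : ℕ} {e : NatExpr} (he : ∀ s', e.eval m n s' = N)
    {ns rs as : List ℕ} (hx : x ∈ ns) (G : ℕ → Fin N → ℝ)
    (hbody : ∀ k : Fin N, ∀ s', s'.nat x = k.1 → Frame ns rs as (d * k) s s' →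
      (∀ a ∈ as, s'.arr a k 0 = s.arr a k 0) →
      Runs S ε ω c s' B (fun s'' => s''.nat x = k.1 ∧ Frame ns rs as d s' s'' ∧
        ∀ a ∈ as, ∀ j : Fin N, s''.arr a j 0 = if j = k then G a k else s'.arr a j 0)) :
    Runs S ε ω (RealRAM.forLoop x e c) s ((N + 1) * (B + e.cost + 10))
      (fun s' => Frame ns rs as (d * N) s s' ∧ ∀ a ∈ as, ∀ j : Fin N, s'.arr a j 0 = G a j) := by
  refine (Runs.forLoop he (fun k s' => Frame ns rs as (d * k) s s' ∧
    ∀ a ∈ as, ∀ j : Fin N, s'.arr a j 0 = if j.1 < k then G a j else s.arr a j 0)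
    ⟨Frame.refl, by simp⟩ (fun k s' v h => ⟨h.1.setNat hx v, h.2⟩)
    fun k hk s' hs h => ?_).imp fun s' h => ⟨h.1, fun a ha j => by simp [h.2 a ha j]⟩
  refine (hbody ⟨k, hk⟩ s' hs h.1 fun a ha => by simp [h.2 a ha ⟨k, hk⟩]).imp
    fun s'' h'' => ⟨h''.1, ?_, fun a ha j => ?_⟩
  · rw [mul_add, mul_one]; exact h.1.trans h''.2.1
  · rw [h''.2.2 a ha j, h.2 a ha j]
    by_cases hj : j = ⟨k, hk⟩
    · subst hj; simp
    · have hj' : j.1 ≠ k := fun e => hj (Fin.ext e)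
      rw [if_neg hj]
      exact if_congr (by omega) rfl rfl

/-- The loop over all index pairs, which are held in the integer registers `4` and `5`. -/
def pairLoop (c : Cmd) : Cmd := RealRAM.forLoop 4 .dim (RealRAM.forLoop 5 .dim c)

/-- A loop over all index pairs that updates the corresponding cells of some arrays and accumulates
a sum in the register `r`. -/
theorem Runs.pairLoop {rs as : List ℕ} (r : ℕ) (G : ℕ → Fin n → Fin n → ℝ) (g : Fin n → Fin n → ℝ)
    (hbody : ∀ j l : Fin n, ∀ s', s'.nat 4 = j.1 → s'.nat 5 = l.1 → Frame [4, 5] rs as 0 s s' →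
      (∀ a ∈ as, s'.arr a j l = s.arr a j l) →
      Runs S ε ω c s' B (fun s'' => Frame [] rs as 0 s' s'' ∧
        (∀ a ∈ as, ∀ j' l' : Fin n, s''.arr a j' l' =
          if j' = j ∧ l' = l then G a j l else s'.arr a j' l') ∧
        s''.real r = s'.real r + g j l)) :
    Runs S ε ω (pairLoop c) s ((n + 1) * ((n + 1) * (B + 22)))
      (fun s' => Frame [4, 5] rs as 0 s s' ∧ (∀ a ∈ as, ∀ j l : Fin n, s'.arr a j l = G a j l) ∧
        s'.real r = s.real r + ∑ j, ∑ l, g j l) := by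
  have key := Runs.forLoop (S := S) (ε := ε) (ω := ω) (s := s) (x := 4) (N := n) (e := .dim)
    (c := RealRAM.forLoop 5 .dim c) (B := (n + 1) * (B + 1 + 10)) (fun _ => rfl)
    (fun k s' => Frame [4, 5] rs as 0 s s' ∧
      (∀ a ∈ as, ∀ j l : Fin n, s'.arr a j l = if j.1 < k then G a j l else s.arr a j l) ∧
      s'.real r = s.real r + prefixSum (fun j => ∑ l, g j l) k)
    ⟨Frame.refl, by simp, by simp⟩
    (fun k s' v h => ⟨h.1.setNat (by simp) v, h.2⟩) ?_
  · refine (key.mono ?_).imp fun s' h => ⟨h.1, fun a ha j l => by simp [h.2.1 a ha j l], by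
      rw [h.2.2, prefixSum_self]⟩
    simp only [NatExpr.cost]
    nlinarith [Nat.zero_le n]
  rintro k hk s1 hs1 ⟨hF1, h1, h1r⟩
  refine (Runs.forLoop (fun _ => rfl) (fun q s' => Frame [5] rs as 0 s1 s' ∧
      (∀ a ∈ as, ∀ j l : Fin n, s'.arr a j l =
        if j.1 = k ∧ l.1 < q then G a j l else s1.arr a j l) ∧
      s'.real r = s1.real r + prefixSum (g ⟨k, hk⟩) q)
    ⟨Frame.refl, by simp, by simp⟩
    (fun k s' v h => ⟨h.1.setNat (by simp) v, h.2⟩) ?_).imp ?_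
  · rintro q hq s2 hs2 ⟨hF2, h2, h2r⟩
    refine (hbody ⟨k, hk⟩ ⟨q, hq⟩ s2 ((hF2.nat 4 (by simp)).trans hs1) hs2
      (hF1.trans (hF2.mono (by simp) (by simp) (by simp))) fun a ha => ?_).imp ?_
    · have e1 := h2 a ha ⟨k, hk⟩ ⟨q, hq⟩
      have e2 := h1 a ha ⟨k, hk⟩ ⟨q, hq⟩
      simp only [lt_irrefl, and_false, if_false] at e1 e2
      rw [e1, e2]
    · rintro s3 ⟨hF3, h3, h3r⟩
      refine ⟨(hF3.nat 5 (by simp)).trans hs2, hF2.trans (hF3.mono (by simp) (by simp) (by simp)),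
        fun a ha j l => ?_, ?_⟩
      · rw [h3 a ha j l, h2 a ha j l]
        by_cases hj : j = ⟨k, hk⟩ ∧ l = ⟨q, hq⟩
        · obtain ⟨rfl, rfl⟩ := hj; simp
        · rw [if_neg hj]
          refine if_congr ?_ rfl rfl
          simp only [Fin.ext_iff] at hj
          omega
      · rw [h3r, h2r, prefixSum_succ _ hq, add_assoc]
  · rintro s2 ⟨hF2, h2, h2r⟩
    refine ⟨(hF2.nat 4 (by simp)).trans hs1,
      hF1.trans (hF2.mono (by simp) (by simp) (by simp)), fun a ha j l => ?_, ?_⟩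
    · rw [h2 a ha j l, h1 a ha j l]
      by_cases hj : j.1 = k
      · simp [hj]
      · simp only [hj, false_and, if_false]
        exact if_congr (by omega) rfl rfl
    · rw [h2r, h1r, prefixSum_self, prefixSum_succ _ hk, add_assoc]

end RealRAM

end

noncomputable section

/-! ## The blocks of the program -/

namespace RealRAM

open Matrix

variable {m n : ℕ} {S : SDP m n} {ε : ℝ} {ω : ℕ → unitInterval} {s : State}

/-- The number of constraints, including an additional trivial constraint. -/
def rows : NatExpr := .add .numConstr (.const 1)

/-- The entry of the array `k` at the pair of loop indices. -/
def cell (k : ℕ) : RealExpr := .arr k (.var 4) (.var 5)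

/-- The entry of the array `k` at the outer loop index. -/
def outer (k : ℕ) : RealExpr := .arr k (.var 4) (.const 0)

/-- The entry of the array `k` at the inner loop index. -/
def inner (k : ℕ) : RealExpr := .arr k (.var 5) (.const 0)

/-- The program that computes the squared row norms of the array `1` in the array `3`. -/
def rowSqCmd : Cmd := RealRAM.forLoop 4 .dim <| .seq (.setReal 3 (.const 0)) <|
  .seq (accLoop 5 .dim 3 (.mul (cell 1) (cell 1))) (.store 3 (.var 4) (.const 0) (.var 3))

/-- Memory layout common to all blocks. Arrays: `0` sum of the primal points, `1` current point, `2`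
weights, `3` squared row norms, `4` and `6` current and previous Chebyshev vector, `5` scratch.
Integer registers: `0` round counter, `1` and `2` logarithms of the numbers of constraints and of
the dimension, `4` and `5` loop indices, `6` sampled constraint, `7` and `8` sampled entry, `9`
Chebyshev counter. Real registers: `0` accuracy, `1` the step `β`, `2` random number, `7` penalty,
`9` the value of `‖X‖²`; the others are scratch. -/
theorem Runs.rowSqCmd {X : Matrix (Fin n) (Fin n) ℝ} (hX : ∀ j l : Fin n, s.arr 1 j l = X j l) :
    Runs S ε ω rowSqCmd s ((n + 1) * ((n + 1) * 60))
      (fun s' => Frame [4, 5] [3] [3] 0 s s' ∧ ∀ j : Fin n, s'.arr 3 j 0 = rowSq X j) := by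
  refine ((Runs.fillLoop (x := 4) (N := n) (d := 0) (e := .dim) (ns := [4, 5]) (rs := [3])
    (as := [3]) (B := 2 + ((n + 1) * 21 + 4)) (fun _ => rfl) (by simp) (fun _ => rowSq X)
    fun k s1 hs1 hF1 _ => ?_).mono ?_).imp fun s' h => ⟨by simpa using h.1, h.2 3 (by simp)⟩
  swap
  · simp only [NatExpr.cost]; nlinarith [Nat.zero_le n]
  refine Runs.seq (Q' := fun s2 => s2.nat 4 = k.1 ∧ Frame [4, 5] [3] [3] 0 s1 s2 ∧ s2.real 3 = 0 ∧
    ∀ i j, s2.arr 3 i j = s1.arr 3 i j)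
    (Runs.setReal ⟨hs1, Frame.refl.setReal (by simp) _, by simp [RealExpr.eval], by simp⟩) ?_
  rintro s2 ⟨hs2, hF2, h2, h23⟩
  refine Runs.seq (Q' := fun s3 => s3.nat 4 = k.1 ∧ Frame [4, 5] [3] [3] 0 s1 s3 ∧
    s3.real 3 = rowSq X k ∧ ∀ i j, s3.arr 3 i j = s1.arr 3 i j) ?_ ?_
  · refine Runs.imp (Runs.accLoop (fun _ => rfl) (fun l => X k l ^ 2) fun l s3 hs3 hF3 => ?_)
      fun s3 h => ⟨(h.1.nat 4 (by simp)).trans hs2, hF2.trans (h.1.mono (by simp) (by simp)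
        (by simp)), by rw [h.2, h2, zero_add, rowSq], fun i j => by
          rw [h.1.arr 3 (by simp), h23]⟩
    simp [RealExpr.eval, cell, NatExpr.eval, hs3, hF3.nat 4, hF3.arr 1, hs2, hF2.arr 1, hF1.arr 1,
      hX, pow_two]
  · rintro s3 ⟨hs3, hF3, h3, h33⟩
    refine Runs.store ⟨hs3, hF3.store (by simp) _ _ _, fun a ha j => ?_⟩
    obtain rfl := List.mem_singleton.1 ha
    simp [NatExpr.eval, RealExpr.eval, hs3, h3, h33, Fin.ext_iff]

/-- The program that samples a constraint and an entry of the array `1`. -/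
def sampleCmd : Cmd :=
  .seq (.sample 2) <| .seq (pickCmd 4 rows (outer 2) 6) <| .seq rowSqCmd <|
  .seq (.sample 2) <| .seq (pickCmd 4 .dim (outer 3) 7) <|
  .seq (.setReal 9 (.var 3)) <|
  .seq (.sample 2) <| pickCmd 4 .dim (.mul (.arr 1 (.var 7) (.var 4)) (.arr 1 (.var 7) (.var 4))) 8

theorem Runs.sampleCmd [NeZero n] {X : Matrix (Fin n) (Fin n) ℝ} {w : Fin (m + 1) → ℝ}
    (hX : ∀ j l : Fin n, s.arr 1 j l = X j l) (hw : ∀ i : Fin (m + 1), s.arr 2 i 0 = w i) :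
    Runs S ε ω sampleCmd s (1000 * (m + 2 + (n + 1) * (n + 1)))
      (fun s' => Frame [4, 5, 6, 7, 8] [2, 3, 4, 5, 9] [3] 3 s s' ∧
        s'.nat 6 = (pick w (ω s.pos)).1 ∧ s'.nat 7 = (rowIdx X ω (s.pos + 1)).1 ∧
        s'.nat 8 = (colIdx X ω (s.pos + 1)).1 ∧ s'.real 9 = ∑ j, rowSq X j) := by
  have key : Runs S ε ω RealRAM.sampleCmd s (1 + ((m + 1 + 1) * 62 + ((n + 1) * ((n + 1) * 60) +
      (1 + ((n + 1) * 58 + (2 + (1 + ((n + 1) * 66))))))))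
      (fun s' => Frame [4, 5, 6, 7, 8] [2, 3, 4, 5, 9] [3] 3 s s' ∧
        s'.nat 6 = (pick w (ω s.pos)).1 ∧ s'.nat 7 = (rowIdx X ω (s.pos + 1)).1 ∧
        s'.nat 8 = (colIdx X ω (s.pos + 1)).1 ∧ s'.real 9 = ∑ j, rowSq X j) := by
    refine Runs.seq (Q' := fun s1 => Frame [4, 5, 6, 7, 8] [2, 3, 4, 5, 9] [3] 1 s s1 ∧
      s1.real 2 = ω s.pos) (Runs.sample ⟨Frame.refl.draw (by simp) _, by simp⟩) ?_
    rintro s1 ⟨F1, h1⟩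
    refine Runs.seq (Q' := fun s2 => Frame [4, 5, 6, 7, 8] [2, 3, 4, 5, 9] [3] 1 s s2 ∧
      s2.nat 6 = (pick w (ω s.pos)).1) ?_ ?_
    · refine ((Runs.pickCmd (fun _ => rfl) (by simp) w fun i s' hs' hF => ?_).mono
        (le_of_eq rfl)).imp fun s' h => ⟨F1.trans (h.1.mono (by simp) (by simp) (by simp)), by
          rw [h.2.1, h1]⟩
      simp [outer, RealExpr.eval, NatExpr.eval, hs', hF.arr 2, F1.arr 2, hw]
    rintro s2 ⟨F2, h2⟩
    refine Runs.seq (Q' := fun s3 => Frame [4, 5, 6, 7, 8] [2, 3, 4, 5, 9] [3] 1 s s3 ∧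
      s3.nat 6 = (pick w (ω s.pos)).1 ∧ ∀ j : Fin n, s3.arr 3 j 0 = rowSq X j)
      (Runs.imp (Runs.rowSqCmd (X := X) fun j l => by rw [F2.arr 1 (by simp), hX]) fun s' h =>
        ⟨F2.trans (h.1.mono (by simp) (by simp) (by simp)), by
          rw [h.1.nat 6 (by simp), h2], h.2⟩) ?_
    rintro s3 ⟨F3, h3, h33⟩
    refine Runs.seq (Q' := fun s4 => Frame [4, 5, 6, 7, 8] [2, 3, 4, 5, 9] [3] 2 s s4 ∧
      s4.nat 6 = (pick w (ω s.pos)).1 ∧ (∀ j : Fin n, s4.arr 3 j 0 = rowSq X j) ∧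
      s4.real 2 = ω (s.pos + 1))
      (Runs.sample ⟨F3.draw (by simp) _, h3, h33, by simp [F3.pos]⟩) ?_
    rintro s4 ⟨F4, h4, h43, h42⟩
    refine Runs.seq (Q' := fun s5 => Frame [4, 5, 6, 7, 8] [2, 3, 4, 5, 9] [3] 2 s s5 ∧
      s5.nat 6 = (pick w (ω s.pos)).1 ∧ s5.nat 7 = (rowIdx X ω (s.pos + 1)).1 ∧
      s5.real 3 = ∑ j, rowSq X j) ?_ ?_
    · refine ((Runs.pickCmd (fun _ => rfl) (by simp) (rowSq X) fun i s' hs' hF => ?_).mono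
        (le_of_eq rfl)).imp fun s' h => ⟨F4.trans (h.1.mono (by simp) (by simp) (by simp)), by
          rw [h.1.nat 6 (by simp), h4], by rw [h.2.1, h42, rowIdx], h.2.2⟩
      simp [outer, RealExpr.eval, NatExpr.eval, hs', hF.arr 3, h43]
    rintro s5 ⟨F5, h5, h57, h53⟩
    refine Runs.seq (Q' := fun s6 => Frame [4, 5, 6, 7, 8] [2, 3, 4, 5, 9] [3] 2 s s6 ∧
      s6.nat 6 = (pick w (ω s.pos)).1 ∧ s6.nat 7 = (rowIdx X ω (s.pos + 1)).1 ∧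
      s6.real 9 = ∑ j, rowSq X j) (Runs.setReal ⟨F5.setReal (by simp) _, h5, h57, by
        simp [RealExpr.eval, h53]⟩) ?_
    rintro s6 ⟨F6, h6, h67, h69⟩
    refine Runs.seq (Q' := fun s7 => Frame [4, 5, 6, 7, 8] [2, 3, 4, 5, 9] [3] 3 s s7 ∧
      s7.nat 6 = (pick w (ω s.pos)).1 ∧ s7.nat 7 = (rowIdx X ω (s.pos + 1)).1 ∧
      s7.real 9 = ∑ j, rowSq X j ∧ s7.real 2 = ω (s.pos + 2))
      (Runs.sample ⟨F6.draw (by simp) _, h6, h67, by simp [h69], by simp [F6.pos]⟩) ?_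
    rintro s7 ⟨F7, h7, h77, h79, h72⟩
    refine ((Runs.pickCmd (fun _ => rfl) (by simp) (fun l => X (rowIdx X ω (s.pos + 1)) l ^ 2)
      fun i s' hs' hF => ?_).mono (le_of_eq rfl)).imp fun s' h =>
        ⟨F7.trans (h.1.mono (by simp) (by simp) (by simp)), by
          rw [h.1.nat 6 (by simp), h7], by rw [h.1.nat 7 (by simp), h77], by
          rw [h.2.1, h72, colIdx], by rw [h.1.real 9 (by simp), h79]⟩
    simp [RealExpr.eval, NatExpr.eval, hs', hF.arr 1, F7.arr 1, hF.nat 7, h77, hX, pow_two]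
  refine key.mono ?_
  nlinarith [Nat.zero_le n]

end RealRAM

end

/-! ### Programs for the Chebyshev iteration and the penalty -/

noncomputable section

namespace RealRAM

open Matrix

variable {m n : ℕ} {S : SDP m n} {ε : ℝ} {ω : ℕ → unitInterval} {s : State}

/-- The program that draws the start vector of the Chebyshev iteration. -/
def startCmd : Cmd := RealRAM.forLoop 4 .dim <| .seq (.sample 2) <|
  .seq (.store 4 (.var 4) (.const 0) (.add (.const 1) (.var 2)))
    (.store 6 (.var 4) (.const 0) (.sub (.const 0) (.add (.const 1) (.var 2))))

theorem Runs.startCmd :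
    Runs S ε ω startCmd s ((n + 1) * 40)
      (fun s' => Frame [4] [2] [4, 6] n s s' ∧
        (∀ j : Fin n, s'.arr 4 j 0 = startVec n s.pos ω j) ∧
        ∀ j : Fin n, s'.arr 6 j 0 = -startVec n s.pos ω j) := by
  refine ((Runs.fillLoop (x := 4) (N := n) (d := 1) (e := .dim) (ns := [4]) (rs := [2])
    (as := [4, 6]) (B := 1 + (6 + 8)) (fun _ => rfl) (by simp)
    (fun a j => if a = 4 then startVec n s.pos ω j else -startVec n s.pos ω j)
    fun k s1 hs1 hF1 _ => ?_).mono ?_).imp fun s' h => ⟨by simpa using h.1,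
      fun j => by simpa using h.2 4 (by simp) j, fun j => by simpa using h.2 6 (by simp) j⟩
  swap
  · simp only [NatExpr.cost]; nlinarith
  refine Runs.seq (Q' := fun s2 => s2.nat 4 = k.1 ∧ Frame [4] [2] [4, 6] 1 s1 s2 ∧
    s2.real 2 = ω (s.pos + k) ∧ ∀ a i j, s2.arr a i j = s1.arr a i j)
    (Runs.sample ⟨hs1, Frame.refl.draw (by simp) _, by simp [hF1.pos], by simp⟩) ?_
  rintro s2 ⟨hs2, hF2, h2, h2a⟩
  refine Runs.seq (Q' := fun s3 => s3.nat 4 = k.1 ∧ Frame [4] [2] [4, 6] 1 s1 s3 ∧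
    s3.real 2 = ω (s.pos + k) ∧ (∀ j : Fin n, s3.arr 4 j 0 =
      if j = k then startVec n s.pos ω k else s1.arr 4 j 0) ∧
    ∀ j : Fin n, s3.arr 6 j 0 = s1.arr 6 j 0)
    (Runs.store ⟨hs2, hF2.store (by simp) _ _ _, h2, fun j => ?_, fun j => ?_⟩) ?_
  · simp [NatExpr.eval, RealExpr.eval, hs2, h2, h2a, Fin.ext_iff, startVec]
  · simp [h2a]
  rintro s3 ⟨hs3, hF3, h3, h34, h36⟩
  refine Runs.store ⟨hs3, hF3.store (by simp) _ _ _, fun a ha j => ?_⟩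
  have ha : a = 4 ∨ a = 6 := by simpa using ha
  rcases ha with rfl | rfl
  · simp [h34]
  · simp [NatExpr.eval, RealExpr.eval, hs3, h3, h36, Fin.ext_iff, startVec]

/-- The program for one step of the Chebyshev iteration. -/
def chebStepCmd : Cmd := .seq
  (RealRAM.forLoop 4 .dim <| .seq (.setReal 3 (.const 0)) <|
    .seq (accLoop 5 .dim 3 (.mul (cell 1) (inner 4)))
      (.store 5 (.var 4) (.const 0) (.sub (.sub (.mul (.const 2) (outer 4))
        (.mul (.const 4) (.var 3))) (outer 6))))
  (RealRAM.forLoop 4 .dim <| .seq (.store 6 (.var 4) (.const 0) (outer 4))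
    (.store 4 (.var 4) (.const 0) (outer 5)))

/-- Every new coordinate needs the whole old vector, so the new vector is built in array `5` and the
two stored vectors are shifted only afterwards. -/
theorem Runs.chebStepCmd {X : Matrix (Fin n) (Fin n) ℝ} (hX : ∀ j l : Fin n, s.arr 1 j l = X j l)
    {v v' : Fin n → ℝ} (hv : ∀ j : Fin n, s.arr 4 j 0 = v j)
    (hv' : ∀ j : Fin n, s.arr 6 j 0 = v' j) :
    Runs S ε ω chebStepCmd s ((n + 1) * ((n + 1) * 120))
      (fun s' => Frame [4, 5] [3] [4, 5, 6] 0 s s' ∧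
        (∀ j : Fin n, s'.arr 4 j 0 = 2 * v j - 4 * ∑ l, X j l * v l - v' j) ∧
        ∀ j : Fin n, s'.arr 6 j 0 = v j) := by
  have key : Runs S ε ω RealRAM.chebStepCmd s
      ((n + 1) * ((2 + ((n + 1) * 21 + 16)) + 1 + 10) + (n + 1) * ((6 + 6) + 1 + 10))
      (fun s' => Frame [4, 5] [3] [4, 5, 6] 0 s s' ∧
        (∀ j : Fin n, s'.arr 4 j 0 = 2 * v j - 4 * ∑ l, X j l * v l - v' j) ∧
        ∀ j : Fin n, s'.arr 6 j 0 = v j) := by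
    refine Runs.seq (Q' := fun s' => Frame [4, 5] [3] [5] 0 s s' ∧
      ∀ j : Fin n, s'.arr 5 j 0 = 2 * v j - 4 * ∑ l, X j l * v l - v' j) ?_ ?_
    · refine (Runs.fillLoop (x := 4) (N := n) (d := 0) (e := .dim) (ns := [4, 5]) (rs := [3])
        (as := [5]) (B := 2 + ((n + 1) * 21 + 16)) (fun _ => rfl) (by simp)
        (fun _ j => 2 * v j - 4 * ∑ l, X j l * v l - v' j)
        fun k s1 hs1 hF1 _ => ?_).imp fun s' h => ⟨by simpa using h.1, h.2 5 (by simp)⟩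
      refine Runs.seq (Q' := fun s2 => s2.nat 4 = k.1 ∧ Frame [4, 5] [3] [5] 0 s1 s2 ∧
        s2.real 3 = 0 ∧ ∀ i j, s2.arr 5 i j = s1.arr 5 i j)
        (Runs.setReal ⟨hs1, Frame.refl.setReal (by simp) _, by simp [RealExpr.eval], by simp⟩) ?_
      rintro s2 ⟨hs2, hF2, h2, h25⟩
      refine Runs.seq (Q' := fun s3 => s3.nat 4 = k.1 ∧ Frame [4, 5] [3] [5] 0 s1 s3 ∧
        s3.real 3 = ∑ l, X k l * v l ∧ ∀ i j, s3.arr 5 i j = s1.arr 5 i j) ?_ ?_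
      · refine Runs.imp (Runs.accLoop (fun _ => rfl) (fun l => X k l * v l) fun l s3 hs3 hF3 => ?_)
          fun s3 h => ⟨(h.1.nat 4 (by simp)).trans hs2, hF2.trans (h.1.mono (by simp) (by simp)
            (by simp)), by rw [h.2, h2, zero_add], fun i j => by
              rw [h.1.arr 5 (by simp), h25]⟩
        simp [RealExpr.eval, cell, inner, NatExpr.eval, hs3, hF3.nat 4, hF3.arr 1, hF3.arr 4, hs2,
          hF2.arr 1, hF1.arr 1, hF2.arr 4, hF1.arr 4, hX, hv]
      · rintro s3 ⟨hs3, hF3, h3, h33⟩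
        refine Runs.store ⟨hs3, hF3.store (by simp) _ _ _, fun a ha j => ?_⟩
        obtain rfl := List.mem_singleton.1 ha
        simp [NatExpr.eval, RealExpr.eval, outer, hs3, h3, h33, Fin.ext_iff, hF3.arr 4, hF1.arr 4,
          hF3.arr 6, hF1.arr 6, hv, hv']
    rintro s1 ⟨hF1, h15⟩
    refine (Runs.fillLoop (x := 4) (N := n) (d := 0) (e := .dim) (ns := [4]) (rs := [])
        (as := [4, 6]) (B := 6 + 6) (fun _ => rfl) (by simp)
        (fun a j => if a = 4 then 2 * v j - 4 * ∑ l, X j l * v l - v' j else v j)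
        fun k s2 hs2 hF2 h2 => ?_).imp fun s' h => ⟨?_, fun j => by simpa using h.2 4 (by simp) j,
          fun j => by simpa using h.2 6 (by simp) j⟩
    · refine Runs.seq (Q' := fun s3 => s3.nat 4 = k.1 ∧ Frame [4] [] [4, 6] 0 s2 s3 ∧
        (∀ j : Fin n, s3.arr 6 j 0 = if j = k then v k else s2.arr 6 j 0) ∧
        ∀ j : Fin n, s3.arr 4 j 0 = s2.arr 4 j 0)
        (Runs.store ⟨hs2, Frame.refl.store (by simp) _ _ _, fun j => ?_, fun j => ?_⟩) ?_
      · simp [NatExpr.eval, RealExpr.eval, outer, hs2, Fin.ext_iff, h2 4, hF1.arr 4, hv]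
      · simp
      rintro s3 ⟨hs3, hF3, h36, h34⟩
      refine Runs.store ⟨hs3, hF3.store (by simp) _ _ _, fun a ha j => ?_⟩
      have ha : a = 4 ∨ a = 6 := by simpa using ha
      rcases ha with rfl | rfl
      · simp [NatExpr.eval, RealExpr.eval, outer, hs3, h34, Fin.ext_iff, hF3.arr 5, hF2.arr 5, h15]
      · simp [h36]
    · have := hF1.mono (ns' := [4, 5]) (rs' := [3]) (as' := [4, 5, 6])
        (by simp) (by simp) (by simp)
      exact this.trans ((by simpa using h.1 : Frame [4] [] [4, 6] 0 s1 s').mono (by simp) (by simp)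
        (by simp))
  refine key.mono ?_
  nlinarith [Nat.zero_le n]

/-- The program for the Chebyshev iteration. -/
def chebCmd : Cmd := .seq (.setNat 9 (.const 0)) <|
  .loop (.realLt (.ofNat (.var 9))
    (.div (.mul (.const 100) (.ofNat (.var 2))) (.sqrt (.var 0))))
    (.seq chebStepCmd (.setNat 9 (.add (.var 9) (.const 1))))

/-- Rounding up is done by the loop test: `i < x` with `x` real holds for exactly `⌈x⌉₊` natural
numbers `i`. -/
theorem Runs.chebCmd {X : Matrix (Fin n) (Fin n) ℝ} (hX : ∀ j l : Fin n, s.arr 1 j l = X j l)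
    {g : Fin n → ℝ} (hg : ∀ j : Fin n, s.arr 4 j 0 = g j)
    (hg' : ∀ j : Fin n, s.arr 6 j 0 = -g j) {k : ℕ}
    (hk : ⌈100 * (s.nat 2 : ℝ) / √(s.real 0)⌉₊ = k) :
    Runs S ε ω chebCmd s ((k + 2) * ((n + 1) * ((n + 1) * 160)))
      (fun s' => Frame [4, 5, 9] [3] [4, 5, 6] 0 s s' ∧
        ∀ j : Fin n, s'.arr 4 j 0 = chebVec X g k j) := by
  have hlt : ∀ i : ℕ, (i : ℝ) < 100 * (s.nat 2 : ℝ) / √(s.real 0) ↔ i < k := fun i => by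
    rw [← hk, Nat.lt_ceil]
  have key : Runs S ε ω RealRAM.chebCmd s
      (2 + (k + 1) * (((n + 1) * ((n + 1) * 120) + 4) + 1 + 10))
      (fun s' => Frame [4, 5, 9] [3] [4, 5, 6] 0 s s' ∧ s'.nat 9 = k ∧
        (∀ j : Fin n, s'.arr 4 j 0 = (chebVecPair X g k).1 j) ∧
        ∀ j : Fin n, s'.arr 6 j 0 = (chebVecPair X g k).2 j) := by
    refine Runs.seq (Q' := fun s' => Frame [4, 5, 9] [3] [4, 5, 6] 0 s s' ∧ s'.nat 9 = 0 ∧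
        (∀ j : Fin n, s'.arr 4 j 0 = (chebVecPair X g 0).1 j) ∧
        ∀ j : Fin n, s'.arr 6 j 0 = (chebVecPair X g 0).2 j)
      (Runs.setNat ⟨Frame.refl.setNat (by simp) _, by simp [NatExpr.eval], by simpa [chebVecPair] using hg, by
        simpa [chebVecPair] using hg'⟩) ?_
    intro s1 h1
    refine (Runs.loop (B := (n + 1) * ((n + 1) * 120) + 4)
      (fun i s' => Frame [4, 5, 9] [3] [4, 5, 6] 0 s s' ∧ s'.nat 9 = i ∧
        (∀ j : Fin n, s'.arr 4 j 0 = (chebVecPair X g i).1 j) ∧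
        ∀ j : Fin n, s'.arr 6 j 0 = (chebVecPair X g i).2 j) h1 ?_ ?_).mono (le_of_eq rfl)
    · rintro i hi s2 ⟨hF2, h29, h24, h26⟩
      refine ⟨?_, Runs.seq (Q' := fun s' => Frame [4, 5, 9] [3] [4, 5, 6] 0 s s' ∧ s'.nat 9 = i ∧
        (∀ j : Fin n, s'.arr 4 j 0 = (chebVecPair X g (i + 1)).1 j) ∧
        ∀ j : Fin n, s'.arr 6 j 0 = (chebVecPair X g (i + 1)).2 j) ?_ ?_⟩
      · simpa [Test.Holds, RealExpr.eval, NatExpr.eval, h29, hF2.nat 2, hF2.real 0] using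
          (hlt i).2 hi
      · exact (Runs.chebStepCmd (X := X) (fun j l => by rw [hF2.arr 1 (by simp), hX]) h24 h26).imp
          fun s' h => ⟨hF2.trans (h.1.mono (by simp) (by simp) (by simp)), by
            rw [h.1.nat 9 (by simp), h29], h.2.1, h.2.2⟩
      · rintro s3 ⟨hF3, h39, h34, h36⟩
        exact Runs.setNat ⟨hF3.setNat (by simp) _, by simp [NatExpr.eval, h39], by simpa using h34,
          by simpa using h36⟩
    · rintro s2 ⟨hF2, h29, h24, h26⟩
      have := (hlt k).not.2 (lt_irrefl k)
      simpa [Test.Holds, RealExpr.eval, NatExpr.eval, h29, hF2.nat 2, hF2.real 0] using this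
  refine (key.mono ?_).imp fun s' h => ⟨h.1, h.2.2.1⟩
  have : 1 ≤ (n + 1) * (n + 1) := Nat.one_le_iff_ne_zero.2 (by positivity)
  nlinarith

/-- The program that computes the direction and the size of the penalty. -/
def penaltyCmd : Cmd := .seq startCmd <| .seq chebCmd <| .seq (.setReal 3 (.const 0)) <|
  .seq (accLoop 4 .dim 3 (.mul (outer 4) (outer 4))) <| .seq (.setReal 4 (.const 0)) <|
  .seq (pairLoop (.setReal 4 (.add (.var 4) (.mul (outer 4) (.mul (cell 1) (inner 4)))))) <|
  .seq (.setReal 7 (.const 0)) <|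
  .ite (.realLt (.var 4) (.const 0)) (.setReal 7 (.div (.const 2) (.var 3))) .skip

theorem Runs.penaltyCmd {X : Matrix (Fin n) (Fin n) ℝ} (hX : ∀ j l : Fin n, s.arr 1 j l = X j l)
    {k : ℕ} (hk : ⌈100 * (s.nat 2 : ℝ) / √(s.real 0)⌉₊ = k) :
    Runs S ε ω penaltyCmd s ((k + 2) * ((n + 1) * ((n + 1) * 400)))
      (fun s' => Frame [4, 5, 9] [2, 3, 4, 7] [4, 5, 6] n s s' ∧
        (∀ j : Fin n, s'.arr 4 j 0 = chebVec X (startVec n s.pos ω) k j) ∧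
        s'.real 7 = penalty X (chebVec X (startVec n s.pos ω) k)) := by
  set v := chebVec X (startVec n s.pos ω) k with hv
  have key : Runs S ε ω RealRAM.penaltyCmd s ((n + 1) * 40 +
      ((k + 2) * ((n + 1) * ((n + 1) * 160)) + (2 + ((n + 1) * 21 + (2 +
      ((n + 1) * ((n + 1) * (14 + 22)) + (2 + (1 + 3 + (4 + 1)))))))))
      (fun s' => Frame [4, 5, 9] [2, 3, 4, 7] [4, 5, 6] n s s' ∧
        (∀ j : Fin n, s'.arr 4 j 0 = v j) ∧ s'.real 7 = penalty X v) := by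
    refine Runs.seq (Q' := fun s' => Frame [4, 5, 9] [2, 3, 4, 7] [4, 5, 6] n s s' ∧
        (∀ j : Fin n, s'.arr 4 j 0 = startVec n s.pos ω j) ∧
        ∀ j : Fin n, s'.arr 6 j 0 = -startVec n s.pos ω j)
      (Runs.startCmd.imp fun s' h => ⟨h.1.mono (by simp) (by simp) (by simp), h.2⟩) ?_
    rintro s1 ⟨F1, h14, h16⟩
    refine Runs.seq (Q' := fun s' => Frame [4, 5, 9] [2, 3, 4, 7] [4, 5, 6] n s s' ∧
        (∀ j : Fin n, s'.arr 4 j 0 = v j))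
      ((Runs.chebCmd (X := X) (fun j l => by rw [F1.arr 1 (by simp), hX]) h14 h16
        (by rw [F1.nat 2 (by simp), F1.real 0 (by simp), hk])).imp fun s' h =>
        ⟨F1.trans (h.1.mono (by simp) (by simp) (by simp)), h.2⟩) ?_
    rintro s2 ⟨F2, h24⟩
    refine Runs.seq (Q' := fun s' => Frame [4, 5, 9] [2, 3, 4, 7] [4, 5, 6] n s s' ∧
        (∀ j : Fin n, s'.arr 4 j 0 = v j) ∧ s'.real 3 = 0)
      (Runs.setReal ⟨F2.setReal (by simp) _, h24, by simp [RealExpr.eval]⟩) ?_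
    rintro s3 ⟨F3, h34, h33⟩
    refine Runs.seq (Q' := fun s' => Frame [4, 5, 9] [2, 3, 4, 7] [4, 5, 6] n s s' ∧
        (∀ j : Fin n, s'.arr 4 j 0 = v j) ∧ s'.real 3 = v ⬝ᵥ v) ?_ ?_
    · refine Runs.imp (Runs.accLoop (fun _ => rfl) (fun j => v j * v j) fun j s' hs' hF => ?_)
        fun s' h => ⟨F3.trans (h.1.mono (by simp) (by simp) (by simp)), fun j => by
          rw [h.1.arr 4 (by simp), h34], by rw [h.2, h33, zero_add]; rfl⟩
      simp [RealExpr.eval, NatExpr.eval, outer, hs', hF.arr 4, h34]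
    rintro s4 ⟨F4, h44, h43⟩
    refine Runs.seq (Q' := fun s' => Frame [4, 5, 9] [2, 3, 4, 7] [4, 5, 6] n s s' ∧
        (∀ j : Fin n, s'.arr 4 j 0 = v j) ∧ s'.real 3 = v ⬝ᵥ v ∧ s'.real 4 = 0)
      (Runs.setReal ⟨F4.setReal (by simp) _, h44, by simp [h43], by simp [RealExpr.eval]⟩) ?_
    rintro s5 ⟨F5, h54, h53, h5⟩
    refine Runs.seq (Q' := fun s' => Frame [4, 5, 9] [2, 3, 4, 7] [4, 5, 6] n s s' ∧
        (∀ j : Fin n, s'.arr 4 j 0 = v j) ∧ s'.real 3 = v ⬝ᵥ v ∧ s'.real 4 = v ⬝ᵥ (X *ᵥ v)) ?_ ?_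
    · refine Runs.imp (Runs.pairLoop (rs := [4]) (as := []) 4 (fun _ _ _ => 0)
        (fun j l => v j * (X j l * v l)) fun j l s' hs' hs'' hF _ => Runs.setReal
          ⟨Frame.refl.setReal (by simp) _, by simp, ?_⟩)
        fun s' h => ⟨F5.trans (h.1.mono (by simp) (by simp) (by simp)), fun j => by
          rw [h.1.arr 4 (by simp), h54], by rw [h.1.real 3 (by simp), h53], by
          rw [h.2.2, h5, zero_add]; simp only [dotProduct, mulVec, Finset.mul_sum]⟩
      simp [RealExpr.eval, NatExpr.eval, cell, inner, outer, hs', hs'', hF.arr 4, hF.arr 1, h54,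
        F5.arr 1, hX]
    rintro s6 ⟨F6, h64, h63, h6⟩
    refine Runs.seq (Q' := fun s' => Frame [4, 5, 9] [2, 3, 4, 7] [4, 5, 6] n s s' ∧
        (∀ j : Fin n, s'.arr 4 j 0 = v j) ∧ s'.real 3 = v ⬝ᵥ v ∧ s'.real 4 = v ⬝ᵥ (X *ᵥ v) ∧
        s'.real 7 = 0)
      (Runs.setReal ⟨F6.setReal (by simp) _, h64, by simp [h63], by simp [h6], by
        simp [RealExpr.eval]⟩) ?_
    rintro s7 ⟨F7, h74, h73, h7, h77⟩
    refine Runs.ite (B := 4) (B' := 1) (fun ht => Runs.setReal ?_) (fun ht => Runs.skip ?_)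
    · have ht : v ⬝ᵥ (X *ᵥ v) < 0 := by simpa [Test.Holds, RealExpr.eval, h7] using ht
      exact ⟨F7.setReal (by simp) _, h74, by simp [RealExpr.eval, h73, penalty, ht]⟩
    · have ht : ¬ v ⬝ᵥ (X *ᵥ v) < 0 := by simpa [Test.Holds, RealExpr.eval, h7] using ht
      exact ⟨F7, h74, by rw [h77, penalty, if_neg ht]⟩
  refine key.mono ?_
  have : 1 ≤ (n + 1) * (n + 1) := Nat.one_le_iff_ne_zero.2 (by positivity)
  nlinarith [Nat.zero_le n, Nat.zero_le k]

end RealRAM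

end

/-! ### The extended problem, and programs for the weight and primal updates -/

noncomputable section

namespace SDP

variable {m n : ℕ}

/-- The constraint matrices, with a trivial constraint at the end. -/
def extA (S : SDP m n) (i : Fin (m + 1)) : Matrix (Fin n) (Fin n) ℝ :=
  Matrix.of fun j l => S.entryA i j l

/-- The right-hand sides, with a trivial constraint at the end. -/
def extB (S : SDP m n) (i : Fin (m + 1)) : ℝ := S.entryB i

end SDP

namespace RealRAM

open Matrix

variable {m n : ℕ} {S : SDP m n} {ε : ℝ} {ω : ℕ → unitInterval} {s : State}

/-- The program that clips the real register `6` to the range given by the real register `8`. -/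
def clipCmd : Cmd := .seq (.ite (.realLt (.var 8) (.var 6)) (.setReal 6 (.var 8)) .skip)
  (.ite (.realLt (.var 6) (.sub (.const 0) (.var 8))) (.setReal 6 (.sub (.const 0) (.var 8))) .skip)

theorem Runs.clipCmd {ns rs as : List ℕ} (h6 : 6 ∈ rs) :
    Runs S ε ω clipCmd s 20 (fun s' => Frame ns rs as 0 s s' ∧
      (∀ x, x ≠ 6 → s'.real x = s.real x) ∧ (∀ x, s'.nat x = s.nat x) ∧
      (∀ a i j, s'.arr a i j = s.arr a i j) ∧ s'.real 6 = clip (s.real 8) (s.real 6)) := by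
  have key : Runs S ε ω RealRAM.clipCmd s ((1 + 3 + (2 + 1)) + (1 + 5 + (4 + 1)))
      (fun s' => Frame ns rs as 0 s s' ∧
      (∀ x, x ≠ 6 → s'.real x = s.real x) ∧ (∀ x, s'.nat x = s.nat x) ∧
      (∀ a i j, s'.arr a i j = s.arr a i j) ∧ s'.real 6 = clip (s.real 8) (s.real 6)) := by
    refine Runs.seq (Q' := fun s' => Frame ns rs as 0 s s' ∧
      (∀ x, x ≠ 6 → s'.real x = s.real x) ∧ (∀ x, s'.nat x = s.nat x) ∧
      (∀ a i j, s'.arr a i j = s.arr a i j) ∧ s'.real 6 = min (s.real 8) (s.real 6))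
      (Runs.ite (B := 2) (B' := 1) (fun ht => Runs.setReal ?_) (fun ht => Runs.skip ?_)) ?_
    · simp only [Test.Holds, RealExpr.eval] at ht
      exact ⟨Frame.refl.setReal h6 _, fun x hx => by simp [hx], by simp, by simp, by
        simp [RealExpr.eval, min_eq_left ht.le]⟩
    · simp only [Test.Holds, RealExpr.eval, not_lt] at ht
      exact ⟨Frame.refl, by simp, by simp, by simp, (min_eq_right ht).symm⟩
    rintro s1 ⟨F1, h1r, h1n, h1a, h1⟩
    refine Runs.ite (B := 4) (B' := 1) (fun ht => Runs.setReal ?_) (fun ht => Runs.skip ?_)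
    · simp only [Test.Holds, RealExpr.eval, h1, h1r 8 (by simp), Rat.cast_zero, zero_sub] at ht
      exact ⟨F1.setReal h6 _, fun x hx => by simp [hx, h1r], by simpa using h1n,
        by simpa using h1a, by
        simp [RealExpr.eval, clip, max_eq_left ht.le, h1r]⟩
    · simp only [Test.Holds, RealExpr.eval, h1, h1r 8 (by simp), Rat.cast_zero, zero_sub,
        not_lt] at ht
      exact ⟨F1, h1r, h1n, h1a, by rw [h1, clip, max_eq_right ht]⟩
  exact key.mono (by norm_num)

/-- The program that updates the weights. -/
def weightCmd : Cmd := RealRAM.forLoop 4 rows <|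
  .seq (.setReal 6 (.div (.mul (.var 9) (.inA (.var 4) (.var 7) (.var 8)))
    (.arr 1 (.var 7) (.var 8)))) <|
  .seq (.setReal 8 (.div (.const 1) (.mul (.const 8) (.var 1)))) <| .seq clipCmd <|
  .seq (.setReal 6 (.mul (.var 1) (.sub (.var 6) (.inB (.var 4))))) <|
  .store 2 (.var 4) (.const 0) (.mul (outer 2) (.add (.sub (.const 1) (.var 6))
    (.mul (.var 6) (.var 6))))

/-- Only the entry `(J, L)` of each constraint matrix is read, so updating all weights takes time
linear in `m`, independently of `n`. -/
theorem Runs.weightCmd {X : Matrix (Fin n) (Fin n) ℝ} (hX : ∀ j l : Fin n, s.arr 1 j l = X j l)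
    {w : Fin (m + 1) → ℝ} (hw : ∀ i : Fin (m + 1), s.arr 2 i 0 = w i) {J L : Fin n}
    (hJ : s.nat 7 = J) (hL : s.nat 8 = L) (hR : s.real 9 = ∑ j, rowSq X j) {β : ℝ}
    (hβ : s.real 1 = β) :
    Runs S ε ω weightCmd s ((m + 2) * 100)
      (fun s' => Frame [4] [6, 8] [2] 0 s s' ∧ ∀ i : Fin (m + 1), s'.arr 2 i 0 =
        w i * weightFactor β (entryEst (S.extA i) X β J L - S.extB i)) := by
  refine ((Runs.fillLoop (x := 4) (N := m + 1) (d := 0) (e := rows) (ns := [4]) (rs := [6, 8])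
    (as := [2]) (B := 11 + (6 + (20 + (7 + (14))))) (fun _ => rfl) (by simp)
    (fun _ i => w i * weightFactor β (entryEst (S.extA i) X β J L - S.extB i))
    fun i s1 hs1 hF1 h1 => ?_).mono ?_).imp fun s' h => ⟨by simpa using h.1, h.2 2 (by simp)⟩
  swap
  · simp only [NatExpr.cost, rows]; omega
  refine Runs.seq (Q' := fun s2 => s2.nat 4 = i.1 ∧ Frame [4] [6, 8] [2] 0 s1 s2 ∧
    (∀ a i j, s2.arr a i j = s1.arr a i j) ∧
    s2.real 6 = (∑ j, rowSq X j) * S.extA i J L / X J L)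
    (Runs.setReal ⟨hs1, Frame.refl.setReal (by simp) _, by simp, ?_⟩) ?_
  · simp [RealExpr.eval, NatExpr.eval, hs1, hF1.nat 7, hF1.nat 8, hF1.real 9, hF1.arr 1, hX, hJ, hL,
      hR, SDP.extA]
  rintro s2 ⟨hs2, F2, h2a, h26⟩
  refine Runs.seq (Q' := fun s3 => s3.nat 4 = i.1 ∧ Frame [4] [6, 8] [2] 0 s1 s3 ∧
    (∀ a i j, s3.arr a i j = s1.arr a i j) ∧
    s3.real 6 = (∑ j, rowSq X j) * S.extA i J L / X J L ∧ s3.real 8 = 1 / (8 * β))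
    (Runs.setReal ⟨hs2, F2.setReal (by simp) _, by simpa using h2a, by simpa using h26, ?_⟩) ?_
  · simp [RealExpr.eval, F2.real 1, hF1.real 1, hβ]
  rintro s3 ⟨hs3, F3, h3a, h36, h38⟩
  refine Runs.seq (Q' := fun s4 => s4.nat 4 = i.1 ∧ Frame [4] [6, 8] [2] 0 s1 s4 ∧
    (∀ a i j, s4.arr a i j = s1.arr a i j) ∧ s4.real 6 = entryEst (S.extA i) X β J L)
    ((Runs.clipCmd (by simp)).imp fun s' h => ⟨by rw [h.2.2.1, hs3], F3.trans h.1, fun a i j => by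
      rw [h.2.2.2.1, h3a], by rw [h.2.2.2.2, h36, h38, entryEst]⟩) ?_
  rintro s4 ⟨hs4, F4, h4a, h46⟩
  refine Runs.seq (Q' := fun s5 => s5.nat 4 = i.1 ∧ Frame [4] [6, 8] [2] 0 s1 s5 ∧
    (∀ a i j, s5.arr a i j = s1.arr a i j) ∧
    s5.real 6 = β * (entryEst (S.extA i) X β J L - S.extB i))
    (Runs.setReal ⟨hs4, F4.setReal (by simp) _, by simpa using h4a, ?_⟩) ?_
  · simp [RealExpr.eval, NatExpr.eval, F4.real 1, hF1.real 1, hβ, h46, hs4, SDP.extB]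
  rintro s5 ⟨hs5, F5, h5a, h56⟩
  refine Runs.store ⟨hs5, F5.store (by simp) _ _ _, fun a ha j => ?_⟩
  obtain rfl := List.mem_singleton.1 ha
  simp [NatExpr.eval, RealExpr.eval, outer, hs5, h5a, h56, Fin.ext_iff, h1 2, hw, weightFactor]

/-- The program that updates the primal point and the sum of the primal points. -/
def primalCmd : Cmd := .seq (.setReal 3 (.const 0)) <|
  .seq (pairLoop (.seq (.store 0 (.var 4) (.var 5) (.add (cell 0) (cell 1))) <|
    .seq (.store 1 (.var 4) (.var 5) (.add (cell 1) (.mul (.var 1) (.add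
      (.div (.add (.inA (.var 6) (.var 4) (.var 5)) (.inA (.var 6) (.var 5) (.var 4))) (.const 2))
      (.mul (.var 7) (.mul (outer 4) (inner 4))))))) <|
    .setReal 3 (.add (.var 3) (.mul (cell 1) (cell 1))))) <|
  .seq (.setReal 8 (.const 1)) <|
  .seq (.ite (.realLt (.const 1) (.var 3)) (.setReal 8 (.sqrt (.var 3))) .skip) <|
  pairLoop (.store 1 (.var 4) (.var 5) (.div (cell 1) (.var 8)))

/-- The gradient step at a cell uses the old point at that cell only, so it can be done in place,
once the old value has been added to the sum. The same pass accumulates the norm for the projection.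
-/
theorem Runs.primalCmd {X Z : Matrix (Fin n) (Fin n) ℝ} (hX : ∀ j l : Fin n, s.arr 1 j l = X j l)
    (hZ : ∀ j l : Fin n, s.arr 0 j l = Z j l) {v : Fin n → ℝ} (hv : ∀ j : Fin n, s.arr 4 j 0 = v j)
    (hz : s.real 7 = penalty X v) {I : Fin (m + 1)} (hI : s.nat 6 = I) {β : ℝ} (hβ : s.real 1 = β) :
    Runs S ε ω primalCmd s ((n + 1) * ((n + 1) * 200))
      (fun s' => Frame [4, 5] [3, 8] [0, 1] 0 s s' ∧ (∀ j l : Fin n, s'.arr 0 j l = (Z + X) j l) ∧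
        ∀ j l : Fin n, s'.arr 1 j l = ballProj (ascent (S.extA I) X β v) j l) := by
  set Y := ascent (S.extA I) X β v with hY
  have key : Runs S ε ω RealRAM.primalCmd s (2 + ((n + 1) * ((n + 1) * ((10 + (30 + 10)) + 22)) +
      (2 + ((1 + 3 + (3 + 1)) + (n + 1) * ((n + 1) * (8 + 22))))))
      (fun s' => Frame [4, 5] [3, 8] [0, 1] 0 s s' ∧ (∀ j l : Fin n, s'.arr 0 j l = (Z + X) j l) ∧
        ∀ j l : Fin n, s'.arr 1 j l = ballProj Y j l) := by
    refine Runs.seq (Q' := fun s' => Frame [4, 5] [3, 8] [0, 1] 0 s s' ∧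
      (∀ a i j, s'.arr a i j = s.arr a i j) ∧ s'.real 3 = 0)
      (Runs.setReal ⟨Frame.refl.setReal (by simp) _, by simp, by simp [RealExpr.eval]⟩) ?_
    rintro s1 ⟨F1, h1a, h13⟩
    refine Runs.seq (Q' := fun s' => Frame [4, 5] [3, 8] [0, 1] 0 s s' ∧
      (∀ j l : Fin n, s'.arr 0 j l = (Z + X) j l) ∧ (∀ j l : Fin n, s'.arr 1 j l = Y j l) ∧
      s'.real 3 = matDot Y Y) ?_ ?_
    · refine (Runs.pairLoop (rs := [3]) (as := [0, 1]) (B := 10 + (30 + 10)) 3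
        (fun a => if a = 0 then Z + X else Y)
        (fun j l => Y j l * Y j l) fun j l s2 hs2 hs2' F2 h2 => ?_).imp
        fun s' h => ⟨F1.trans (h.1.mono (by simp) (by simp) (by simp)), fun j l => by
          simpa using h.2.1 0 (by simp) j l, fun j l => by simpa using h.2.1 1 (by simp) j l, by
          rw [h.2.2, h13, zero_add]; rfl⟩
      refine Runs.seq (Q' := fun s' => Frame [] [3] [0, 1] 0 s2 s' ∧ (∀ j' l' : Fin n,
        s'.arr 0 j' l' = if j' = j ∧ l' = l then (Z + X) j l else s2.arr 0 j' l') ∧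
        (∀ a, a ≠ 0 → ∀ i j, s'.arr a i j = s2.arr a i j) ∧ s'.real 3 = s2.real 3)
        (Runs.store ⟨Frame.refl.store (by simp) _ _ _, fun j' l' => ?_, fun a ha i j => ?_, rfl⟩) ?_
      · simp [NatExpr.eval, RealExpr.eval, cell, hs2, hs2', Fin.ext_iff, h2 0, h2 1, h1a, hX, hZ]
      · simp [ha]
      rintro s3 ⟨F3, h30, h3a, h33⟩
      refine Runs.seq (Q' := fun s' => Frame [] [3] [0, 1] 0 s2 s' ∧ (∀ j' l' : Fin n,
        s'.arr 0 j' l' = if j' = j ∧ l' = l then (Z + X) j l else s2.arr 0 j' l') ∧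
        (∀ j' l' : Fin n,
          s'.arr 1 j' l' = if j' = j ∧ l' = l then Y j l else s2.arr 1 j' l') ∧
        s'.real 3 = s2.real 3)
        (Runs.store ⟨F3.store (by simp) _ _ _, fun j' l' => ?_, fun j' l' => ?_, h33⟩) ?_
      · simp [h30]
      · simp [NatExpr.eval, RealExpr.eval, cell, outer, inner, F3.nat 4, F3.nat 5, F3.nat 6,
          F3.real 1, F3.real 7, F3.arr 4, hs2, hs2', Fin.ext_iff, h3a, F2.real 1, F2.real 7,
          F2.nat 6, F2.arr 4, h2 1, F1.nat 6, F1.real 1, F1.real 7, h1a, hv, hX, hI, hβ, hz,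
          hY, ascent, SDP.extA]
      rintro s4 ⟨F4, h40, h41, h43⟩
      refine Runs.setReal ⟨F4.setReal (by simp) _, fun a ha j' l' => ?_, ?_⟩
      · have ha : a = 0 ∨ a = 1 := by simpa using ha
        rcases ha with rfl | rfl
        · simp [h40]
        · simp [h41]
      · simp [RealExpr.eval, NatExpr.eval, cell, F4.nat 4, F4.nat 5, hs2, hs2', h41, h43]
    rintro s2 ⟨F2, h20, h21, h23⟩
    refine Runs.seq (Q' := fun s' => Frame [4, 5] [3, 8] [0, 1] 0 s s' ∧
      (∀ j l : Fin n, s'.arr 0 j l = (Z + X) j l) ∧ (∀ j l : Fin n, s'.arr 1 j l = Y j l) ∧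
      s'.real 3 = matDot Y Y ∧ s'.real 8 = 1)
      (Runs.setReal ⟨F2.setReal (by simp) _, h20, h21, by simp [h23], by
        simp [RealExpr.eval]⟩) ?_
    rintro s3 ⟨F3, h30, h31, h33, h38⟩
    refine Runs.seq (Q' := fun s' => Frame [4, 5] [3, 8] [0, 1] 0 s s' ∧
      (∀ j l : Fin n, s'.arr 0 j l = (Z + X) j l) ∧ (∀ j l : Fin n, s'.arr 1 j l = Y j l) ∧
      s'.real 8 = ballDiv (matDot Y Y))
      (Runs.ite (B := 3) (B' := 1) (fun ht => Runs.setReal ?_) (fun ht => Runs.skip ?_)) ?_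
    · have ht : 1 < matDot Y Y := by simpa [Test.Holds, RealExpr.eval, h33] using ht
      exact ⟨F3.setReal (by simp) _, h30, h31, by simp [RealExpr.eval, h33, ballDiv, ht]⟩
    · have ht : ¬ 1 < matDot Y Y := by simpa [Test.Holds, RealExpr.eval, h33] using ht
      exact ⟨F3, h30, h31, by rw [h38, ballDiv, if_neg ht]⟩
    rintro s4 ⟨F4, h40, h41, h48⟩
    refine (Runs.pairLoop (rs := []) (as := [1]) (B := 8) 0 (fun _ => ballProj Y) (fun _ _ => 0)
        fun j l s5 hs5 hs5' F5 h5 => Runs.store ⟨Frame.refl.store (by simp) _ _ _,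
          fun a ha j' l' => ?_, by simp⟩).imp fun s' h =>
        ⟨F4.trans (h.1.mono (by simp) (by simp) (by simp)), fun j l => by
          rw [h.1.arr 0 (by simp), h40], h.2.1 1 (by simp)⟩
    obtain rfl := List.mem_singleton.1 ha
    simp [NatExpr.eval, RealExpr.eval, cell, hs5, hs5', Fin.ext_iff, h5 1, h41, F5.real 8, h48,
      ballProj]
  refine key.mono ?_
  have : 1 ≤ (n + 1) * (n + 1) := Nat.one_le_iff_ne_zero.2 (by positivity)
  nlinarith

end RealRAM

end

noncomputable section

/-! ## The program -/

namespace RealRAM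

open Matrix

variable {m n : ℕ} {S : SDP m n} {ε : ℝ} {ω : ℕ → unitInterval} {s : State}

/-- The memory state `s` holds the state `r` of the iteration. -/
structure Holds (r : IterState n (m + 1)) (s : State) : Prop where
  X : ∀ j l : Fin n, s.arr 1 j l = r.X j l
  sum : ∀ j l : Fin n, s.arr 0 j l = r.sum j l
  w : ∀ i : Fin (m + 1), s.arr 2 i 0 = r.w i

/-- The program for one round of the iteration. -/
def roundCmd : Cmd := .seq sampleCmd <| .seq penaltyCmd <| .seq weightCmd primalCmd

/-- All sampling precedes the updates, and the weights are updated before the point is overwritten,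
so both players react to the old state as in `iterStep`. The frames certify that no block disturbs
results still needed. -/
theorem Runs.roundCmd [NeZero n] {r : IterState n (m + 1)} (hr : Holds r s) {k : ℕ}
    (hk : ⌈100 * (s.nat 2 : ℝ) / √(s.real 0)⌉₊ = k) :
    Runs S ε ω roundCmd s (2000 * (m + 2 + (k + 2) * ((n + 1) * (n + 1))))
      (fun s' => Frame [4, 5, 6, 7, 8, 9] [2, 3, 4, 5, 6, 7, 8, 9]
        [0, 1, 2, 3, 4, 5, 6] (n + 3) s s' ∧
        Holds (iterStep S.extA S.extB (s.real 1) k ω s.pos r) s') := by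
  have key : Runs S ε ω RealRAM.roundCmd s (1000 * (m + 2 + (n + 1) * (n + 1)) +
      ((k + 2) * ((n + 1) * ((n + 1) * 400)) + ((m + 2) * 100 + (n + 1) * ((n + 1) * 200))))
      (fun s' => Frame [4, 5, 6, 7, 8, 9] [2, 3, 4, 5, 6, 7, 8, 9]
        [0, 1, 2, 3, 4, 5, 6] (n + 3) s s' ∧
        Holds (iterStep S.extA S.extB (s.real 1) k ω s.pos r) s') := by
    refine Runs.seq (Runs.sampleCmd hr.X hr.w) ?_
    rintro s1 ⟨F1, h16, h17, h18, h19⟩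
    refine Runs.seq (Runs.penaltyCmd (X := r.X) (k := k)
      (fun j l => by rw [F1.arr 1 (by simp), hr.X])
      (by rw [F1.nat 2 (by simp), F1.real 0 (by simp), hk])) ?_
    rintro s2 ⟨F2, h24, h27⟩
    rw [F1.pos] at h24 h27
    refine Runs.seq (Runs.weightCmd (X := r.X) (w := r.w) (J := rowIdx r.X ω (s.pos + 1))
      (L := colIdx r.X ω (s.pos + 1)) (β := s.real 1)
      (fun j l => by rw [F2.arr 1 (by simp), F1.arr 1 (by simp), hr.X])
      (fun j => by rw [F2.arr 2 (by simp), F1.arr 2 (by simp), hr.w])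
      (by rw [F2.nat 7 (by simp), h17]) (by rw [F2.nat 8 (by simp), h18])
      (by rw [F2.real 9 (by simp), h19]) (by rw [F2.real 1 (by simp), F1.real 1 (by simp)])) ?_
    rintro s3 ⟨F3, h32⟩
    refine (Runs.primalCmd (X := r.X) (Z := r.sum) (v := chebVec r.X (startVec n (s.pos + 3) ω) k)
      (I := pick r.w (ω s.pos)) (β := s.real 1)
      (fun j l => by rw [F3.arr 1 (by simp), F2.arr 1 (by simp), F1.arr 1 (by simp), hr.X])
      (fun j l => by rw [F3.arr 0 (by simp), F2.arr 0 (by simp), F1.arr 0 (by simp), hr.sum])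
      (fun j => by rw [F3.arr 4 (by simp), h24]) (by rw [F3.real 7 (by simp), h27])
      (by rw [F3.nat 6 (by simp), F2.nat 6 (by simp), h16])
      (by rw [F3.real 1 (by simp), F2.real 1 (by simp), F1.real 1 (by simp)])).imp ?_
    rintro s4 ⟨F4, h40, h41⟩
    refine ⟨?_, h41, h40, fun i => ?_⟩
    · have := (((F1.mono (ns' := [4, 5, 6, 7, 8, 9]) (rs' := [2, 3, 4, 5, 6, 7, 8, 9])
        (as' := [0, 1, 2, 3, 4, 5, 6]) (by simp) (by simp) (by simp)).trans
        (F2.mono (by simp) (by simp) (by simp))).trans (F3.mono (by simp) (by simp)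
        (by simp))).trans (F4.mono (by simp) (by simp) (by simp))
      rwa [add_zero, add_zero, add_comm] at this
    · rw [F4.arr 2 (by simp), h32]; rfl
  refine key.mono ?_
  nlinarith [Nat.zero_le k, Nat.zero_le m]

/-- The program that prepares the iteration. -/
def initCmd : Cmd := .seq (.setReal 0 .eps) <|
  .seq (.ite (.realLt (.const 1) .eps) (.setReal 0 (.const 1)) .skip) <|
  .seq (.setReal 1 (.div (.var 0) (.const 800))) <| .seq (clogCmd (.add rows rows) 1) <|
  .seq (clogCmd .dim 2) <| .seq (.setNat 0 (.const 0)) <|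
  RealRAM.forLoop 4 rows (.store 2 (.var 4) (.const 0) (.const 1))

theorem clog_two_le_self (M : ℕ) : Nat.clog 2 M ≤ M :=
  (Nat.clog_le_iff_le_pow one_lt_two).2 Nat.lt_two_pow_self.le

theorem Runs.initCmd :
    Runs S ε ω initCmd State.init (200 * (m + 2 + (n + 1) * (n + 1))) (fun s' =>
      s'.pos = 0 ∧ s'.nat 0 = 0 ∧ s'.nat 1 = Nat.clog 2 (m + 1 + (m + 1)) ∧
      s'.nat 2 = Nat.clog 2 n ∧ s'.real 0 = min ε 1 ∧ s'.real 1 = min ε 1 / 800 ∧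
      Holds (⟨fun _ => 1, 0, 0⟩ : IterState n (m + 1)) s') := by
  have key : Runs S ε ω RealRAM.initCmd State.init (2 + ((1 + 3 + (2 + 1)) + (4 +
      ((Nat.clog 2 (m + 1 + (m + 1)) + 1) * 27 + ((Nat.clog 2 n + 1) * 21 + (2 +
      (m + 2) * 17)))))) (fun s' =>
      s'.pos = 0 ∧ s'.nat 0 = 0 ∧ s'.nat 1 = Nat.clog 2 (m + 1 + (m + 1)) ∧
      s'.nat 2 = Nat.clog 2 n ∧ s'.real 0 = min ε 1 ∧ s'.real 1 = min ε 1 / 800 ∧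
      Holds (⟨fun _ => 1, 0, 0⟩ : IterState n (m + 1)) s') := by
    refine Runs.seq (Q' := fun s' => Frame [0, 1, 2, 3, 4] [0, 1] [2] 0 State.init s' ∧
      s'.real 0 = ε) (Runs.setReal ⟨Frame.refl.setReal (by simp) _, by simp [RealExpr.eval]⟩) ?_
    rintro s1 ⟨F1, h10⟩
    refine Runs.seq (Q' := fun s' => Frame [0, 1, 2, 3, 4] [0, 1] [2] 0 State.init s' ∧
      s'.real 0 = min ε 1) (Runs.ite (B := 2) (B' := 1) (fun ht => Runs.setReal ?_)
        (fun ht => Runs.skip ?_)) ?_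
    · have ht : 1 < ε := by simpa [Test.Holds, RealExpr.eval] using ht
      exact ⟨F1.setReal (by simp) _, by simp [RealExpr.eval, min_eq_right ht.le]⟩
    · have ht : ε ≤ 1 := by simpa [Test.Holds, RealExpr.eval] using ht
      exact ⟨F1, by rw [h10, min_eq_left ht]⟩
    rintro s2 ⟨F2, h20⟩
    refine Runs.seq (Q' := fun s' => Frame [0, 1, 2, 3, 4] [0, 1] [2] 0 State.init s' ∧
      s'.real 0 = min ε 1 ∧ s'.real 1 = min ε 1 / 800)
      (Runs.setReal ⟨F2.setReal (by simp) _, by simp [h20], by simp [RealExpr.eval, h20]⟩) ?_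
    rintro s3 ⟨F3, h30, h31⟩
    refine Runs.seq (Q' := fun s' => Frame [0, 1, 2, 3, 4] [0, 1] [2] 0 State.init s' ∧
      s'.real 0 = min ε 1 ∧ s'.real 1 = min ε 1 / 800 ∧ s'.nat 1 = Nat.clog 2 (m + 1 + (m + 1)))
      ((Runs.clogCmd (fun _ => rfl) (by simp)).imp fun s' h =>
        ⟨F3.trans (h.1.mono (by simp) (by simp) (by simp)), by rw [h.1.real 0 (by simp), h30],
          by rw [h.1.real 1 (by simp), h31], h.2⟩) ?_
    rintro s4 ⟨F4, h40, h41, h4⟩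
    refine Runs.seq (Q' := fun s' => Frame [0, 1, 2, 3, 4] [0, 1] [2] 0 State.init s' ∧
      s'.real 0 = min ε 1 ∧ s'.real 1 = min ε 1 / 800 ∧
      s'.nat 1 = Nat.clog 2 (m + 1 + (m + 1)) ∧ s'.nat 2 = Nat.clog 2 n)
      ((Runs.clogCmd (fun _ => rfl) (by simp)).imp fun s' h =>
        ⟨F4.trans (h.1.mono (by simp) (by simp) (by simp)), by rw [h.1.real 0 (by simp), h40],
          by rw [h.1.real 1 (by simp), h41], by rw [h.1.nat 1 (by simp), h4], h.2⟩) ?_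
    rintro s5 ⟨F5, h50, h51, h5, h52⟩
    refine Runs.seq (Q' := fun s' => Frame [0, 1, 2, 3, 4] [0, 1] [2] 0 State.init s' ∧
      s'.real 0 = min ε 1 ∧ s'.real 1 = min ε 1 / 800 ∧
      s'.nat 1 = Nat.clog 2 (m + 1 + (m + 1)) ∧ s'.nat 2 = Nat.clog 2 n ∧ s'.nat 0 = 0)
      (Runs.setNat ⟨F5.setNat (by simp) _, h50, h51, by simp [h5], by simp [h52], by
        simp [NatExpr.eval]⟩) ?_
    rintro s6 ⟨F6, h60, h61, h6, h62, h6n⟩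
    refine (Runs.fillLoop (x := 4) (N := m + 1) (d := 0) (e := rows) (ns := [4]) (rs := [])
      (as := [2]) (B := 4) (fun _ => rfl) (by simp) (fun _ _ => 1)
      fun i s7 hs7 _ _ => Runs.store ⟨hs7, Frame.refl.store (by simp) _ _ _, fun a ha j => ?_⟩).imp
      fun s' h => ⟨by simp [h.1.pos, F6.pos, State.init], by rw [h.1.nat 0 (by simp), h6n], by
        rw [h.1.nat 1 (by simp), h6], by rw [h.1.nat 2 (by simp), h62], by
        rw [h.1.real 0 (by simp), h60], by rw [h.1.real 1 (by simp), h61],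
        fun j l => by rw [h.1.arr 1 (by simp), F6.arr 1 (by simp)]; rfl,
        fun j l => by rw [h.1.arr 0 (by simp), F6.arr 0 (by simp)]; rfl, h.2 2 (by simp)⟩
    obtain rfl := List.mem_singleton.1 ha
    simp [NatExpr.eval, RealExpr.eval, hs7, Fin.ext_iff]
  refine key.mono ?_
  have h1 := clog_two_le_self (m + 1 + (m + 1))
  have h2 := clog_two_le_self n
  nlinarith [Nat.zero_le n]

/-- The program that approximates a solution of a semidefinite feasibility problem. -/
def solveCmd : Cmd := .seq initCmd <|
  .seq (.loop (.realLt (.ofNat (.var 0))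
    (.div (.mul (.const 4000) (.ofNat (.var 1))) (.mul (.var 0) (.var 0))))
    (.seq roundCmd (.setNat 0 (.add (.var 0) (.const 1))))) <|
  pairLoop (.store 0 (.var 4) (.var 5) (.div (cell 0) (.ofNat (.var 0))))

/-- The numbers `k` and `T` do not involve `ω`, so the output identity and the step bound hold for
every tape; chance enters only through the value of `iterOutput`. -/
theorem Runs.solveCmd [NeZero n] {k T : ℕ} (hk : ⌈100 * (Nat.clog 2 n : ℝ) / √(min ε 1)⌉₊ = k)
    (hT : ⌈4000 * (Nat.clog 2 (m + 1 + (m + 1)) : ℝ) / (min ε 1 * min ε 1)⌉₊ = T) :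
    Runs S ε ω solveCmd State.init (3000 * ((T + 2) * (m + 2 + (k + 2) * ((n + 1) * (n + 1)))))
      (fun s' => s'.output n = iterOutput S.extA S.extB (min ε 1 / 800) k T ω) := by
  have hlt : ∀ i : ℕ, (i : ℝ) < 4000 * (Nat.clog 2 (m + 1 + (m + 1)) : ℝ) / (min ε 1 * min ε 1) ↔
      i < T := fun i => by rw [← hT, Nat.lt_ceil]
  set R := 2000 * (m + 2 + (k + 2) * ((n + 1) * (n + 1))) with hR
  have key : Runs S ε ω RealRAM.solveCmd State.init (200 * (m + 2 + (n + 1) * (n + 1)) +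
      ((T + 1) * ((R + 4) + 1 + 11) + (n + 1) * ((n + 1) * (9 + 22))))
      (fun s' => s'.output n = iterOutput S.extA S.extB (min ε 1 / 800) k T ω) := by
    refine Runs.seq Runs.initCmd ?_
    rintro s0 ⟨h0p, h00, h01, h02, h0r, h0r', h0⟩
    refine Runs.seq (Q' := fun s' => (s'.nat 0 = T ∧ s'.nat 1 = Nat.clog 2 (m + 1 + (m + 1)) ∧
      s'.nat 2 = Nat.clog 2 n ∧ s'.real 0 = min ε 1 ∧ s'.real 1 = min ε 1 / 800) ∧
      s'.pos = (n + 3) * T ∧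
      Holds (iterRun S.extA S.extB (min ε 1 / 800) k ω T) s') ?_ ?_
    · refine (Runs.loop (B := R + 4) (N := T) (fun t s' => (s'.nat 0 = t ∧
        s'.nat 1 = Nat.clog 2 (m + 1 + (m + 1)) ∧
        s'.nat 2 = Nat.clog 2 n ∧ s'.real 0 = min ε 1 ∧ s'.real 1 = min ε 1 / 800) ∧
        s'.pos = (n + 3) * t ∧
        Holds (iterRun S.extA S.extB (min ε 1 / 800) k ω t) s')
        ⟨⟨h00, h01, h02, h0r, h0r'⟩, h0p, h0⟩ ?_ ?_).mono (le_of_eq rfl)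
      · rintro t ht s1 ⟨⟨h10, h11, h12, h1r, h1r'⟩, h1p, h1⟩
        refine ⟨by simpa [Test.Holds, RealExpr.eval, NatExpr.eval, h10, h11, h1r] using
          (hlt t).2 ht, Runs.seq (Runs.roundCmd h1 (by rw [h12, h1r, hk])) ?_⟩
        rintro s2 ⟨F2, h2⟩
        rw [h1p, h1r'] at h2
        refine Runs.setNat ⟨⟨by simp [NatExpr.eval, F2.nat 0, h10], by simp [F2.nat 1, h11],
          by simp [F2.nat 2, h12], by simp [F2.real 0, h1r], by simp [F2.real 1, h1r']⟩, by
          simp [F2.pos, h1p]; ring, h2.X, h2.sum, h2.w⟩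
      · rintro s1 ⟨⟨h10, h11, h12, h1r, h1r'⟩, h1p, h1⟩
        have := (hlt T).not.2 (lt_irrefl T)
        simpa [Test.Holds, RealExpr.eval, NatExpr.eval, h10, h11, h1r] using this
    rintro s1 ⟨⟨h10, -⟩, -, h1⟩
    refine (Runs.pairLoop (rs := []) (as := [0]) (B := 9) 0
        (fun _ => iterOutput S.extA S.extB (min ε 1 / 800) k T ω) (fun _ _ => 0)
        fun j l s2 hs2 hs2' F2 h2 => Runs.store ⟨Frame.refl.store (by simp) _ _ _,
          fun a ha j' l' => ?_, by simp⟩).imp fun s' h => ?_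
    · ext j l
      exact h.2.1 0 (by simp) j l
    · obtain rfl := List.mem_singleton.1 ha
      simp [NatExpr.eval, RealExpr.eval, cell, hs2, hs2', Fin.ext_iff, h2 0, h1.sum, F2.nat 0, h10,
        iterOutput]
  refine key.mono ?_
  have h1 : 1 ≤ (n + 1) * (n + 1) := Nat.one_le_iff_ne_zero.2 (by positivity)
  set q := (n + 1) * (n + 1)
  have h2 : (n + 1) * ((n + 1) * (9 + 22)) = 31 * q := by simp only [q]; ring
  set p := m + 2 + (k + 2) * q with hp
  clear_value R p q
  have h3 : m + 2 + q ≤ p := by nlinarith [Nat.zero_le (k * q)]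
  have h4 : 16 ≤ 8 * p := by nlinarith [Nat.zero_le ((k + 2) * q), Nat.zero_le m]
  have h5 : (T + 1) * (R + 4 + 1 + 11) ≤ (T + 1) * (2008 * p) :=
    Nat.mul_le_mul_left _ (by omega)
  rw [h2]
  nlinarith [Nat.zero_le (T * p), Nat.zero_le m]

end RealRAM

end

noncomputable section

/-! ## The extended problem -/

namespace SDP

variable {m n : ℕ} (S : SDP m n)

theorem extA_castSucc (i : Fin m) : S.extA i.castSucc = S.A i := by
  ext j l; simp [extA, entryA]

/-- The index `m` is out of range and random access returns `0` there, so the trivial constraint is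
available without being stored. -/
theorem extA_last : S.extA (Fin.last m) = 0 := by
  ext j l; simp [extA, entryA]

theorem extB_castSucc (i : Fin m) : S.extB i.castSucc = S.b i := by simp [extB, entryB]

theorem extB_last : S.extB (Fin.last m) = 0 := by simp [extB, entryB]

/-- Approximate solutions of the extended problem, with an accuracy of at most `1`, are approximated
solutions. -/
theorem isApproxSolution_of_ext {ε : ℝ} {X : Matrix (Fin n) (Fin n) ℝ}
    (h : ∀ i, S.extB i - min ε 1 ≤ matDot (S.extA i) X)
    (hX : (X + min ε 1 • (1 : Matrix (Fin n) (Fin n) ℝ)).PosSemidef) : S.IsApproxSolution ε X := by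
  refine ⟨fun i => ?_, ?_⟩
  · have := h i.castSucc
    rw [extA_castSucc, extB_castSucc] at this
    linarith [min_le_left ε 1]
  · have h1 : ((ε - min ε 1) • (1 : Matrix (Fin n) (Fin n) ℝ)).PosSemidef :=
      Matrix.PosSemidef.one.smul (sub_nonneg.2 (min_le_left ε 1))
    have h2 := hX.add h1
    rwa [add_assoc, ← add_smul, add_sub_cancel] at h2

end SDP

/-! ## The running time -/

/-- The `+ 1` from rounding up is absorbed by `log 2 ≤ log m`, and `1 / log 2 ≤ 3/2`. -/
theorem clog_le_log {M m : ℕ} {c : ℝ} (hm : 2 ≤ m) (hM : 0 < M) (hMm : Real.log M ≤ c * Real.log m) :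
    (Nat.clog 2 M : ℝ) ≤ 3 / 2 * (c + 1) * Real.log m := by
  have h2 := Real.log_two_gt_d9
  have hm' : Real.log 2 ≤ Real.log m := Real.log_le_log two_pos (by exact_mod_cast hm)
  have h1 : (Nat.clog 2 M : ℝ) < Real.logb 2 M + 1 := by
    have := Nat.ceil_lt_add_one (Real.logb_nonneg one_lt_two
      (show (1 : ℝ) ≤ M by exact_mod_cast hM))
    rwa [show (2 : ℝ) = ((2 : ℕ) : ℝ) by norm_num, Real.natCeil_logb_natCast] at this
  have h3 : Real.logb 2 M + 1 ≤ (c + 1) * Real.log m / Real.log 2 := by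
    rw [Real.logb, le_div_iff₀ (by linarith), add_mul, div_mul_cancel₀ _ (by linarith)]
    linarith
  have h0 : 0 ≤ (c + 1) * Real.log m := by
    have : 0 ≤ Real.log M := Real.log_natCast_nonneg M
    linarith
  have h4 : (c + 1) * Real.log m / Real.log 2 ≤ 3 / 2 * (c + 1) * Real.log m := by
    rw [div_le_iff₀ (by linarith)]
    nlinarith
  linarith

theorem clog_two_rows_le {m : ℕ} (hm : 2 ≤ m) :
    (Nat.clog 2 (m + 1 + (m + 1)) : ℝ) ≤ 6 * Real.log m := by
  have h := clog_le_log (M := m + 1 + (m + 1)) (c := 3) hm (by omega) (by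
    rw [show (3 : ℝ) * Real.log m = Real.log ((m : ℝ) ^ 3) by rw [Real.log_pow]; norm_num]
    refine Real.log_le_log (by positivity) ?_
    have : m + 1 + (m + 1) ≤ m ^ 3 := by
      have : 4 ≤ m ^ 2 := by nlinarith
      nlinarith
    exact_mod_cast this)
  linarith

theorem clog_two_dim_le {n : ℕ} (hn : 1 ≤ n) : (Nat.clog 2 n : ℝ) ≤ 3 * Real.log n := by
  rcases hn.eq_or_lt with rfl | hn
  · simp
  · have h := clog_le_log (M := n) (c := 1) hn (by omega) (by simp)
    linarith

/-- The number of steps of the program in terms of the size of the problem. -/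
theorem steps_le {m n k T : ℕ} {ε : ℝ} (hm : 2 ≤ m) (hn : 1 ≤ n) (hε : 0 < ε) (hε1 : ε ≤ 1)
    (hk : ⌈100 * (Nat.clog 2 n : ℝ) / √ε⌉₊ = k)
    (hT : ⌈4000 * (Nat.clog 2 (m + 1 + (m + 1)) : ℝ) / (ε * ε)⌉₊ = T) :
    ((3000 * ((T + 2) * (m + 2 + (k + 2) * ((n + 1) * (n + 1)))) : ℕ) : ℝ) ≤
      (3000 * 24006 * 1224) * (m * Real.log m / ε ^ 2 +
          (n : ℝ) ^ 2 * Real.log m * Real.log n / ε ^ (5 / 2 : ℝ)) := by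
  have hpow : ε ^ (5 / 2 : ℝ) = ε ^ 2 * √ε := by
    rw [show (5 / 2 : ℝ) = (2 : ℕ) + 1 / 2 by norm_num, Real.rpow_add hε, Real.rpow_natCast,
      Real.sqrt_eq_rpow]
  have hs : 0 < √ε := Real.sqrt_pos.2 hε
  have hs1 : √ε ≤ 1 := Real.sqrt_le_one.2 hε1
  have h2 := Real.log_two_gt_d9
  have hlm : 1 / 2 ≤ Real.log m := by
    have : Real.log 2 ≤ Real.log m := Real.log_le_log two_pos (by exact_mod_cast hm)
    linarith
  have hln : 0 ≤ Real.log n := Real.log_natCast_nonneg n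
  have hm' : (2 : ℝ) ≤ m := by exact_mod_cast hm
  -- `4000 * 6 = 24000`, and the extra `3` from rounding and the `+ 2` is at most `6` times `log m /
  -- ε² ≥ 1/2`.
  have hTb : (T : ℝ) + 2 ≤ 24006 * (Real.log m / ε ^ 2) := by
    have h1 : (T : ℝ) < 4000 * (Nat.clog 2 (m + 1 + (m + 1)) : ℝ) / (ε * ε) + 1 := by
      rw [← hT]; exact Nat.ceil_lt_add_one (by positivity)
    have h3 : 4000 * (Nat.clog 2 (m + 1 + (m + 1)) : ℝ) / (ε * ε) ≤
        24000 * (Real.log m / ε ^ 2) := by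
      rw [← pow_two, mul_div_assoc', div_le_div_iff_of_pos_right (by positivity)]
      linarith [clog_two_rows_le hm]
    have h4 : 1 / 2 ≤ Real.log m / ε ^ 2 := by
      rw [le_div_iff₀ (by positivity)]; nlinarith
    linarith
  have hkb : (m : ℝ) + 2 + (k + 2) * ((n + 1) * (n + 1)) ≤
      1224 * (m + (n : ℝ) ^ 2 * Real.log n / √ε) := by
    -- For `n = 1` the term with `log n` is `0`, so the `m` term must absorb everything; this works
    -- because then `k = 0`.
    rcases hn.eq_or_lt with rfl | hn
    · have : k = 0 := by rw [← hk]; simp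
      subst this
      norm_num
      linarith
    · have hln2 : 1 / 2 ≤ Real.log n := by
        have : Real.log 2 ≤ Real.log n := Real.log_le_log two_pos (by exact_mod_cast hn)
        linarith
      have h1 : (k : ℝ) < 100 * (Nat.clog 2 n : ℝ) / √ε + 1 := by
        rw [← hk]; exact Nat.ceil_lt_add_one (by positivity)
      have h3 : 100 * (Nat.clog 2 n : ℝ) / √ε ≤ 300 * (Real.log n / √ε) := by
        rw [mul_div_assoc', div_le_div_iff_of_pos_right hs]
        linarith [clog_two_dim_le hn.le]
      have h4 : 1 / 2 ≤ Real.log n / √ε := by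
        rw [le_div_iff₀ hs]; nlinarith
      -- As for `T`, with `306 = 300 + 6`; then `306 * 4 = 1224` from `(n + 1)² ≤ 4 n²`.
      have h5 : (k : ℝ) + 2 ≤ 306 * (Real.log n / √ε) := by linarith
      have hn' : (2 : ℝ) ≤ n := by exact_mod_cast hn
      have h6 : ((n : ℝ) + 1) * (n + 1) ≤ 4 * (n : ℝ) ^ 2 := by nlinarith
      have h7 : ((k : ℝ) + 2) * (((n : ℝ) + 1) * (n + 1)) ≤
          306 * (Real.log n / √ε) * (4 * (n : ℝ) ^ 2) :=
        mul_le_mul h5 h6 (by positivity) (by positivity)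
      have h8 : 306 * (Real.log n / √ε) * (4 * (n : ℝ) ^ 2) =
          1224 * ((n : ℝ) ^ 2 * Real.log n / √ε) := by ring
      linarith
  push_cast
  calc (3000 : ℝ) * ((T + 2) * (m + 2 + (k + 2) * ((n + 1) * (n + 1))))
      ≤ 3000 * (24006 * (Real.log m / ε ^ 2) * (1224 * (m + (n : ℝ) ^ 2 * Real.log n / √ε))) := by
        gcongr
    _ = _ := by rw [hpow]; field_simp

end

/-! ### The theorem -/

theorem theorem1 :
    ∃ (P : RealRAM.Cmd) (C : ℝ), ∀ (m n : ℕ) (ε : ℝ) (S : SDP m n),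
      1 ≤ m → 1 ≤ n → 0 < ε →
      (∀ i, ‖S.A i‖ ≤ 1) → (∀ i, |S.b i| ≤ 1) →
      (∃ X : Matrix (Fin n) (Fin n) ℝ, S.IsFeasible X ∧ ‖X‖ ≤ 1) →
      -- the output is an `ε`-approximated solution with probability at least `1/2`
      1 / 2 ≤ RealRAM.uniformTape {ω | ∃ (t : ℕ) (s : RealRAM.State),
        RealRAM.Exec S ε ω P RealRAM.State.init t s ∧ S.IsApproxSolution ε (s.output n)} ∧
      -- the running time, for all outcomes of the random numbers
      (2 ≤ m → ε ≤ 1 → ∀ ω : ℕ → unitInterval, ∃ (t : ℕ) (s : RealRAM.State),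
        RealRAM.Exec S ε ω P RealRAM.State.init t s ∧
        (t : ℝ) ≤ C * (m * Real.log m / ε ^ 2 +
          (n : ℝ) ^ 2 * Real.log m * Real.log n / ε ^ (5 / 2 : ℝ))) := by
  refine ⟨RealRAM.solveCmd, 3000 * 24006 * 1224, ?_⟩
  rintro m n ε S - hn hε hA hb ⟨U, hU, hU1⟩
  have : NeZero n := ⟨by omega⟩
  have hε' : 0 < min ε 1 := lt_min hε one_pos
  refine ⟨?_, fun hm hε1 ω => ?_⟩
  -- The iteration is analysed for accuracy at most `1`, so a larger `ε` is replaced by `1`, which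
  -- only strengthens the conclusion.
  · have h := half_le_uniformTape_iterOutput (a := S.extA) (b := S.extB) (i₀ := Fin.last m)
      (U := U) (ε := min ε 1) (L := Nat.clog 2 (m + 1 + (m + 1))) (Ln := Nat.clog 2 n)
      (k := ⌈100 * (Nat.clog 2 n : ℝ) / √(min ε 1)⌉₊)
      (T := ⌈4000 * (Nat.clog 2 (m + 1 + (m + 1)) : ℝ) / (min ε 1 * min ε 1)⌉₊)
      (fun i => ?_) (fun i => ?_) S.extA_last S.extB_last hU.1 (matDot_self_le_one hU1)
      (fun i => ?_) hε' (min_le_right ε 1) (Nat.le_pow_clog one_lt_two n) (Nat.le_ceil _)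
      (by rw [two_mul]; exact Nat.le_pow_clog one_lt_two _) (by rw [pow_two]; exact Nat.le_ceil _)
    · refine h.trans (measure_mono fun ω hω => ?_)
      obtain ⟨t, s, h1, -, h3⟩ := RealRAM.Runs.solveCmd (S := S) (ε := ε) (ω := ω) rfl rfl
      exact ⟨t, s, h1, h3 ▸ S.isApproxSolution_of_ext hω.1 hω.2⟩
    · refine Fin.lastCases ?_ (fun i => ?_) i
      · rw [S.extA_last]; simp [matDot]
      · rw [S.extA_castSucc]; exact matDot_self_le_one (hA i)
    · refine Fin.lastCases ?_ (fun i => ?_) i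
      · rw [S.extB_last]; simp
      · rw [S.extB_castSucc]; exact hb i
    · refine Fin.lastCases ?_ (fun i => ?_) i
      · rw [S.extA_last, S.extB_last]; simp [matDot]
      · rw [S.extA_castSucc, S.extB_castSucc]; exact hU.2 i
  · obtain ⟨t, s, h1, h2, -⟩ := RealRAM.Runs.solveCmd (S := S) (ε := ε) (ω := ω) rfl rfl
    refine ⟨t, s, h1, le_trans (Nat.cast_le.2 h2) ?_⟩
    rw [min_eq_left hε1]
    exact steps_le hm hn hε hε1 rfl rfl
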